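/- Let $n\ge 1$, let $M\subset\mathbb C$ be a simply connected domain containing $0$, and let $\varphi$ be holomorphic on $M$ with a zero of order $n$ at $0$ and no other zero. Endow $M$ with the flat metric $ds^2=|\varphi|\,|dz|^2$ of the quadratic differential $\varphi\,dz^2$, which has a cone point of angle $(n+2)\pi$ at $0$. A foliation of $M\setminus\{0\}$ is called $\varphi$-geodesic if every leaf consists of shortest arcs of this metric, i.e. each point of a leaf lies in the interior of an arc of the leaf that is shortest in $M$ between its endpoints. Consider finite words in the symbols $h$ and $p$, where $h$ has weight $2\pi/(n+2)$ and each occurrence of $p$ carries a weight $\alpha>0$; the weight of a word is the sum of the weights of its symbols. Two words are equivalent if they are connected by cyclic permutations and by the contraction $p\,p=p$ (under which the weights add) and its inverse. A class $[w]$ is normalized if its words have weight $2\pi$. The singularity $w$ of a word $w$ of weight $2\pi$ is the foliation of $\mathbb C\setminus\{0\}$ obtained by placing around $0$, clockwise and in the order of the symbols of $w$, sectors whose angles are the weights of the symbols, where a sector for $p$ is filled by radii (parabolic sector), and a sector for $h$ is bounded by two radii and filled by the hyperbolas $r^{(n+2)/2}\sin\left(\tfrac{n+2}{2}\delta\right)=\mathrm{const}>0$,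 with $\delta$ the angle from the first boundary radius (hyperbolic sector). (i) For each $\varphi$-geodesic foliation $\mathcal F$ of $M\setminus\{0\}$ there is a normalized class such that, for every word $w$ in it, $\mathcal F$ is near $0$ topologically equivalent to the singularity $w$, up to a rotation of the latter: there is a homeomorphism $\Psi$ between neighborhoods of $0$ with $\Psi(0)=0$ that takes $\mathcal F$ to this singularity. Moreover $\Psi$ can be chosen with complex derivative $1$ at $0$, so that the sectors of $\mathcal F$ occur in the clockwise order of the symbols of $w$ and sweep at $0$ angles equal to their weights. (ii) Conversely, for each normalized class there are a simply connected domain $U\subset M$ containing $0$ and a $\varphi$-geodesic foliation $\mathcal F$ of $U\setminus\{0\}$ that is near $0$ equivalent, in the sense of (i), to the singularity $w$ for every word $w$ of the class. -/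

import Mathlib

open Set Filter Topology

noncomputable section

namespace QuadDiff

/-! ### The flat metric of a holomorphic quadratic differential -/

/-- `M` is a simply connected domain of the complex plane, and `φ` is holomorphic on `M` and
vanishes there only at `0`, to the order `n`. -/
structure IsZeroNbhd (φ : ℂ → ℂ) (n : ℕ) (M : Set ℂ) : Prop where
  isOpen : IsOpen M
  simplyConnected : IsSimplyConnected M
  zero_mem : (0 : ℂ) ∈ M
  holomorphic : DifferentiableOn ℂ φ M
  zero_iff : ∀ z ∈ M, φ z = 0 ↔ z = 0
  order : analyticOrderAt φ 0 = n

/-- `γ`, restricted to `[0, 1]`, is a `C¹` path in `M` from `p` to `q`.  The velocity may vanish,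
so piecewise `C¹` paths are covered up to reparametrization. -/
structure IsPath (M : Set ℂ) (p q : ℂ) (γ : ℝ → ℂ) : Prop where
  contDiffOn : ContDiffOn ℝ 1 γ (Icc 0 1)
  mapsTo : MapsTo γ (Icc 0 1) M
  source : γ 0 = p
  target : γ 1 = q

/-- The length of a path in the metric `ds² = |φ| |dz|²` defined by `φ dz²`. -/
def length (φ : ℂ → ℂ) (γ : ℝ → ℂ) : ℝ :=
  ∫ t in (0 : ℝ)..1, √‖φ (γ t)‖ * ‖derivWithin γ (Icc 0 1) t‖

/-- `A` is a shortest arc in `M` from `p` to `q` for the `φ`-metric. -/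
def IsShortestArc (φ : ℂ → ℂ) (M : Set ℂ) (p q : ℂ) (A : Set ℂ) : Prop :=
  ∃ γ, IsPath M p q γ ∧ γ '' Icc 0 1 = A ∧ ∀ η, IsPath M p q η → length φ γ ≤ length φ η

/-! ### Foliations -/

/-- A (topological) one-dimensional foliation of an open set `U` of the plane: an atlas of flow
boxes whose transition maps are locally of the form `(x, y) ↦ (f (x, y), g y)`, with `g` injective.
The plaques are the horizontal segments `y = const` of the flow boxes. -/
structure Foliation (U : Set ℂ) where
  atlas : Set (OpenPartialHomeomorph ℂ (ℝ × ℝ))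
  source_subset : ∀ e ∈ atlas, e.source ⊆ U
  cover : ∀ z ∈ U, ∃ e ∈ atlas, z ∈ e.source
  target_eq : ∀ e ∈ atlas, ∃ a b c d : ℝ, e.target = Ioo a b ×ˢ Ioo c d
  compatible : ∀ e ∈ atlas, ∀ e' ∈ atlas, ∀ z ∈ e.source ∩ e'.source,
    ∀ᶠ q : ℂ × ℂ in 𝓝 (z, z), (e q.1).2 = (e q.2).2 ↔ (e' q.1).2 = (e' q.2).2

/-- The leaf through `z`: the points that a finite chain of plaques joins to `z`. -/
def Foliation.leaf {U : Set ℂ} (F : Foliation U) (z : ℂ) : Set ℂ :=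
  {z' | Relation.EqvGen
    (fun a b => ∃ e ∈ F.atlas, a ∈ e.source ∧ b ∈ e.source ∧ (e a).2 = (e b).2) z z'}

/-- Every leaf is a `φ`-geodesic line, that is, it consists of shortest arcs for the `φ`-metric
of `M`: every point of the leaf lies in the interior of an arc of the leaf which is shortest. -/
def Foliation.IsGeodesic {U : Set ℂ} (F : Foliation U) (φ : ℂ → ℂ) (M : Set ℂ) : Prop :=
  ∀ z₀ ∈ U, ∀ z ∈ F.leaf z₀, ∀ e ∈ F.atlas, z ∈ e.source →
    ∃ s t : ℝ, s < (e z).1 ∧ (e z).1 < t ∧ Icc s t ×ˢ {(e z).2} ⊆ e.target ∧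
      IsShortestArc φ M (e.symm (s, (e z).2)) (e.symm (t, (e z).2))
        (e.symm '' (Icc s t ×ˢ {(e z).2}))

/-! ### Words -/

/-- The symbols `h` and `p`; a symbol `p` carries its weight, a positive real. -/
inductive Letter : Type
  | h : Letter
  | p (α : {x : ℝ // 0 < x}) : Letter

/-- The weight of a symbol. -/
def Letter.weight (n : ℕ) : Letter → ℝ
  | .h => 2 * Real.pi / (n + 2)
  | .p α => α

/-- Finite words in the symbols `h` and `p`. -/
abbrev Word : Type := List Letter

/-- The weight of a word is the sum of the weights of its symbols. -/
def wordWeight (n : ℕ) (w : Word) : ℝ := (w.map (Letter.weight n)).sum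

/-- The elementary operations on words: cyclic permutation, and the contraction `p² = p`, under
which weights add up. -/
inductive ElemOp : Word → Word → Prop
  | rotate (u v : Word) : ElemOp (u ++ v) (v ++ u)
  | contract (u v : Word) (α β : {x : ℝ // 0 < x}) :
      ElemOp (u ++ Letter.p α :: Letter.p β :: v) (u ++ Letter.p (α + β) :: v)

/-- Equivalence of words, generated by the elementary operations. -/
def wordSetoid : Setoid Word := Relation.EqvGen.setoid ElemOp

/-- Equivalence classes `[w]` of words. -/
abbrev WordClass : Type := Quotient wordSetoid

/-- The class of a word. -/
def Word.toClass (w : Word) : WordClass := Quotient.mk wordSetoid w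

/-- The class is normalized: all its words have weight `2π`. -/
def WordClass.IsNormalized (n : ℕ) (c : WordClass) : Prop :=
  ∀ w : Word, w.toClass = c → wordWeight n w = 2 * Real.pi

/-! ### The singularity encoded by a word -/

/-- `a` and `b` lie on the same leaf in the model sector of type `s`, which starts at the ray of
argument `θ` and sweeps clockwise the angle `s.weight n`.  A parabolic sector is filled by
radii `δ = const`; a hyperbolic sector, of angle `2π/(n+2)`, by the hyperbolas
`r ^ ((n+2)/2) * sin ((n+2)/2 * δ) = const > 0`, while the value `0` gives its boundary radii. -/
def SectorRel (n : ℕ) (θ : ℝ) (s : Letter) (a b : ℂ) : Prop :=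
  ∃ r r' δ δ' : ℝ, 0 < r ∧ 0 < r' ∧ δ ∈ Icc 0 (s.weight n) ∧ δ' ∈ Icc 0 (s.weight n) ∧
    a = r * Complex.exp ((θ - δ : ℝ) * Complex.I) ∧
    b = r' * Complex.exp ((θ - δ' : ℝ) * Complex.I) ∧
    match s with
    | .h => r ^ (((n : ℝ) + 2) / 2) * Real.sin (((n : ℝ) + 2) / 2 * δ) =
        r' ^ (((n : ℝ) + 2) / 2) * Real.sin (((n : ℝ) + 2) / 2 * δ')
    | .p _ => δ = δ'

/-- The singularity with word `w`: model sectors are placed around `0`, clockwise from the ray of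
argument `θ`, in the order of the symbols of `w`; two points are related if some sector contains
both, on the same level.  Near a point other than `0`, the related points are those on a common
plaque. -/
def ModelRel (n : ℕ) : ℝ → Word → ℂ → ℂ → Prop
  | _, [], _, _ => False
  | θ, s :: w, a, b => SectorRel n θ s a b ∨ ModelRel n (θ - s.weight n) w a b

/-- Near `0` the foliation `F` is topologically equivalent to the singularity `w`: a homeomorphism
`Ψ` between neighborhoods of `0`, fixing `0`, takes the plaques of `F` to those of the model.
Moreover `Ψ` has complex derivative `1` at `0`, so that it preserves orientation and the directions
at `0`: the sectors of `F` sweep at `0` angles equal to the weights of the symbols. -/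
def Foliation.HasSingularity {U : Set ℂ} (F : Foliation U) (n : ℕ) (w : Word) : Prop :=
  ∃ (θ : ℝ) (Ψ : OpenPartialHomeomorph ℂ ℂ),
    (0 : ℂ) ∈ Ψ.source ∧ Ψ 0 = 0 ∧ Ψ.source \ {0} ⊆ U ∧ HasDerivAt Ψ 1 0 ∧
    ∀ z ∈ Ψ.source \ {0}, ∀ e ∈ F.atlas, z ∈ e.source →
      ∀ᶠ q : ℂ × ℂ in 𝓝 (z, z), (e q.1).2 = (e q.2).2 ↔ ModelRel n θ w (Ψ q.1) (Ψ q.2)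

end QuadDiff

end

namespace QuadDiff

/-! ### Charts, arcs and plaques -/

/-! In a coordinate ζ tangent to the identity at 0, φ dz² becomes ζ^n dζ² up to a constant factor
(`exists_isNatCoord`). With k = (n+2)/2, the branches of W = (exp(-iμ) ζ)^k on sectors are then
isometric charts up to scale (`IsNatCoord.isFlatChart`). In such charts short straight segments are
shortest and shortest arcs are straight near interior points (`IsFlatChart.isShortestArc`,
`IsFlatChart.exists_segment_subset`).

The leaves of a model singularity are straight in these charts: a radius stays a radius, and a
hyperbolic sector unrolls to the half-plane Re W > 0, its hyperbolas becoming the lines Re W =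
const. Pulling the model back by ζ therefore gives a geodesic foliation, with ζ itself as the
homeomorphism Ψ. This proves (ii).

For (i), the leaf through a point has one direction in each chart. This direction persists along the
straight line as long as the line stays in the chart, and it passes to limits
(`LeafDir.eq_real_mul`, `LeafDir.add_mul`, `LeafDir.of_tendsto`). Suppose that a ray from 0 is not a
leaf. The leaves through points of the ray tending to 0 are straight lines crossing it, and a limit
of them is a line through 0 in the W-plane, whose two halves are radial leaves. They enclose the
angle π in the W-plane, that is π/k = 2π/(n+2) at 0, and a radial leaf between them would cross the
approximating lines. So every nonradial direction lies in a gap of exactly this width, bounded by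
radial leaves (`IsNatCoord.exists_isGap`). Gaps do not overlap, so finitely many fit into a full
turn, and their order around 0 spells the word (`IsNatCoord.exists_word`).

It remains to make the leaves in a gap vertical in the W-plane. They have directions m + i, and
since they cannot meet the bounding radial leaves inside the chart, |m| ≤ 2 Re W / ρ^k near 0
(`IsGap.exists_slope`). The shear W ↦ W - m Im W takes each leaf to the vertical line through its
intersection with the axis of the gap. By the slope bound the relative displacement vanishes at the
boundary of the gap and at 0, so these shears and the identity on the radial leaves fit together to
a homeomorphism with derivative 1 at 0 (`IsShearing.exists_openPartialHomeomorph`). Composed with ζ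
it is Ψ.

The choice of the word in its class is immaterial: an elementary operation only rotates the model
(`ElemOp.exists_modelRel_iff`). -/

theorem eq_of_locally_eq {X Y : Type*} [TopologicalSpace X] {S : Set X} (hS : IsPreconnected S)
    {f : X → Y} (h : ∀ x ∈ S, ∀ᶠ x' in 𝓝[S] x, f x' = f x) {x y : X} (hx : x ∈ S) (hy : y ∈ S) :
    f x = f y := by
  refine hS.induction₂ (fun a b => f a = f b) (fun a ha => ?_) (fun a b c _ _ _ => Eq.trans)
    (fun a b _ _ => Eq.symm) hx hy
  filter_upwards [h a ha] with b hb using hb.symm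

/-- A continuous injective map of a compact set is a homeomorphism over an open set whose
preimage is interior. -/
theorem exists_openPartialHomeomorph_of_compact {X Y : Type*} [TopologicalSpace X] [Nonempty X]
    [TopologicalSpace Y] [T2Space Y] {K : Set X} (hK : IsCompact K) {f : X → Y}
    (hf : ContinuousOn f K) (hinj : InjOn f K) {V : Set Y} (hV : IsOpen V) (hVK : V ⊆ f '' K)
    (hint : ∀ x ∈ K, f x ∈ V → x ∈ interior K) :
    ∃ e : OpenPartialHomeomorph X Y, (∀ x, e x = f x) ∧ e.source = K ∩ f ⁻¹' V ∧ e.target = V := by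
  classical
  have hinv : ∀ y ∈ V, Function.invFunOn f K y ∈ K ∧ f (Function.invFunOn f K y) = y :=
    fun y hy => Function.invFunOn_pos (hVK hy)
  have hleft : ∀ x ∈ K, f x ∈ V → Function.invFunOn f K (f x) = x := fun x hx hxV =>
    hinj (hinv _ hxV).1 hx (hinv _ hxV).2
  refine ⟨{ toFun := f, invFun := Function.invFunOn f K, source := K ∩ f ⁻¹' V, target := V
            map_source' := fun x hx => hx.2
            map_target' := fun y hy => ⟨(hinv y hy).1, by
              rw [mem_preimage, (hinv y hy).2]; exact hy⟩
            left_inv' := fun x hx => hleft x hx.1 hx.2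
            right_inv' := fun y hy => (hinv y hy).2
            open_source := ?_, open_target := hV
            continuousOn_toFun := hf.mono inter_subset_left
            continuousOn_invFun := ?_ }, fun _ => rfl, rfl, rfl⟩
  · rw [continuousOn_iff_isClosed]
    intro t ht
    refine ⟨f '' (K ∩ t), ((hK.inter_right ht).image_of_continuousOn
      (hf.mono inter_subset_left)).isClosed, ?_⟩
    ext y
    constructor
    · rintro ⟨hy, hyV⟩
      exact ⟨⟨_, ⟨(hinv y hyV).1, hy⟩, (hinv y hyV).2⟩, hyV⟩
    · rintro ⟨⟨x, ⟨hxK, hxt⟩, rfl⟩, hyV⟩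
      refine ⟨?_, hyV⟩
      rw [mem_preimage, hleft x hxK hyV]
      exact hxt
  · have : K ∩ f ⁻¹' V = interior K ∩ f ⁻¹' V := by
      ext x
      exact ⟨fun hx => ⟨hint x hx.1 hx.2, hx.2⟩, fun hx => ⟨interior_subset hx.1, hx.2⟩⟩
    rw [this]
    exact (hf.mono interior_subset).isOpen_inter_preimage isOpen_interior hV

/-- An injective continuous function on an interval around `0` covers a neighborhood of its value
at `0`. -/
theorem image_Ioo_mem_nhds {g : ℝ → ℝ} {ε : ℝ} (hε : 0 < ε) (hg : ContinuousOn g (Icc (-ε) ε))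
    (hinj : InjOn g (Icc (-ε) ε)) : g '' Ioo (-ε) ε ∈ 𝓝 (g 0) := by
  have h0 : (0 : ℝ) ∈ Icc (-ε) ε := ⟨by linarith, hε.le⟩
  have hl : -ε ∈ Icc (-ε) ε := ⟨le_rfl, by linarith⟩
  have hr : ε ∈ Icc (-ε) ε := ⟨by linarith, le_rfl⟩
  rcases hg.strictMonoOn_of_injOn_Icc' (by linarith) hinj with h | h
  · exact mem_of_superset (Ioo_mem_nhds (h hl h0 (by linarith)) (h h0 hr hε))
      (intermediate_value_Ioo (by linarith) hg)
  · exact mem_of_superset (Ioo_mem_nhds (h h0 hr hε) (h hl h0 (by linarith)))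
      (intermediate_value_Ioo' (by linarith) hg)

/-- An arc contained in a plaque fills the plaque near each of its interior points. -/
theorem eventually_mem_arc (e : OpenPartialHomeomorph ℂ (ℝ × ℝ)) {c : ℝ → ℂ} {ε : ℝ} (hε : 0 < ε)
    (hc : ContinuousOn c (Icc (-ε) ε)) (hinj : InjOn c (Icc (-ε) ε))
    (hs : ∀ t ∈ Icc (-ε) ε, c t ∈ e.source) (he : ∀ t ∈ Icc (-ε) ε, (e (c t)).2 = (e (c 0)).2) :
    ∀ᶠ z in 𝓝 (c 0), (e z).2 = (e (c 0)).2 → ∃ t ∈ Ioo (-ε) ε, c t = z := by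
  have h0 : (0 : ℝ) ∈ Icc (-ε) ε := ⟨by linarith, hε.le⟩
  have hg : ContinuousOn (fun t => (e (c t)).1) (Icc (-ε) ε) :=
    continuous_fst.comp_continuousOn (e.continuousOn.comp hc hs)
  have hgi : InjOn (fun t => (e (c t)).1) (Icc (-ε) ε) := fun t ht t' ht' h =>
    hinj ht ht' (e.injOn (hs t ht) (hs t' ht') (Prod.ext h ((he t ht).trans (he t' ht').symm)))
  have hcont : ContinuousAt (fun z => (e z).1) (c 0) :=
    continuousAt_fst.comp (e.continuousAt (hs 0 h0))
  filter_upwards [hcont (image_Ioo_mem_nhds hε hg hgi), e.open_source.mem_nhds (hs 0 h0)]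
    with z hz hzs hze
  obtain ⟨t, ht, htz⟩ := hz
  have ht' := Ioo_subset_Icc_self ht
  exact ⟨t, ht, e.injOn (hs t ht') hzs (Prod.ext htz ((he t ht').trans hze.symm))⟩

/-- `z` lies inside an arc which is contained in plaques of both `e` and `e'`. -/
def HasCommonArc (e e' : OpenPartialHomeomorph ℂ (ℝ × ℝ)) (z : ℂ) : Prop :=
  ∃ (c : ℝ → ℂ) (ε : ℝ), 0 < ε ∧ ContinuousOn c (Icc (-ε) ε) ∧ InjOn c (Icc (-ε) ε) ∧ c 0 = z ∧
    ∀ t ∈ Icc (-ε) ε, c t ∈ e.source ∧ c t ∈ e'.source ∧ (e (c t)).2 = (e z).2 ∧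
      (e' (c t)).2 = (e' z).2

theorem HasCommonArc.symm {e e' : OpenPartialHomeomorph ℂ (ℝ × ℝ)} {z : ℂ}
    (h : HasCommonArc e e' z) : HasCommonArc e' e z := by
  obtain ⟨c, ε, h1, h2, h3, h4, h5⟩ := h
  exact ⟨c, ε, h1, h2, h3, h4, fun t ht => ⟨(h5 t ht).2.1, (h5 t ht).1, (h5 t ht).2.2.2,
    (h5 t ht).2.2.1⟩⟩

/-- The segment from `e q.1` to `e q.2` is horizontal and stays in the target of `e`. Along it the
second coordinate of `e'` is locally constant, because a common arc fills the plaque of `e` near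
each of its points. Comparing two charts is thus reduced to exhibiting one arc through every nearby
point. -/
theorem eventually_plaque_imp {e e' : OpenPartialHomeomorph ℂ (ℝ × ℝ)} {z₀ : ℂ}
    (h₀ : z₀ ∈ e.source) (h : ∀ᶠ z in 𝓝 z₀, HasCommonArc e e' z) :
    ∀ᶠ q : ℂ × ℂ in 𝓝 (z₀, z₀), (e q.1).2 = (e q.2).2 → (e' q.1).2 = (e' q.2).2 := by
  have h1 : ∀ᶠ p in 𝓝 (e z₀), p ∈ e.target ∧ HasCommonArc e e' (e.symm p) := by
    refine Filter.Eventually.and (e.open_target.mem_nhds (e.map_source h₀)) ?_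
    have := e.symm.continuousAt (e.map_source h₀)
    rw [ContinuousAt, e.left_inv h₀] at this
    exact this.eventually h
  obtain ⟨r, hr, hball⟩ := Metric.eventually_nhds_iff_ball.1 h1
  have h2 : ∀ᶠ z in 𝓝 z₀, z ∈ e.source ∧ e z ∈ Metric.ball (e z₀) r :=
    Filter.Eventually.and (e.open_source.mem_nhds h₀)
      (e.continuousAt h₀ (Metric.ball_mem_nhds _ hr))
  rw [nhds_prod_eq]
  filter_upwards [h2.prod_mk h2] with q ⟨⟨hq1, hq1'⟩, hq2, hq2'⟩ hq
  set S : Set (ℝ × ℝ) := segment ℝ (e q.1) (e q.2) with hS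
  have hSb : S ⊆ Metric.ball (e z₀) r := (convex_ball _ _).segment_subset hq1' hq2'
  have hS2 : ∀ p ∈ S, p.2 = (e q.1).2 := by
    rintro p ⟨a, b, -, -, hab, rfl⟩
    simp only [Prod.snd_add, Prod.smul_snd, smul_eq_mul, ← hq]
    rw [← add_mul, hab, one_mul]
  have key := eq_of_locally_eq (S := S) (f := fun p => (e' (e.symm p)).2)
    (convex_segment _ _).isPreconnected ?_ (left_mem_segment ℝ _ _) (right_mem_segment ℝ _ _)
  · simpa only [e.left_inv hq1, e.left_inv hq2] using key
  intro p hp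
  obtain ⟨hpt, c, ε, hε, hc, hci, hc0, hcs⟩ := hball p (hSb hp)
  have hArc := eventually_mem_arc e hε hc hci (fun t ht => (hcs t ht).1)
    (fun t ht => by rw [hc0]; exact (hcs t ht).2.2.1)
  rw [hc0] at hArc
  have hev := (e.symm.continuousAt hpt).eventually hArc
  filter_upwards [nhdsWithin_le_nhds hev, self_mem_nhdsWithin] with p' hp' hp'S
  obtain ⟨t, ht, htz⟩ := hp' (by
    rw [e.right_inv (hball p' (hSb hp'S)).1, e.right_inv hpt, hS2 p hp, hS2 p' hp'S])
  rw [← htz]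
  exact (hcs t (Ioo_subset_Icc_self ht)).2.2.2

theorem eventually_plaque_iff {e e' : OpenPartialHomeomorph ℂ (ℝ × ℝ)} {z₀ : ℂ}
    (h₀ : z₀ ∈ e.source) (h₀' : z₀ ∈ e'.source) (h : ∀ᶠ z in 𝓝 z₀, HasCommonArc e e' z) :
    ∀ᶠ q : ℂ × ℂ in 𝓝 (z₀, z₀), (e q.1).2 = (e q.2).2 ↔ (e' q.1).2 = (e' q.2).2 := by
  filter_upwards [eventually_plaque_imp h₀ h,
    eventually_plaque_imp h₀' (h.mono fun _ => HasCommonArc.symm)] with q h1 h2 using ⟨h1, h2⟩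

/-! ### Words -/

theorem wordWeight_nil (n : ℕ) : wordWeight n [] = 0 := rfl

theorem wordWeight_cons (n : ℕ) (s : Letter) (w : Word) :
    wordWeight n (s :: w) = s.weight n + wordWeight n w := by
  simp [wordWeight]

theorem wordWeight_append (n : ℕ) (u v : Word) :
    wordWeight n (u ++ v) = wordWeight n u + wordWeight n v := by
  simp [wordWeight]

theorem Letter.weight_pos (n : ℕ) (s : Letter) : 0 < s.weight n := by
  cases s with
  | h => simp only [Letter.weight]; positivity
  | p α => exact α.2

theorem ElemOp.wordWeight_eq {n : ℕ} {u v : Word} (h : ElemOp u v) :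
    wordWeight n u = wordWeight n v := by
  cases h with
  | rotate u v => rw [wordWeight_append, wordWeight_append, add_comm]
  | contract u v α β =>
    simp only [wordWeight_append, wordWeight_cons, Letter.weight, Positive.coe_add, add_assoc]

theorem isNormalized_toClass {n : ℕ} {w : Word} (hw : wordWeight n w = 2 * Real.pi) :
    w.toClass.IsNormalized n := by
  intro w' h
  have h' : Relation.EqvGen ElemOp w' w := Quotient.exact h
  rw [← hw]
  clear hw h
  induction h' with
  | rel x y h => exact h.wordWeight_eq
  | refl => rfl
  | symm x y _ ih => exact ih.symm
  | trans x y z _ _ ih1 ih2 => exact ih1.trans ih2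

theorem modelRel_append (n : ℕ) (θ : ℝ) (u v : Word) (a b : ℂ) :
    ModelRel n θ (u ++ v) a b ↔ ModelRel n θ u a b ∨ ModelRel n (θ - wordWeight n u) v a b := by
  induction u generalizing θ with
  | nil => simp [ModelRel, wordWeight_nil]
  | cons s u ih =>
    simp only [List.cons_append, ModelRel, ih, wordWeight_cons, or_assoc, sub_sub]

theorem exp_sub_two_pi (θ δ : ℝ) : Complex.exp ((θ - 2 * Real.pi - δ : ℝ) * Complex.I) =
    Complex.exp ((θ - δ : ℝ) * Complex.I) := by
  rw [show ((θ - δ : ℝ) : ℂ) * Complex.I =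
    ((θ - 2 * Real.pi - δ : ℝ) : ℂ) * Complex.I + 2 * Real.pi * Complex.I by push_cast; ring,
    Complex.exp_periodic]

theorem sectorRel_sub_two_pi (n : ℕ) (θ : ℝ) (s : Letter) (a b : ℂ) :
    SectorRel n (θ - 2 * Real.pi) s a b ↔ SectorRel n θ s a b := by
  simp only [SectorRel, exp_sub_two_pi]

theorem modelRel_sub_two_pi (n : ℕ) (θ : ℝ) (w : Word) (a b : ℂ) :
    ModelRel n (θ - 2 * Real.pi) w a b ↔ ModelRel n θ w a b := by
  induction w generalizing θ with
  | nil => rfl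
  | cons s w ih =>
    simp only [ModelRel, sectorRel_sub_two_pi]
    rw [show θ - 2 * Real.pi - s.weight n = θ - s.weight n - 2 * Real.pi by ring, ih]

/-- Related points of a parabolic sector have the same angle, so a cut along a ray never separates
them. -/
theorem sectorRel_add (n : ℕ) (θ : ℝ) (α β : {x : ℝ // 0 < x}) (a b : ℂ) :
    SectorRel n θ (.p (α + β)) a b ↔
      SectorRel n θ (.p α) a b ∨ SectorRel n (θ - α) (.p β) a b := by
  have hα := α.2
  have hβ := β.2
  simp only [SectorRel, Letter.weight, Positive.coe_add]
  constructor
  · rintro ⟨r, r', δ, δ', hr, hr', hδ, hδ', ha, hb, rfl⟩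
    rcases le_total δ α with h | h
    · exact Or.inl ⟨r, r', δ, δ, hr, hr', ⟨hδ.1, h⟩, ⟨hδ.1, h⟩, ha, hb, rfl⟩
    · refine Or.inr ⟨r, r', δ - α, δ - α, hr, hr', ⟨by linarith, by linarith [hδ.2]⟩,
        ⟨by linarith, by linarith [hδ.2]⟩, ?_, ?_, rfl⟩ <;> rwa [sub_sub, add_sub_cancel]
  · rintro (⟨r, r', δ, δ', hr, hr', hδ, hδ', ha, hb, rfl⟩ |
      ⟨r, r', δ, δ', hr, hr', hδ, hδ', ha, hb, rfl⟩)
    · have : δ ∈ Icc 0 ((α : ℝ) + β) := ⟨hδ.1, by linarith [hδ.2]⟩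
      exact ⟨r, r', δ, δ, hr, hr', this, this, ha, hb, rfl⟩
    · have : (α : ℝ) + δ ∈ Icc 0 ((α : ℝ) + β) := ⟨by linarith [hδ.1], by linarith [hδ.2]⟩
      refine ⟨r, r', α + δ, α + δ, hr, hr', this, this, ?_, ?_, rfl⟩ <;> rwa [← sub_sub]

/-- An elementary operation changes the singularity only by a rotation. -/
theorem ElemOp.exists_modelRel_iff {n : ℕ} {u v : Word} (h : ElemOp u v)
    (hw : wordWeight n u = 2 * Real.pi) :
    ∃ ω : ℝ, ∀ θ a b, ModelRel n θ u a b ↔ ModelRel n (θ + ω) v a b := by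
  cases h with
  | rotate u v =>
    refine ⟨- wordWeight n u, fun θ a b => ?_⟩
    rw [modelRel_append, modelRel_append, or_comm, ← sub_eq_add_neg]
    rw [wordWeight_append] at hw
    -- Placed after `v`, the block `u` starts a full turn later, hence at its original ray.
    rw [sub_sub, hw, modelRel_sub_two_pi]
  | contract u v α β =>
    refine ⟨0, fun θ a b => ?_⟩
    rw [add_zero, modelRel_append, modelRel_append]
    simp only [ModelRel, sectorRel_add, Letter.weight, Positive.coe_add, or_assoc, sub_sub, add_assoc]

/-- Equivalent normalized words have the same singularity up to a rotation. -/
theorem exists_modelRel_iff {n : ℕ} {u v : Word} (h : u.toClass = v.toClass)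
    (hw : wordWeight n u = 2 * Real.pi) :
    ∃ ω : ℝ, ∀ θ a b, ModelRel n θ u a b ↔ ModelRel n (θ + ω) v a b := by
  have h' : Relation.EqvGen ElemOp u v := Quotient.exact h
  clear h
  suffices wordWeight n u = wordWeight n v ∧ (wordWeight n u = 2 * Real.pi →
      ∃ ω : ℝ, ∀ θ a b, ModelRel n θ u a b ↔ ModelRel n (θ + ω) v a b) from this.2 hw
  clear hw
  induction h' with
  | rel x y h => exact ⟨h.wordWeight_eq, h.exists_modelRel_iff⟩
  | refl => exact ⟨rfl, fun _ => ⟨0, by simp⟩⟩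
  | symm x y _ ih =>
    refine ⟨ih.1.symm, fun hw => ?_⟩
    obtain ⟨ω, hω⟩ := ih.2 (ih.1.trans hw)
    exact ⟨-ω, fun θ a b => by rw [hω, neg_add_cancel_right]⟩
  | trans x y z _ _ ih1 ih2 =>
    refine ⟨ih1.1.trans ih2.1, fun hw => ?_⟩
    obtain ⟨ω, hω⟩ := ih1.2 hw
    obtain ⟨ω', hω'⟩ := ih2.2 (ih1.1.symm.trans hw)
    exact ⟨ω + ω', fun θ a b => by rw [hω, hω', add_assoc]⟩

/-- If `F` has the singularity of a normalized word, then it has that of every equivalent word. -/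
theorem Foliation.HasSingularity.of_toClass_eq {U : Set ℂ} {F : Foliation U} {n : ℕ} {w w' : Word}
    (hF : F.HasSingularity n w) (hw : wordWeight n w = 2 * Real.pi)
    (h : w'.toClass = w.toClass) : F.HasSingularity n w' := by
  obtain ⟨ω, hω⟩ := exists_modelRel_iff h.symm hw
  obtain ⟨θ, Ψ, h1, h2, h3, h4, h5⟩ := hF
  refine ⟨θ + ω, Ψ, h1, h2, h3, h4, fun z hz e he hze => ?_⟩
  simpa only [hω] using h5 z hz e he hze

/-! ### Lengths of paths -/

/-- The speed of a path in the `φ`-metric. -/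
noncomputable def speed (φ : ℂ → ℂ) (γ : ℝ → ℂ) (t : ℝ) : ℝ :=
  √‖φ (γ t)‖ * ‖derivWithin γ (Icc 0 1) t‖

theorem speed_nonneg (φ : ℂ → ℂ) (γ : ℝ → ℂ) (t : ℝ) : 0 ≤ speed φ γ t := by
  unfold speed; positivity

section Paths

variable {φ : ℂ → ℂ} {M : Set ℂ} {p q r : ℂ} {γ : ℝ → ℂ}

theorem IsPath.hasDerivWithinAt (h : IsPath M p q γ) {t : ℝ} (ht : t ∈ Icc (0 : ℝ) 1) :
    HasDerivWithinAt γ (derivWithin γ (Icc 0 1) t) (Icc 0 1) t :=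
  ((h.contDiffOn.differentiableOn one_ne_zero) t ht).hasDerivWithinAt

theorem IsPath.continuousOn_derivWithin (h : IsPath M p q γ) :
    ContinuousOn (derivWithin γ (Icc 0 1)) (Icc 0 1) :=
  h.contDiffOn.continuousOn_derivWithin (uniqueDiffOn_Icc one_pos) le_rfl

theorem IsPath.continuousOn_speed (h : IsPath M p q γ) (hφ : ContinuousOn φ M) :
    ContinuousOn (speed φ γ) (Icc 0 1) :=
  (Real.continuous_sqrt.comp_continuousOn
    (hφ.comp h.contDiffOn.continuousOn h.mapsTo).norm).mul h.continuousOn_derivWithin.norm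

theorem IsPath.intervalIntegrable_speed (h : IsPath M p q γ) (hφ : ContinuousOn φ M) {a b : ℝ}
    (ha : a ∈ Icc (0 : ℝ) 1) (hb : b ∈ Icc (0 : ℝ) 1) :
    IntervalIntegrable (speed φ γ) MeasureTheory.volume a b :=
  ((h.continuousOn_speed hφ).mono (ordConnected_Icc.uIcc_subset ha hb)).intervalIntegrable

/-- `p` and `q` are joined in `M` by a `C¹` path of `φ`-length `l`, which rests outside `[0, 1]`. -/
def Joined (φ : ℂ → ℂ) (M : Set ℂ) (p q : ℂ) (l : ℝ) : Prop :=
  ∃ η : ℝ → ℂ, ContDiff ℝ 1 η ∧ (∀ t, η t ∈ M) ∧ (∀ t ≤ 0, η t = p) ∧ (∀ t, 1 ≤ t → η t = q) ∧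
    ∫ t in (0 : ℝ)..1, √‖φ (η t)‖ * ‖deriv η t‖ = l

theorem Joined.exists_isPath {l : ℝ} (h : Joined φ M p q l) :
    ∃ η, IsPath M p q η ∧ length φ η = l := by
  obtain ⟨η, h1, h2, h3, h4, h5⟩ := h
  refine ⟨η, ⟨h1.contDiffOn, fun t _ => h2 t, h3 0 le_rfl, h4 1 le_rfl⟩, ?_⟩
  rw [← h5, length]
  refine intervalIntegral.integral_congr fun t ht => ?_
  rw [uIcc_of_le zero_le_one] at ht
  rw [((h1.differentiable one_ne_zero) t).derivWithin (uniqueDiffOn_Icc one_pos t ht)]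

theorem deriv_eq_zero_of_eqOn_Iic {η : ℝ → ℂ} (h : ContDiff ℝ 1 η) {a : ℝ}
    (hc : ∀ t ≤ a, η t = p) {t : ℝ} (ht : t ≤ a) : deriv η t = 0 := by
  have h1 := ((h.differentiable one_ne_zero) t).hasDerivAt.hasDerivWithinAt (s := Iic t)
  have h2 : HasDerivWithinAt η 0 (Iic t) t :=
    (hasDerivWithinAt_const t (Iic t) p).congr (fun s hs => hc s (le_trans hs ht)) (hc t ht)
  exact (uniqueDiffOn_Iic t t self_mem_Iic).eq_deriv _ h1 h2

theorem deriv_eq_zero_of_eqOn_Ici {η : ℝ → ℂ} (h : ContDiff ℝ 1 η) {a : ℝ}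
    (hc : ∀ t, a ≤ t → η t = p) {t : ℝ} (ht : a ≤ t) : deriv η t = 0 := by
  have h1 := ((h.differentiable one_ne_zero) t).hasDerivAt.hasDerivWithinAt (s := Ici t)
  have h2 : HasDerivWithinAt η 0 (Ici t) t :=
    (hasDerivWithinAt_const t (Ici t) p).congr (fun s hs => hc s (le_trans ht hs)) (hc t ht)
  exact (uniqueDiffOn_Ici t t self_mem_Ici).eq_deriv _ h1 h2

/-- Since both paths rest outside `[0, 1]`, the concatenation is the single formula `η (2 * t) + η'
(2 * t - 1) - q`: on each half one of the two terms cancels against `q`. It is `C¹` without any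
matching of velocities at the joint. -/
theorem Joined.trans (hφ : ContinuousOn φ M) {l l' : ℝ} (h : Joined φ M p q l)
    (h' : Joined φ M q r l') : Joined φ M p r (l + l') := by
  obtain ⟨η, h1, h2, h3, h4, h5⟩ := h
  obtain ⟨η', h1', h2', h3', h4', h5'⟩ := h'
  have hd := h1.differentiable one_ne_zero
  have hd' := h1'.differentiable one_ne_zero
  have hder : ∀ t, deriv (fun t => η (2 * t) + η' (2 * t - 1) - q) t =
      (2 : ℝ) • deriv η (2 * t) + (2 : ℝ) • deriv η' (2 * t - 1) := fun t => by
    have e1 : HasDerivAt (fun t : ℝ => 2 * t) 2 t := by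
      simpa using (hasDerivAt_id t).const_mul 2
    exact (((hd _).hasDerivAt.scomp t e1).add ((hd' _).hasDerivAt.scomp t
      (e1.sub_const 1))).sub_const q |>.deriv
  have hl : ∀ t ≤ (1 / 2 : ℝ), η' (2 * t - 1) = q ∧ deriv η' (2 * t - 1) = 0 := fun t ht =>
    ⟨h3' _ (by linarith), deriv_eq_zero_of_eqOn_Iic h1' h3' (by linarith)⟩
  have hr : ∀ t : ℝ, (1 / 2 : ℝ) ≤ t → η (2 * t) = q ∧ deriv η (2 * t) = 0 := fun t ht =>
    ⟨h4 _ (by linarith), deriv_eq_zero_of_eqOn_Ici h1 h4 (by linarith)⟩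
  have hM : ∀ t, η (2 * t) + η' (2 * t - 1) - q ∈ M := fun t => by
    rcases le_total t (1 / 2) with h | h
    · rw [(hl t h).1, add_sub_cancel_right]; exact h2 _
    · rw [(hr t h).1, add_sub_cancel_left]; exact h2' _
  have hC : ContDiff ℝ 1 (fun t => η (2 * t) + η' (2 * t - 1) - q) := by fun_prop
  refine ⟨_, hC, hM, fun t ht => ?_, fun t ht => ?_, ?_⟩
  · rw [(hl t (by linarith)).1, h3 _ (by linarith), add_sub_cancel_right]
  · rw [(hr t (by linarith)).1, h4' _ (by linarith), add_sub_cancel_left]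
  have hint : Continuous fun t => √‖φ (η (2 * t) + η' (2 * t - 1) - q)‖ *
      ‖deriv (fun t => η (2 * t) + η' (2 * t - 1) - q) t‖ := by
    refine Continuous.mul (Real.continuous_sqrt.comp ?_) (hC.continuous_deriv le_rfl).norm
    exact (hφ.comp_continuous hC.continuous hM).norm
  rw [← intervalIntegral.integral_add_adjacent_intervals
    (hint.intervalIntegrable 0 (1 / 2)) (hint.intervalIntegrable (1 / 2) 1)]
  congr 1
  · have : ∫ t in (0 : ℝ)..(1 / 2), √‖φ (η (2 * t) + η' (2 * t - 1) - q)‖ *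
        ‖deriv (fun t => η (2 * t) + η' (2 * t - 1) - q) t‖ =
        ∫ t in (0 : ℝ)..(1 / 2), 2 * (√‖φ (η (2 * t))‖ * ‖deriv η (2 * t)‖) := by
      refine intervalIntegral.integral_congr fun t ht => ?_
      rw [uIcc_of_le (by norm_num)] at ht
      rw [hder, (hl t ht.2).1, (hl t ht.2).2, smul_zero, add_zero, add_sub_cancel_right, norm_smul,
        Real.norm_ofNat]
      ring
    rw [this, intervalIntegral.integral_const_mul,
      intervalIntegral.mul_integral_comp_mul_left (f := fun t => √‖φ (η t)‖ * ‖deriv η t‖), ← h5]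
    norm_num
  · have : ∫ t in (1 / 2 : ℝ)..1, √‖φ (η (2 * t) + η' (2 * t - 1) - q)‖ *
        ‖deriv (fun t => η (2 * t) + η' (2 * t - 1) - q) t‖ =
        ∫ t in (1 / 2 : ℝ)..1, 2 * (√‖φ (η' (2 * t - 1))‖ * ‖deriv η' (2 * t - 1)‖) := by
      refine intervalIntegral.integral_congr fun t ht => ?_
      rw [uIcc_of_le (by norm_num)] at ht
      rw [hder, (hr t ht.1).1, (hr t ht.1).2, smul_zero, zero_add, add_sub_cancel_left, norm_smul,
        Real.norm_ofNat]
      ring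
    rw [this, intervalIntegral.integral_const_mul,
      intervalIntegral.mul_integral_comp_mul_sub (f := fun t => √‖φ (η' t)‖ * ‖deriv η' t‖), ← h5']
    norm_num

/-- Composition with a smooth monotone step function makes the velocity vanish at both ends and
leaves the length unchanged. Subarcs of a path can then be concatenated with other paths. -/
theorem IsPath.joined (hφ : ContinuousOn φ M) (h : IsPath M p q γ) {a b : ℝ} (ha : 0 ≤ a)
    (hab : a ≤ b) (hb : b ≤ 1) : Joined φ M (γ a) (γ b) (∫ t in a..b, speed φ γ t) := by
  set σ : ℝ → ℝ := fun t => a + (b - a) * Real.smoothTransition t with hσ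
  have hst : ContDiff ℝ 1 Real.smoothTransition := Real.smoothTransition.contDiff
  have hσC : ContDiff ℝ 1 σ := contDiff_const.add (contDiff_const.mul hst)
  have hσm : Monotone σ := fun s t hst' => by
    have := Real.smoothTransition.monotone hst'
    simp only [hσ]; nlinarith
  have hσI : ∀ t, σ t ∈ Icc a b := fun t => by
    have h0 := Real.smoothTransition.nonneg t
    have h1 := Real.smoothTransition.le_one t
    simp only [hσ]; constructor <;> nlinarith
  have hσI' : ∀ t, σ t ∈ Icc (0 : ℝ) 1 := fun t => Icc_subset_Icc ha hb (hσI t)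
  have hσ0 : ∀ t ≤ 0, σ t = a := fun t ht => by
    simp [hσ, Real.smoothTransition.zero_of_nonpos ht]
  have hσ1 : ∀ t, 1 ≤ t → σ t = b := fun t ht => by
    simp [hσ, Real.smoothTransition.one_of_one_le ht]
  have hσd : ∀ t, HasDerivAt σ (deriv σ t) t := fun t =>
    (hσC.differentiable one_ne_zero t).hasDerivAt
  have hC : ContDiff ℝ 1 (γ ∘ σ) := by
    rw [← contDiffOn_univ]
    exact h.contDiffOn.comp hσC.contDiffOn fun t _ => hσI' t
  have hder : ∀ t, deriv (γ ∘ σ) t = deriv σ t • derivWithin γ (Icc 0 1) (σ t) := fun t =>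
    ((h.hasDerivWithinAt (hσI' t)).scomp_hasDerivAt t (hσd t) hσI').deriv
  refine ⟨γ ∘ σ, hC, fun t => h.mapsTo (hσI' t), fun t ht => by simp [hσ0 t ht],
    fun t ht => by simp [hσ1 t ht], ?_⟩
  have key := intervalIntegral.integral_comp_mul_deriv'' (a := 0) (b := 1) (f := σ)
    (f' := deriv σ) (g := speed φ γ) hσC.continuous.continuousOn
    (fun t _ => (hσd t).hasDerivWithinAt) (hσC.continuous_deriv le_rfl).continuousOn
    ((h.continuousOn_speed hφ).mono (by rintro _ ⟨t, -, rfl⟩; exact hσI' t))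
  rw [hσ0 0 le_rfl, hσ1 1 le_rfl] at key
  rw [← key]
  refine intervalIntegral.integral_congr fun t _ => ?_
  have : 0 ≤ deriv σ t := hσm.deriv_nonneg
  simp only [Function.comp_apply, hder, speed, norm_smul, Real.norm_of_nonneg this]
  ring

end Paths

/-! ### Flat charts -/

/-- `X` is an isometric chart of the `φ`-metric of `M`, up to the factor `κ`. -/
structure IsFlatChart (φ : ℂ → ℂ) (M : Set ℂ) (κ : ℝ) (X : OpenPartialHomeomorph ℂ ℂ) : Prop where
  pos : 0 < κ
  source_subset : X.source ⊆ M
  exists_hasDerivAt : ∀ z ∈ X.source, ∃ d : ℂ, d ≠ 0 ∧ HasDerivAt X d z ∧ κ * ‖d‖ = √‖φ z‖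

section FlatChart

variable {φ : ℂ → ℂ} {M : Set ℂ} {κ : ℝ} {X : OpenPartialHomeomorph ℂ ℂ}

theorem IsFlatChart.norm_deriv (hX : IsFlatChart φ M κ X) {z : ℂ} (hz : z ∈ X.source) :
    κ * ‖deriv X z‖ = √‖φ z‖ := by
  obtain ⟨d, -, hd, h⟩ := hX.exists_hasDerivAt z hz
  rw [hd.deriv, h]

theorem IsFlatChart.differentiableOn (hX : IsFlatChart φ M κ X) :
    DifferentiableOn ℂ X X.source := fun z hz => by
  obtain ⟨d, -, hd, -⟩ := hX.exists_hasDerivAt z hz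
  exact hd.differentiableAt.differentiableWithinAt

theorem IsFlatChart.hasDerivAt_symm (hX : IsFlatChart φ M κ X) {W : ℂ} (hW : W ∈ X.target) :
    ∃ d : ℂ, HasDerivAt X.symm d W ∧ √‖φ (X.symm W)‖ * ‖d‖ = κ := by
  obtain ⟨d, hd0, hd, h⟩ := hX.exists_hasDerivAt _ (X.map_target hW)
  refine ⟨d⁻¹, X.hasDerivAt_symm hW hd0 hd, ?_⟩
  rw [← h, norm_inv, mul_assoc, mul_inv_cancel₀ (norm_ne_zero_iff.2 hd0), mul_one]

theorem IsFlatChart.joined (hX : IsFlatChart φ M κ X) {W W' : ℂ}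
    (h : segment ℝ W W' ⊆ X.target) :
    Joined φ M (X.symm W) (X.symm W') (κ * ‖W' - W‖) := by
  set σ : ℝ → ℂ := fun t => W + Real.smoothTransition t • (W' - W) with hσ
  have hst : ContDiff ℝ 1 Real.smoothTransition := Real.smoothTransition.contDiff
  have hσC : ContDiff ℝ 1 σ := contDiff_const.add (hst.smul contDiff_const)
  have hσI : ∀ t, σ t ∈ X.target := fun t => h (by
    rw [segment_eq_image']
    exact ⟨_, ⟨Real.smoothTransition.nonneg t, Real.smoothTransition.le_one t⟩, rfl⟩)
  have hσd : ∀ t, HasDerivAt σ (deriv Real.smoothTransition t • (W' - W)) t := fun t =>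
    ((hst.differentiable one_ne_zero t).hasDerivAt.smul_const _).const_add _
  have hd : ∀ w ∈ X.target, HasDerivAt X.symm (deriv X.symm w) w ∧
      √‖φ (X.symm w)‖ * ‖deriv X.symm w‖ = κ := fun w hw => by
    obtain ⟨d, h1, h2⟩ := hX.hasDerivAt_symm hw
    rw [h1.deriv]; exact ⟨h1, h2⟩
  have hXC : ContDiffOn ℝ 1 X.symm X.target := by
    have : DifferentiableOn ℂ X.symm X.target := fun w hw =>
      (hd w hw).1.differentiableAt.differentiableWithinAt
    exact (this.contDiffOn X.open_target).restrict_scalars ℝ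
  have hC : ContDiff ℝ 1 (X.symm ∘ σ) := by
    rw [← contDiffOn_univ]
    exact hXC.comp hσC.contDiffOn fun t _ => hσI t
  refine ⟨X.symm ∘ σ, hC, fun t => hX.source_subset (X.map_target (hσI t)),
    fun t ht => by simp [hσ, Real.smoothTransition.zero_of_nonpos ht],
    fun t ht => by simp [hσ, Real.smoothTransition.one_of_one_le ht], ?_⟩
  have h1 : ∀ t, √‖φ ((X.symm ∘ σ) t)‖ * ‖deriv (X.symm ∘ σ) t‖ =
      deriv Real.smoothTransition t * (κ * ‖W' - W‖) := fun t => by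
    have e := (((hd _ (hσI t)).1).comp t (hσd t)).deriv
    rw [e, norm_mul, norm_smul, Real.norm_of_nonneg Real.smoothTransition.monotone.deriv_nonneg,
      Function.comp_apply, ← (hd _ (hσI t)).2]
    ring
  simp only [h1]
  rw [intervalIntegral.integral_mul_const, intervalIntegral.integral_deriv_eq_sub
    (fun t _ => hst.differentiable one_ne_zero t)
    ((hst.continuous_deriv le_rfl).intervalIntegrable _ _)]
  simp

/-- The speed in the `φ`-metric is `κ` times the Euclidean speed of the image curve, and a curve is
at least as long as its chord. -/
theorem IsFlatChart.le_integral_speed (hX : IsFlatChart φ M κ X) {p q : ℂ} {γ : ℝ → ℂ}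
    (hγ : IsPath M p q γ) {a b : ℝ} (ha : 0 ≤ a) (hab : a ≤ b) (hb : b ≤ 1)
    (h : ∀ t ∈ Icc a b, γ t ∈ X.source) :
    κ * ‖X (γ b) - X (γ a)‖ ≤ ∫ t in a..b, speed φ γ t := by
  have hsub : Icc a b ⊆ Icc (0 : ℝ) 1 := Icc_subset_Icc ha hb
  have hXd : ContinuousOn (deriv X) X.source :=
    (hX.differentiableOn.contDiffOn (n := 1) X.open_source).continuousOn_deriv_of_isOpen
      X.open_source le_rfl
  have hγc : ContinuousOn γ (Icc a b) := hγ.contDiffOn.continuousOn.mono hsub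
  have hP : ContinuousOn (fun t => deriv X (γ t) * derivWithin γ (Icc 0 1) t) (Icc a b) :=
    (hXd.comp hγc h).mul (hγ.continuousOn_derivWithin.mono hsub)
  have hFTC := intervalIntegral.integral_eq_sub_of_hasDeriv_right_of_le hab
    (f := fun t => X (γ t)) (X.continuousOn.comp hγc h)
    (f' := fun t => deriv X (γ t) * derivWithin γ (Icc 0 1) t) (fun t ht => by
      have ht' := Ioo_subset_Icc_self ht
      have h1 : HasDerivAt X (deriv X (γ t)) (γ t) := by
        obtain ⟨d, -, hd, -⟩ := hX.exists_hasDerivAt _ (h t ht')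
        rwa [hd.deriv]
      have h2 := hγ.hasDerivWithinAt (hsub ht')
      have h3 : HasDerivAt γ (derivWithin γ (Icc 0 1) t) t :=
        h2.hasDerivAt (Icc_mem_nhds (by linarith [ht.1]) (by linarith [ht.2]))
      exact (h1.comp t h3).hasDerivWithinAt)
    (by rw [← uIcc_of_le hab] at hP; exact hP.intervalIntegrable)
  rw [← hFTC]
  calc κ * ‖∫ t in a..b, deriv X (γ t) * derivWithin γ (Icc 0 1) t‖
      ≤ κ * ∫ t in a..b, ‖deriv X (γ t) * derivWithin γ (Icc 0 1) t‖ :=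
        mul_le_mul_of_nonneg_left (intervalIntegral.norm_integral_le_integral_norm hab) hX.pos.le
    _ = ∫ t in a..b, speed φ γ t := by
        rw [← intervalIntegral.integral_const_mul]
        refine intervalIntegral.integral_congr fun t ht => ?_
        rw [uIcc_of_le hab] at ht
        simp only [speed]
        rw [norm_mul, ← hX.norm_deriv (h t ht), mul_assoc]

end FlatChart

/-- A curve that leaves a disc of a chart does so through the boundary circle. -/
theorem exists_first_exit {X : OpenPartialHomeomorph ℂ ℂ} {W₀ : ℂ} {r : ℝ}
    (hr : Metric.closedBall W₀ r ⊆ X.target) {f : ℝ → ℂ} {a b : ℝ}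
    (hf : ContinuousOn f (Icc a b)) (ha : f a ∈ X.source ∧ X (f a) ∈ Metric.ball W₀ r)
    (hex : ∃ t ∈ Icc a b, ¬ (f t ∈ X.source ∧ X (f t) ∈ Metric.ball W₀ r)) :
    ∃ c ∈ Ioc a b, (∀ t ∈ Icc a c, f t ∈ X.source ∧ X (f t) ∈ Metric.closedBall W₀ r) ∧
      dist (X (f c)) W₀ = r := by
  set V : Set ℂ := X.source ∩ X ⁻¹' Metric.ball W₀ r with hV
  have hVo : IsOpen V := X.isOpen_inter_preimage Metric.isOpen_ball
  set K : Set ℂ := X.symm '' Metric.closedBall W₀ r with hK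
  have hKc : IsClosed K :=
    ((isCompact_closedBall W₀ r).image_of_continuousOn (X.symm.continuousOn.mono hr)).isClosed
  have hKmem : ∀ z ∈ K, z ∈ X.source ∧ X z ∈ Metric.closedBall W₀ r := by
    rintro _ ⟨W, hW, rfl⟩
    exact ⟨X.map_target (hr hW), by rwa [X.right_inv (hr hW)]⟩
  have hVK : V ⊆ K := fun z hz => ⟨X z, Metric.ball_subset_closedBall hz.2, X.left_inv hz.1⟩
  set B : Set ℝ := Icc a b ∩ f ⁻¹' Vᶜ with hB
  have hBc : IsClosed B := hf.preimage_isClosed_of_isClosed isClosed_Icc hVo.isClosed_compl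
  have hBne : B.Nonempty := by obtain ⟨t, ht, h⟩ := hex; exact ⟨t, ht, h⟩
  have hBb : BddBelow B := ⟨a, fun t ht => ht.1.1⟩
  have hcB : sInf B ∈ B := hBc.csInf_mem hBne hBb
  set c := sInf B
  have hac : a < c := lt_of_le_of_ne hcB.1.1 (by rintro h; exact hcB.2 (h ▸ ha))
  have hlt : ∀ t ∈ Ico a c, f t ∈ V := fun t ht => by
    by_contra h
    exact absurd (csInf_le hBb ⟨⟨ht.1, ht.2.le.trans hcB.1.2⟩, h⟩) (not_le.2 ht.2)
  have hcK : f c ∈ K := by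
    have h1 : Tendsto f (𝓝[Ico a c] c) (𝓝 (f c)) :=
      (hf c hcB.1).mono (Ico_subset_Icc_self.trans (Icc_subset_Icc_right hcB.1.2))
    have : (𝓝[Ico a c] c).NeBot := by
      rw [nhdsWithin_Ico_eq_nhdsLT hac]; infer_instance
    exact hKc.mem_of_tendsto h1 (eventually_mem_nhdsWithin.mono fun t ht => hVK (hlt t ht))
  refine ⟨c, ⟨hac, hcB.1.2⟩, fun t ht => ?_, ?_⟩
  · rcases ht.2.lt_or_eq with h | rfl
    · exact hKmem _ (hVK (hlt t ⟨ht.1, h⟩))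
    · exact hKmem _ hcK
  · obtain ⟨h1, h2⟩ := hKmem _ hcK
    refine le_antisymm h2 (not_lt.1 fun h => hcB.2 ⟨h1, h⟩)

/-! ### Minimality of straight segments and straightness of shortest arcs -/

section FlatChart

variable {φ : ℂ → ℂ} {M : Set ℂ} {κ : ℝ} {X : OpenPartialHomeomorph ℂ ℂ}

/-- Short straight segments are shortest. -/
theorem IsFlatChart.le_length (hφ : ContinuousOn φ M) (hX : IsFlatChart φ M κ X) {W₀ W W' : ℂ}
    {r : ℝ} (hr : Metric.closedBall W₀ (3 * r) ⊆ X.target) (hW : dist W W₀ < r)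
    (hW' : dist W' W₀ < r) {η : ℝ → ℂ} (hη : IsPath M (X.symm W) (X.symm W') η) :
    κ * ‖W' - W‖ ≤ length φ η := by
  have hr0 : 0 < r := dist_nonneg.trans_lt hW
  have hball : ∀ V, dist V W₀ < r → V ∈ Metric.ball W₀ (3 * r) := fun V hV => by
    rw [Metric.mem_ball]; linarith
  have hWt : W ∈ X.target := hr (Metric.ball_subset_closedBall (hball W hW))
  have hWt' : W' ∈ X.target := hr (Metric.ball_subset_closedBall (hball W' hW'))
  by_cases h : ∀ t ∈ Icc (0 : ℝ) 1, η t ∈ X.source ∧ X (η t) ∈ Metric.ball W₀ (3 * r)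
  · have := hX.le_integral_speed hη le_rfl zero_le_one le_rfl fun t ht => (h t ht).1
    rwa [hη.source, hη.target, X.right_inv hWt, X.right_inv hWt'] at this
  -- A path leaving the disc of radius `3 * r` travels at least `2 * r` in the chart before reaching
  -- the boundary circle, while `W` and `W'` are less than `2 * r` apart.
  · push Not at h
    obtain ⟨c, hc, hcs, hcr⟩ := exists_first_exit hr hη.contDiffOn.continuousOn
      (by rw [hη.source, X.right_inv hWt]; exact ⟨X.map_target hWt, hball W hW⟩)
      (by obtain ⟨t, ht, h⟩ := h; exact ⟨t, ht, fun h' => h h'.1 h'.2⟩)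
    have h1 := hX.le_integral_speed hη le_rfl hc.1.le hc.2 fun t ht => (hcs t ht).1
    rw [hη.source, X.right_inv hWt] at h1
    have hI : ∀ a ∈ Icc (0 : ℝ) 1, ∀ b ∈ Icc (0 : ℝ) 1,
        IntervalIntegrable (speed φ η) MeasureTheory.volume a b := fun a ha b hb =>
      hη.intervalIntegrable_speed hφ ha hb
    have hcI : c ∈ Icc (0 : ℝ) 1 := Ioc_subset_Icc_self hc
    have h2 : ∫ t in (0 : ℝ)..c, speed φ η t ≤ length φ η := by
      have h3 := intervalIntegral.integral_add_adjacent_intervals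
        (hI 0 (by simp) c hcI) (hI c hcI 1 (by simp))
      have h4 : 0 ≤ ∫ t in c..1, speed φ η t :=
        intervalIntegral.integral_nonneg hc.2 fun t _ => speed_nonneg φ η t
      have h5 : length φ η = ∫ t in (0 : ℝ)..1, speed φ η t := rfl
      linarith
    refine le_trans (mul_le_mul_of_nonneg_left ?_ hX.pos.le) (h1.trans h2)
    rw [← dist_eq_norm, ← dist_eq_norm]
    have := dist_triangle_right W' W W₀
    have := dist_triangle (X (η c)) W W₀
    linarith

/-- A subarc of a shortest path is no longer than a straight segment between its endpoints. -/
theorem IsFlatChart.integral_speed_le (hφ : ContinuousOn φ M) (hX : IsFlatChart φ M κ X)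
    {p q : ℂ} {γ : ℝ → ℂ} (hγ : IsPath M p q γ)
    (hmin : ∀ η, IsPath M p q η → length φ γ ≤ length φ η) {a b : ℝ} (ha : 0 ≤ a) (hab : a ≤ b)
    (hb : b ≤ 1) (has : γ a ∈ X.source) (hbs : γ b ∈ X.source)
    (hseg : segment ℝ (X (γ a)) (X (γ b)) ⊆ X.target) :
    ∫ t in a..b, speed φ γ t ≤ κ * ‖X (γ b) - X (γ a)‖ := by
  have h1 := hγ.joined hφ le_rfl ha (hab.trans hb)
  have h2 := hX.joined hseg
  rw [X.left_inv has, X.left_inv hbs] at h2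
  have h3 := hγ.joined hφ (ha.trans hab) hb le_rfl
  rw [hγ.source] at h1
  rw [hγ.target] at h3
  -- The competitor: the given path with its arc from `a` to `b` replaced by the straight segment.
  obtain ⟨η, hη, hl⟩ := ((h1.trans hφ h2).trans hφ h3).exists_isPath
  have h4 := hmin η hη
  rw [hl] at h4
  have hI : ∀ a ∈ Icc (0 : ℝ) 1, ∀ b ∈ Icc (0 : ℝ) 1,
      IntervalIntegrable (speed φ γ) MeasureTheory.volume a b := fun a ha b hb =>
    hγ.intervalIntegrable_speed hφ ha hb
  have haI : a ∈ Icc (0 : ℝ) 1 := ⟨ha, hab.trans hb⟩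
  have hbI : b ∈ Icc (0 : ℝ) 1 := ⟨ha.trans hab, hb⟩
  have h5 := intervalIntegral.integral_add_adjacent_intervals (hI 0 (by simp) a haI) (hI a haI b hbI)
  have h6 := intervalIntegral.integral_add_adjacent_intervals (hI 0 (by simp) b hbI)
    (hI b hbI 1 (by simp))
  have h7 : length φ γ = ∫ t in (0 : ℝ)..1, speed φ γ t := rfl
  linarith

/-- Shortest arcs are straight near their interior points. -/
theorem IsFlatChart.exists_segment_subset (hφ : ContinuousOn φ M) (hX : IsFlatChart φ M κ X)
    {p q z : ℂ} {A : Set ℂ} (hA : IsShortestArc φ M p q A) (hzA : z ∈ A) (hz : z ∈ X.source)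
    (hpz : p ≠ z) (hqz : q ≠ z) :
    ∃ u : ℂ, ‖u‖ = 1 ∧ ∃ ε : ℝ, 0 < ε ∧ ∀ t ∈ Icc (-ε) ε, X z + (t : ℂ) * u ∈ X.target ∧
      X.symm (X z + t * u) ∈ A := by
  obtain ⟨γ, hγ, rfl, hmin⟩ := hA
  obtain ⟨t₀, ht₀, rfl⟩ := hzA
  obtain ⟨R, hR, hRt⟩ := Metric.nhds_basis_closedBall.mem_iff.1
    (X.open_target.mem_nhds (X.map_source hz))
  -- A disc around `X (γ t₀)` that avoids both endpoints of the arc, so that the path must leave it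
  -- both before and after `t₀`.
  have hout : ∀ w, w ≠ γ t₀ → ∃ r > 0, r ≤ R ∧ ∀ r' ≤ r,
      ¬ (w ∈ X.source ∧ X w ∈ Metric.ball (X (γ t₀)) r') := fun w hw => by
    by_cases hws : w ∈ X.source
    · have : X w ≠ X (γ t₀) := fun h => hw (X.injOn hws hz h)
      refine ⟨min R (dist (X w) (X (γ t₀))), lt_min hR (dist_pos.2 this), min_le_left _ _,
        fun r' hr' h => ?_⟩
      exact absurd h.2 (not_lt.2 (hr'.trans (min_le_right _ _)))
    · exact ⟨R, hR, le_rfl, fun r' _ h => hws h.1⟩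
  obtain ⟨r1, hr1, hr1R, hp⟩ := hout p hpz
  obtain ⟨r2, hr2, -, hq⟩ := hout q hqz
  set r := min r1 r2 with hrdef
  have hr : 0 < r := lt_min hr1 hr2
  have hrt : Metric.closedBall (X (γ t₀)) r ⊆ X.target :=
    (Metric.closedBall_subset_closedBall ((min_le_left _ _).trans hr1R)).trans hRt
  have hγc := hγ.contDiffOn.continuousOn
  have hin : γ t₀ ∈ X.source ∧ X (γ t₀) ∈ Metric.ball (X (γ t₀)) r :=
    ⟨hz, Metric.mem_ball_self hr⟩
  obtain ⟨b, hb, hbs, hbr⟩ := exists_first_exit hrt (f := γ) (a := t₀) (b := 1)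
    (hγc.mono (Icc_subset_Icc_left ht₀.1)) hin
    ⟨1, ⟨ht₀.2, le_rfl⟩, by rw [hγ.target]; exact hq _ (min_le_right _ _)⟩
  -- The last entrance into the disc before `t₀` is the first exit of the path run backwards.
  obtain ⟨a', ha', has', har'⟩ := exists_first_exit hrt (f := fun t => γ (-t)) (a := -t₀) (b := 0)
    (hγc.comp continuous_neg.continuousOn fun t ht => ⟨by linarith [ht.2], by
      linarith [ht.1, ht₀.2]⟩) (by simpa only [neg_neg] using hin)
    ⟨0, ⟨by linarith [ht₀.1], le_rfl⟩, by
      rw [neg_zero, hγ.source]; exact hp _ (min_le_left _ _)⟩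
  obtain ⟨a, rfl⟩ : ∃ a, a' = -a := ⟨-a', by ring⟩
  rw [neg_neg] at har'
  have ha0 : 0 ≤ a := by linarith [ha'.2]
  have hat : a < t₀ := by linarith [ha'.1]
  have hab : a ≤ b := by linarith [hb.1]
  have hmem : ∀ t ∈ Icc a b, γ t ∈ X.source ∧ X (γ t) ∈ Metric.closedBall (X (γ t₀)) r :=
    fun t ht => by
      rcases le_total t₀ t with h | h
      · exact hbs t ⟨h, ht.2⟩
      · simpa only [neg_neg] using has' (-t) ⟨by linarith, by linarith [ht.1]⟩
  -- The arc from `a` to `b` is no longer than its chord, and each of its two pieces is at least as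
  -- long as its own chord. This is equality in the triangle inequality, which puts the intermediate
  -- point on the chord.
  have hbtw : ∀ t ∈ Icc a b, Wbtw ℝ (X (γ a)) (X (γ t)) (X (γ b)) := fun t ht => by
    have haI : a ∈ Icc a b := ⟨le_rfl, hab⟩
    have hbI : b ∈ Icc a b := ⟨hab, le_rfl⟩
    have h1 := hX.integral_speed_le hφ hγ hmin ha0 hab hb.2 (hmem a haI).1 (hmem b hbI).1
      (((convex_closedBall _ _).segment_subset (hmem a haI).2 (hmem b hbI).2).trans hrt)
    have h2 := hX.le_integral_speed hγ ha0 ht.1 (ht.2.trans hb.2)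
      fun s hs => (hmem s ⟨hs.1, hs.2.trans ht.2⟩).1
    have h3 := hX.le_integral_speed hγ (ha0.trans ht.1) ht.2 hb.2
      fun s hs => (hmem s ⟨ht.1.trans hs.1, hs.2⟩).1
    have hI : ∀ s ∈ Icc a b, s ∈ Icc (0 : ℝ) 1 := fun s hs => ⟨ha0.trans hs.1, hs.2.trans hb.2⟩
    have h4 := intervalIntegral.integral_add_adjacent_intervals
      (hγ.intervalIntegrable_speed hφ (hI a haI) (hI t ht))
      (hγ.intervalIntegrable_speed hφ (hI t ht) (hI b hbI))
    rw [← dist_add_dist_eq_iff]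
    refine le_antisymm ?_ (dist_triangle _ _ _)
    rw [dist_comm (X (γ a)) (X (γ t)), dist_comm (X (γ t)) (X (γ b)), dist_comm (X (γ a)) (X (γ b)),
      dist_eq_norm, dist_eq_norm, dist_eq_norm]
    have h5 : κ * (‖X (γ t) - X (γ a)‖ + ‖X (γ b) - X (γ t)‖) ≤ κ * ‖X (γ b) - X (γ a)‖ := by
      rw [mul_add]; linarith
    exact le_of_mul_le_mul_left h5 hX.pos
  have hP : ContinuousOn (fun t => X (γ t)) (Icc a b) :=
    X.continuousOn.comp (hγc.mono (Icc_subset_Icc ha0 hb.2)) fun t ht => (hmem t ht).1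
  have hza := hbtw t₀ ⟨hat.le, hb.1.le⟩
  have hL := hza.dist_add_dist
  rw [har', dist_comm, hbr] at hL
  obtain ⟨τ, hτ0, hτ⟩ := hza
  -- The centre lies on the chord and has distance `r` from both ends, hence is its midpoint.
  have hτ2 : τ = 1 / 2 := by
    have h1 : dist (X (γ t₀)) (X (γ a)) = τ * (r + r) := by
      rw [← hτ, dist_lineMap_left, hL, Real.norm_of_nonneg hτ0.1]
    rw [dist_comm, har'] at h1
    nlinarith
  set u : ℂ := (X (γ b) - X (γ t₀)) / r with hu
  have hrC : (r : ℂ) ≠ 0 := by exact_mod_cast hr.ne'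
  have hu1 : ‖u‖ = 1 := by
    rw [hu, norm_div, ← dist_eq_norm, hbr, Complex.norm_real, Real.norm_of_nonneg hr.le,
      div_self hr.ne']
  have hXb : X (γ b) = X (γ t₀) + r * u := by rw [hu]; field_simp; ring
  have hXa : X (γ a) = X (γ t₀) - r * u := by
    have h1 : X (γ t₀) = X (γ a) + (1 / 2 : ℂ) * (X (γ b) - X (γ a)) := by
      conv_lhs => rw [← hτ, hτ2, AffineMap.lineMap_apply, vsub_eq_sub, vadd_eq_add,
        Complex.real_smul, add_comm]
      push_cast; ring
    have h2 : X (γ b) = 2 * X (γ t₀) - X (γ a) := by rw [h1]; ring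
    rw [hXb] at h2
    linear_combination h2
  refine ⟨u, hu1, r, hr, fun s hs => ?_⟩
  have hst : X (γ t₀) + (s : ℂ) * u ∈ Metric.closedBall (X (γ t₀)) r := by
    rw [Metric.mem_closedBall, dist_eq_norm, add_sub_cancel_left, norm_mul, hu1, mul_one,
      Complex.norm_real]
    exact abs_le.2 hs
  refine ⟨hrt hst, ?_⟩
  have huu : (u * (starRingEnd ℂ) u).re = 1 := by
    rw [Complex.mul_conj, Complex.ofReal_re, Complex.normSq_eq_norm_sq, hu1, one_pow]
  have hre : ∀ x : ℝ, ((x : ℂ) * u * (starRingEnd ℂ) u).re = x := fun x => by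
    rw [mul_assoc, Complex.re_ofReal_mul, huu, mul_one]
  -- The arc covers the whole chord: its component along `u` runs from `-r` to `r`.
  obtain ⟨t, ht, hts⟩ := intermediate_value_Icc hab (f := fun t =>
    ((X (γ t) - X (γ t₀)) * (starRingEnd ℂ) u).re)
    (Complex.continuous_re.comp_continuousOn ((hP.sub continuousOn_const).mul continuousOn_const))
    (show s ∈ _ by
      simp only [hXa, hXb]
      rw [sub_sub_cancel_left, add_sub_cancel_left, hre, neg_mul, Complex.neg_re, hre]
      exact hs)
  obtain ⟨l, -, hl⟩ := hbtw t ht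
  have hXt : X (γ t) = X (γ t₀) + (((2 * l - 1) * r : ℝ) : ℂ) * u := by
    rw [← hl, hXa, hXb, AffineMap.lineMap_apply, vsub_eq_sub, vadd_eq_add, Complex.real_smul]
    push_cast; ring
  simp only [hXt] at hts
  rw [add_sub_cancel_left, hre] at hts
  rw [← hts, ← hXt, X.left_inv (hmem t ht).1]
  exact ⟨t, ⟨ha0.trans ht.1, ht.2.trans hb.2⟩, rfl⟩

end FlatChart

/-! ### The natural coordinate at the zero -/

/-- The exponent `k = (n + 2) / 2` for which `ζ ^ k` is a natural parameter of `ζ ^ n dζ²`. -/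
noncomputable def expt (n : ℕ) : ℝ := ((n : ℝ) + 2) / 2

theorem one_le_expt (n : ℕ) : 1 ≤ expt n := by
  have : (0 : ℝ) ≤ n := n.cast_nonneg
  unfold expt; linarith

theorem expt_pos (n : ℕ) : 0 < expt n := one_pos.trans_le (one_le_expt n)

/-- The holomorphic solution of `k S + z S' = s`. -/
theorem exists_radial_primitive {s : ℂ → ℂ} {ρ : ℝ} (hs : DifferentiableOn ℂ s (Metric.ball 0 ρ))
    {k : ℝ} (hk : 1 ≤ k) :
    ∃ S : ℂ → ℂ, ∀ z ∈ Metric.ball (0 : ℂ) (ρ / 2), ∃ S' : ℂ, HasDerivAt S S' z ∧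
      k * S z + z * S' = s z := by
  rcases le_or_gt ρ 0 with hρ | hρ
  · refine ⟨0, fun z hz => ?_⟩
    rw [Metric.ball_eq_empty.2 (by linarith)] at hz
    exact hz.elim
  have hd : ∀ w ∈ Metric.ball (0 : ℂ) ρ, HasDerivAt s (deriv s w) w := fun w hw =>
    (hs.differentiableAt (Metric.isOpen_ball.mem_nhds hw)).hasDerivAt
  have hsc : ContinuousOn s (Metric.ball 0 ρ) := hs.continuousOn
  have hdc : ContinuousOn (deriv s) (Metric.ball 0 ρ) :=
    (hs.contDiffOn (n := 1) Metric.isOpen_ball).continuousOn_deriv_of_isOpen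
      Metric.isOpen_ball le_rfl
  have hcl : Metric.closedBall (0 : ℂ) (ρ / 2) ⊆ Metric.ball 0 ρ :=
    Metric.closedBall_subset_ball (by linarith)
  obtain ⟨B, hB⟩ := (isCompact_closedBall (0 : ℂ) (ρ / 2)).exists_bound_of_continuousOn
    (hdc.mono hcl)
  have hmem : ∀ z ∈ Metric.ball (0 : ℂ) (ρ / 2), ∀ t ∈ Icc (0 : ℝ) 1,
      (t : ℂ) * z ∈ Metric.closedBall (0 : ℂ) (ρ / 2) := fun z hz t ht => by
    rw [mem_closedBall_zero_iff, norm_mul, Complex.norm_real, Real.norm_of_nonneg ht.1]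
    rw [mem_ball_zero_iff] at hz
    nlinarith [ht.2, norm_nonneg z]
  have hpow : Continuous fun t : ℝ => ((t ^ (k - 1) : ℝ) : ℂ) :=
    Complex.continuous_ofReal.comp (Real.continuous_rpow_const (by linarith))
  have hmul : ∀ z : ℂ, Continuous fun t : ℝ => (t : ℂ) * z := fun z => by fun_prop
  have hF : ∀ z ∈ Metric.ball (0 : ℂ) (ρ / 2),
      ContinuousOn (fun t : ℝ => ((t ^ (k - 1) : ℝ) : ℂ) * s (t * z)) (Icc 0 1) := fun z hz =>
    hpow.continuousOn.mul (hsc.comp (hmul z).continuousOn fun t ht => hcl (hmem z hz t ht))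
  have hF' : ∀ z ∈ Metric.ball (0 : ℂ) (ρ / 2),
      ContinuousOn (fun t : ℝ => ((t ^ (k - 1) : ℝ) : ℂ) * (deriv s (t * z) * t)) (Icc 0 1) :=
    fun z hz => hpow.continuousOn.mul ((hdc.comp (hmul z).continuousOn
      fun t ht => hcl (hmem z hz t ht)).mul Complex.continuous_ofReal.continuousOn)
  have hI : uIcc (0 : ℝ) 1 = Icc 0 1 := uIcc_of_le zero_le_one
  have hIo : uIoc (0 : ℝ) 1 ⊆ Icc 0 1 := by
    rw [uIoc_of_le zero_le_one]; exact Ioc_subset_Icc_self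
  -- In the variable `t`, the function `t ^ k * s (t * z)` goes from `0` to `s z`, and its
  -- derivative is the integrand of `k * S z + z * S'`.
  refine ⟨fun z => ∫ t in (0 : ℝ)..1, ((t ^ (k - 1) : ℝ) : ℂ) * s (t * z), fun z hz => ?_⟩
  have key := (intervalIntegral.hasDerivAt_integral_of_dominated_loc_of_deriv_le
    (μ := MeasureTheory.volume) (𝕜 := ℂ)
    (F := fun z (t : ℝ) => ((t ^ (k - 1) : ℝ) : ℂ) * s (t * z))
    (F' := fun z (t : ℝ) => ((t ^ (k - 1) : ℝ) : ℂ) * (deriv s (t * z) * t))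
    (bound := fun _ => B) (x₀ := z) (a := 0) (b := 1)
    (Metric.isOpen_ball.mem_nhds hz)
    (by
      filter_upwards [Metric.isOpen_ball.mem_nhds hz] with w hw
      exact ((hF w hw).mono hIo).aestronglyMeasurable measurableSet_uIoc)
    (by rw [← hI] at hF; exact (hF z hz).intervalIntegrable)
    (((hF' z hz).mono hIo).aestronglyMeasurable measurableSet_uIoc)
    (Eventually.of_forall fun t ht w hw => by
      have ht' := hIo ht
      rw [norm_mul, norm_mul, Complex.norm_real, Complex.norm_real, Real.norm_of_nonneg ht'.1,
        Real.norm_of_nonneg (Real.rpow_nonneg ht'.1 _)]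
      have h1 := hB _ (hmem w hw t ht')
      have h2 : t ^ (k - 1) ≤ 1 := Real.rpow_le_one ht'.1 ht'.2 (by linarith)
      have h3 := Real.rpow_nonneg ht'.1 (k - 1)
      have h4 : ‖deriv s (t * w)‖ * t ≤ B * 1 :=
        mul_le_mul h1 ht'.2 ht'.1 ((norm_nonneg _).trans h1)
      have h5 : 0 ≤ ‖deriv s (t * w)‖ * t := mul_nonneg (norm_nonneg _) ht'.1
      nlinarith)
    intervalIntegrable_const
    (Eventually.of_forall fun t ht w hw => by
      have h1 : HasDerivAt (fun x : ℂ => (t : ℂ) * x) (t : ℂ) w := by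
        simpa using (hasDerivAt_id w).const_mul (t : ℂ)
      exact ((hd _ (hcl (hmem w hw t (hIo ht)))).comp w h1).const_mul _)).2
  refine ⟨_, key, ?_⟩
  have hFTC := intervalIntegral.integral_eq_sub_of_hasDerivAt (a := (0 : ℝ)) (b := 1)
    (f := fun t : ℝ => ((t ^ k : ℝ) : ℂ) * s (t * z))
    (f' := fun t : ℝ => (k : ℂ) * (((t ^ (k - 1) : ℝ) : ℂ) * s (t * z)) +
      z * (((t ^ (k - 1) : ℝ) : ℂ) * (deriv s (t * z) * t)))
    (fun t ht => by
      rw [hI] at ht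
      have h1 : HasDerivAt (fun x : ℝ => ((x ^ k : ℝ) : ℂ)) ((k * t ^ (k - 1) : ℝ) : ℂ) t :=
        (Real.hasDerivAt_rpow_const (Or.inr hk)).ofReal_comp
      have h2 : HasDerivAt (fun x : ℝ => (x : ℂ) * z) z t := by
        simpa using (Complex.ofRealCLM.hasDerivAt (x := t)).mul_const z
      have h3 := (hd _ (hcl (hmem z hz t ht))).comp t h2
      refine (h1.mul h3).congr_deriv ?_
      have h4 : t ^ k = t ^ (k - 1) * t := by
        rcases ht.1.eq_or_lt with rfl | h
        · rw [Real.zero_rpow (by linarith), mul_zero]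
        · rw [← Real.rpow_add_one h.ne', sub_add_cancel]
      rw [h4]; push_cast; simp only [Function.comp_apply]; ring)
    (by
      refine ContinuousOn.intervalIntegrable ?_
      rw [hI]
      exact (continuousOn_const.mul (hF z hz)).add (continuousOn_const.mul (hF' z hz)))
  rw [intervalIntegral.integral_add, intervalIntegral.integral_const_mul,
    intervalIntegral.integral_const_mul] at hFTC
  · rw [hFTC]
    simp [Real.zero_rpow (show k ≠ 0 by linarith)]
  · refine ContinuousOn.intervalIntegrable ?_
    rw [hI]; exact continuousOn_const.mul (hF z hz)
  · refine ContinuousOn.intervalIntegrable ?_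
    rw [hI]; exact continuousOn_const.mul (hF' z hz)

/-- A natural coordinate near the zero of `φ`: up to a constant factor, the `φ`-metric is that of
`ζ ^ n dζ²`. -/
structure IsNatCoord (φ : ℂ → ℂ) (M : Set ℂ) (n : ℕ) (C ρ : ℝ) (Z : OpenPartialHomeomorph ℂ ℂ) :
    Prop where
  C_pos : 0 < C
  ρ_pos : 0 < ρ
  zero_mem : (0 : ℂ) ∈ Z.source
  source_subset : Z.source ⊆ M
  map_zero : Z 0 = 0
  hasDerivAt_zero : HasDerivAt Z 1 0
  exists_hasDerivAt : ∀ z ∈ Z.source, ∃ d : ℂ, d ≠ 0 ∧ HasDerivAt Z d z ∧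
    ‖φ z‖ = C * ‖Z z‖ ^ n * ‖d‖ ^ 2
  target_eq : Z.target = Metric.ball 0 ρ

/-- Write φ = z^n g and let s be the square root of g/g(0) with s(0) = 1. A coordinate f with f^n
f'² = z^n s² is wanted, formally (f^k)' = k z^(k-1) s, because k - 1 = n/2. With k S + z S' = s the
function z^k · k S has this derivative, which suggests f = z (k S)^(1/k). This is single-valued near
0 since k S(0) = 1, and the multivalued z^k is never formed. The constant is C = |g(0)|. -/
theorem exists_isNatCoord {φ : ℂ → ℂ} {n : ℕ} {M : Set ℂ} (hM : IsZeroNbhd φ n M) :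
    ∃ C ρ Z, IsNatCoord φ M n C ρ Z := by
  have hφ : AnalyticAt ℂ φ 0 := hM.holomorphic.analyticAt (hM.isOpen.mem_nhds hM.zero_mem)
  obtain ⟨g, hg, hg0, hgφ⟩ := hφ.analyticOrderAt_eq_natCast.1 hM.order
  have hk := one_le_expt n
  have hkp := expt_pos n
  set k := expt n with hkdef
  have hkC : (k : ℂ) ≠ 0 := by exact_mod_cast hkp.ne'
  have hgs : ∀ᶠ z in 𝓝 (0 : ℂ), g z / g 0 ∈ Complex.slitPlane := by
    have : ContinuousAt (fun z => g z / g 0) 0 := hg.continuousAt.div_const _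
    refine this.eventually (Complex.isOpen_slitPlane.mem_nhds ?_)
    beta_reduce
    rw [div_self hg0]
    exact Complex.one_mem_slitPlane
  obtain ⟨R, hR, hgood⟩ := Metric.eventually_nhds_iff_ball.1
    (hgs.and (hg.eventually_analyticAt.and (hgφ.and (hM.isOpen.mem_nhds hM.zero_mem))))
  set s : ℂ → ℂ := fun z => (g z / g 0) ^ ((2 : ℕ) : ℂ)⁻¹ with hs
  have hs2 : ∀ z, s z ^ 2 = g z / g 0 := fun z => Complex.cpow_nat_inv_pow _ two_ne_zero
  have hsd : DifferentiableOn ℂ s (Metric.ball 0 R) := fun z hz =>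
    (((hgood z hz).2.1.differentiableAt.div_const _).cpow_const
      (hgood z hz).1).differentiableWithinAt
  have hs0 : s 0 = 1 := by simp [hs, div_self hg0]
  obtain ⟨S, hS⟩ := exists_radial_primitive hsd hk
  have h0b : (0 : ℂ) ∈ Metric.ball (0 : ℂ) (R / 2) := Metric.mem_ball_self (by linarith)
  have hT0 : (k : ℂ) * S 0 = 1 := by
    obtain ⟨S', -, h⟩ := hS 0 h0b
    rw [← hs0, ← h]; ring
  have hTs : ∀ᶠ z in 𝓝 (0 : ℂ), (k : ℂ) * S z ∈ Complex.slitPlane := by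
    obtain ⟨S', h, -⟩ := hS 0 h0b
    refine (h.continuousAt.const_mul (k : ℂ)).eventually (Complex.isOpen_slitPlane.mem_nhds ?_)
    beta_reduce
    rw [hT0]
    exact Complex.one_mem_slitPlane
  obtain ⟨R', hR', hgood'⟩ := Metric.eventually_nhds_iff_ball.1
    (hTs.and (Metric.isOpen_ball.mem_nhds h0b))
  set f : ℂ → ℂ := fun z => z * ((k : ℂ) * S z) ^ (((1 / k : ℝ)) : ℂ) with hf
  have hfd : ∀ z ∈ Metric.ball (0 : ℂ) R',
      HasDerivAt f (((k : ℂ) * S z) ^ (((1 / k - 1 : ℝ)) : ℂ) * s z) z := fun z hz => by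
    obtain ⟨hTz, hzR⟩ := hgood' z hz
    obtain ⟨S', h, hode⟩ := hS z hzR
    refine ((hasDerivAt_id z).mul ((h.const_mul (k : ℂ)).cpow_const
      (c := (((1 / k : ℝ)) : ℂ)) hTz)).congr_deriv ?_
    have hT : (k : ℂ) * S z ≠ 0 := Complex.slitPlane_ne_zero hTz
    have e1 : ((k : ℂ) * S z) ^ (((1 / k : ℝ)) : ℂ) =
        ((k : ℂ) * S z) ^ (((1 / k - 1 : ℝ)) : ℂ) * ((k : ℂ) * S z) := by
      nth_rewrite 3 [← Complex.cpow_one ((k : ℂ) * S z)]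
      rw [← Complex.cpow_add _ _ hT]; push_cast; congr 1; ring
    rw [← hode]
    simp only [id]
    rw [e1]
    push_cast
    field_simp
  have hfan : AnalyticAt ℂ f 0 := by
    have : DifferentiableOn ℂ f (Metric.ball 0 R') := fun z hz =>
      (hfd z hz).differentiableAt.differentiableWithinAt
    exact this.analyticAt (Metric.ball_mem_nhds 0 hR')
  have hf0 : f 0 = 0 := by simp [hf]
  have hfd0 : HasDerivAt f 1 0 := by
    have := hfd 0 (Metric.mem_ball_self hR')
    rwa [hT0, hs0, Complex.one_cpow, mul_one] at this
  have hstrict : HasStrictDerivAt f 1 0 := by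
    have := hfan.hasStrictDerivAt
    rwa [hfd0.deriv] at this
  have hstrict' := hstrict.hasStrictFDerivAt_equiv one_ne_zero
  set e := hstrict'.toOpenPartialHomeomorph f with he
  have hecoe : ⇑e = f := hstrict'.toOpenPartialHomeomorph_coe
  have hesrc : (0 : ℂ) ∈ e.source := hstrict'.mem_toOpenPartialHomeomorph_source
  set N : Set ℂ := Metric.ball 0 R' ∩ Metric.ball 0 R with hN
  have hNo : IsOpen N := Metric.isOpen_ball.inter Metric.isOpen_ball
  set e1 := e.restrOpen N hNo with he1
  have he1s : e1.source = e.source ∩ N := e.restrOpen_source N hNo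
  have he1c : ⇑e1 = f := hecoe
  have h0e1 : (0 : ℂ) ∈ e1.source := by
    rw [he1s]
    exact ⟨hesrc, Metric.mem_ball_self hR', Metric.mem_ball_self hR⟩
  have h0t : (0 : ℂ) ∈ e1.target := by
    have := e1.map_source h0e1
    rwa [he1c, hf0] at this
  obtain ⟨ρ, hρ, hρt⟩ := Metric.mem_nhds_iff.1 (e1.open_target.mem_nhds h0t)
  set Z := (e1.symm.restrOpen (Metric.ball 0 ρ) Metric.isOpen_ball).symm with hZ
  have hZc : ⇑Z = f := he1c
  have hZt : Z.target = Metric.ball 0 ρ := by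
    rw [hZ, OpenPartialHomeomorph.symm_target, OpenPartialHomeomorph.restrOpen_source,
      OpenPartialHomeomorph.symm_source, inter_eq_right.2 hρt]
  have hZs : Z.source ⊆ N := fun z hz => by
    have h1 : z ∈ e1.source := by
      have h2 := Z.map_source hz
      rw [hZt] at h2
      have h3 : z = e1.symm (Z z) := (Z.left_inv hz).symm
      rw [h3]
      exact e1.map_target (hρt h2)
    rw [he1s] at h1
    exact h1.2
  have hZ0 : (0 : ℂ) ∈ Z.source := by
    have h1 : Z.symm 0 ∈ Z.source := Z.map_target (by rw [hZt]; exact Metric.mem_ball_self hρ)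
    have h2 : Z.symm 0 = e1.symm (f 0) := by rw [hf0]; rfl
    rwa [h2, ← he1c, e1.left_inv h0e1] at h1
  refine ⟨‖g 0‖, ρ, Z, norm_pos_iff.2 hg0, hρ, hZ0,
    fun z hz => (hgood z (hZs hz).2).2.2.2, by rw [hZc, hf0], by rw [hZc]; exact hfd0,
    fun z hz => ?_, hZt⟩
  obtain ⟨hzR', hzR⟩ := hZs hz
  obtain ⟨hTz, -⟩ := hgood' z hzR'
  obtain ⟨hgz, -, hφz, -⟩ := hgood z hzR
  have hT : (k : ℂ) * S z ≠ 0 := Complex.slitPlane_ne_zero hTz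
  have hsz : s z ≠ 0 := fun h => by
    have := hs2 z
    rw [h, zero_pow two_ne_zero] at this
    exact Complex.slitPlane_ne_zero hgz this.symm
  refine ⟨((k : ℂ) * S z) ^ (((1 / k - 1 : ℝ)) : ℂ) * s z,
    mul_ne_zero (by rw [Complex.cpow_def_of_ne_zero hT]; exact Complex.exp_ne_zero _) hsz,
    by rw [hZc]; exact hfd z hzR', ?_⟩
  have ha : 0 < ‖(k : ℂ) * S z‖ := norm_pos_iff.2 hT
  have hg2 : ‖g z‖ = ‖g 0‖ * ‖s z‖ ^ 2 := by
    rw [← norm_pow, hs2, norm_div, mul_div_cancel₀ _ (norm_ne_zero_iff.2 hg0)]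
  rw [hZc, hφz, sub_zero, smul_eq_mul, hf]
  beta_reduce
  rw [norm_mul, norm_pow, norm_mul, norm_mul, Complex.norm_cpow_real, Complex.norm_cpow_real, hg2]
  set a := ‖(k : ℂ) * S z‖
  -- The exponents cancel: n/k + 2 (1/k - 1) = 0, as n = 2k - 2.
  have hone : (a ^ (1 / k)) ^ n * (a ^ (1 / k - 1)) ^ 2 = 1 := by
    rw [← Real.rpow_natCast, ← Real.rpow_natCast, ← Real.rpow_mul ha.le, ← Real.rpow_mul ha.le,
      ← Real.rpow_add ha]
    have : 1 / k * (n : ℝ) + (1 / k - 1) * ((2 : ℕ) : ℝ) = 0 := by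
      have : (n : ℝ) = 2 * k - 2 := by rw [hkdef, expt]; ring
      rw [this]; push_cast; field_simp; ring
    rw [this, Real.rpow_zero]
  calc ‖z‖ ^ n * (‖g 0‖ * ‖s z‖ ^ 2)
      = ‖g 0‖ * ‖z‖ ^ n * ‖s z‖ ^ 2 * ((a ^ (1 / k)) ^ n * (a ^ (1 / k - 1)) ^ 2) := by
        rw [hone]; ring
    _ = _ := by ring

/-! ### Real powers on the slit plane and the flat sector charts -/

theorem cpow_eq_exp {W : ℂ} (hW : W ≠ 0) (a : ℝ) :
    W ^ (a : ℂ) = Complex.exp (a * Complex.log W) := by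
  rw [Complex.cpow_def_of_ne_zero hW, mul_comm]

theorem log_cpow_ofReal {W : ℂ} (hW : W ≠ 0) {a : ℝ} (h : |a * W.arg| < Real.pi) :
    Complex.log (W ^ (a : ℂ)) = a * Complex.log W := by
  have hh := abs_lt.1 h
  rw [cpow_eq_exp hW, Complex.log_exp]
  · rw [Complex.im_ofReal_mul, Complex.log_im]; exact hh.1
  · rw [Complex.im_ofReal_mul, Complex.log_im]; exact hh.2.le

theorem arg_cpow_ofReal {W : ℂ} (hW : W ≠ 0) {a : ℝ} (h : |a * W.arg| < Real.pi) :
    (W ^ (a : ℂ)).arg = a * W.arg := by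
  rw [← Complex.log_im, log_cpow_ofReal hW h, Complex.im_ofReal_mul, Complex.log_im]

theorem cpow_ofReal_ne_zero {W : ℂ} (hW : W ≠ 0) (a : ℝ) : W ^ (a : ℂ) ≠ 0 := by
  rw [cpow_eq_exp hW]; exact Complex.exp_ne_zero _

theorem cpow_cpow_of_abs_arg_lt {W : ℂ} (hW : W ≠ 0) {a b : ℝ} (h : |a * W.arg| < Real.pi)
    (hab : a * b = 1) : (W ^ (a : ℂ)) ^ (b : ℂ) = W := by
  rw [cpow_eq_exp (cpow_ofReal_ne_zero hW a), log_cpow_ofReal hW h, ← mul_assoc,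
    ← Complex.ofReal_mul, mul_comm b, hab, Complex.ofReal_one, one_mul, Complex.exp_log hW]

theorem mem_slitPlane_of_abs_arg_lt {W : ℂ} (hW : W ≠ 0) (h : |W.arg| < Real.pi) :
    W ∈ Complex.slitPlane :=
  Complex.mem_slitPlane_iff_arg.2 ⟨(abs_lt.1 h).2.ne, hW⟩

theorem abs_arg_lt_of_mem_slitPlane {W : ℂ} (h : W ∈ Complex.slitPlane) : |W.arg| < Real.pi :=
  abs_lt.2 ⟨Complex.neg_pi_lt_arg W, lt_of_le_of_ne (Complex.arg_le_pi W)
    (Complex.mem_slitPlane_iff_arg.1 h).1⟩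

theorem abs_inv_expt_mul_lt (n : ℕ) {x : ℝ} (h : |x| < Real.pi) : |1 / expt n * x| < Real.pi := by
  have hk := one_le_expt n
  rw [abs_mul, abs_of_pos (by positivity)]
  have : 1 / expt n ≤ 1 := by rw [div_le_one (by linarith)]; exact hk
  calc 1 / expt n * |x| ≤ 1 * |x| := mul_le_mul_of_nonneg_right this (abs_nonneg x)
    _ < Real.pi := by rwa [one_mul]

/-- The branch of `(v⁻¹ ζ) ^ k` on the sector of half-angle `π / k` around the ray through `v`. -/
noncomputable def sectorChart (n : ℕ) (v : ℂ) (hv : v ≠ 0) : OpenPartialHomeomorph ℂ ℂ where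
  toFun ζ := (v⁻¹ * ζ) ^ ((expt n : ℝ) : ℂ)
  invFun W := v * W ^ ((1 / expt n : ℝ) : ℂ)
  source := {ζ | v⁻¹ * ζ ∈ Complex.slitPlane ∧ |expt n * (v⁻¹ * ζ).arg| < Real.pi}
  target := Complex.slitPlane
  map_source' ζ hζ := by
    have h0 := Complex.slitPlane_ne_zero hζ.1
    refine mem_slitPlane_of_abs_arg_lt (cpow_ofReal_ne_zero h0 _) ?_
    rw [arg_cpow_ofReal h0 hζ.2]
    exact hζ.2
  map_target' W hW := by
    have h0 := Complex.slitPlane_ne_zero hW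
    have h1 := abs_arg_lt_of_mem_slitPlane hW
    have h2 := abs_inv_expt_mul_lt n h1
    rw [mem_ofPred_eq, inv_mul_cancel_left₀ hv, arg_cpow_ofReal h0 h2]
    refine ⟨mem_slitPlane_of_abs_arg_lt (cpow_ofReal_ne_zero h0 _) ?_, ?_⟩
    · rwa [arg_cpow_ofReal h0 h2]
    · rwa [← mul_assoc, mul_one_div_cancel (expt_pos n).ne', one_mul]
  left_inv' ζ hζ := by
    rw [cpow_cpow_of_abs_arg_lt (Complex.slitPlane_ne_zero hζ.1) hζ.2
      (mul_one_div_cancel (expt_pos n).ne'), mul_inv_cancel_left₀ hv]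
  right_inv' W hW := by
    rw [inv_mul_cancel_left₀ hv, cpow_cpow_of_abs_arg_lt (Complex.slitPlane_ne_zero hW)
      (abs_inv_expt_mul_lt n (abs_arg_lt_of_mem_slitPlane hW))
      (one_div_mul_cancel (expt_pos n).ne')]
  open_source := by
    have h1 : IsOpen {ζ : ℂ | v⁻¹ * ζ ∈ Complex.slitPlane} :=
      Complex.isOpen_slitPlane.preimage (by fun_prop)
    have h2 : ContinuousOn (fun ζ : ℂ => |expt n * (v⁻¹ * ζ).arg|)
        {ζ : ℂ | v⁻¹ * ζ ∈ Complex.slitPlane} := fun ζ hζ => by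
      have h3 : ContinuousAt (fun ζ : ℂ => (v⁻¹ * ζ).arg) ζ :=
        (Complex.continuousAt_arg hζ).comp (f := fun ζ : ℂ => v⁻¹ * ζ) (by fun_prop)
      exact (continuousAt_const.mul h3).abs.continuousWithinAt
    exact h2.isOpen_inter_preimage h1 isOpen_Iio
  open_target := Complex.isOpen_slitPlane
  continuousOn_toFun ζ hζ := by
    have h : ContinuousAt (fun ζ : ℂ => v⁻¹ * ζ) ζ := by fun_prop
    exact ((continuousAt_cpow_const hζ.1).comp (f := fun ζ : ℂ => v⁻¹ * ζ) h).continuousWithinAt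
  continuousOn_invFun W hW := by
    exact (continuousAt_const.mul (continuousAt_cpow_const hW)).continuousWithinAt

theorem sectorChart_symm_apply (n : ℕ) (v : ℂ) (hv : v ≠ 0) (W : ℂ) :
    (sectorChart n v hv).symm W = v * W ^ ((1 / expt n : ℝ) : ℂ) := rfl

theorem sectorChart_target (n : ℕ) (v : ℂ) (hv : v ≠ 0) :
    (sectorChart n v hv).target = Complex.slitPlane := rfl

theorem norm_sectorChart_symm (n : ℕ) {v : ℂ} (hv : v ≠ 0) (hv1 : ‖v‖ = 1) (W : ℂ) :
    ‖(sectorChart n v hv).symm W‖ = ‖W‖ ^ (1 / expt n) := by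
  rw [sectorChart_symm_apply, norm_mul, Complex.norm_cpow_real, hv1, one_mul]

/-- The natural parameter on the sector around the ray through `v`. -/
noncomputable def natChart (n : ℕ) (Z : OpenPartialHomeomorph ℂ ℂ) (v : ℂ) (hv : v ≠ 0) :
    OpenPartialHomeomorph ℂ ℂ :=
  Z.trans (sectorChart n v hv)

theorem natChart_symm_apply (n : ℕ) (Z : OpenPartialHomeomorph ℂ ℂ) (v : ℂ) (hv : v ≠ 0) (W : ℂ) :
    (natChart n Z v hv).symm W = Z.symm ((sectorChart n v hv).symm W) := rfl

section

variable {φ : ℂ → ℂ} {M : Set ℂ} {n : ℕ} {C ρ : ℝ} {Z : OpenPartialHomeomorph ℂ ℂ}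

theorem IsNatCoord.mem_target_natChart (hZ : IsNatCoord φ M n C ρ Z) {v : ℂ} (hv : v ≠ 0)
    (hv1 : ‖v‖ = 1) {W : ℂ} :
    W ∈ (natChart n Z v hv).target ↔ W ∈ Complex.slitPlane ∧ ‖W‖ < ρ ^ expt n := by
  have hk := expt_pos n
  rw [natChart, OpenPartialHomeomorph.trans_target, mem_inter_iff, sectorChart_target, mem_preimage,
    hZ.target_eq, mem_ball_zero_iff, norm_sectorChart_symm n hv hv1]
  refine and_congr_right fun _ => ?_
  rw [← Real.rpow_lt_rpow_iff (by positivity) hZ.ρ_pos.le hk, ← Real.rpow_mul (norm_nonneg _),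
    one_div_mul_cancel hk.ne', Real.rpow_one]

/-- From |d(ζ^k)| = k |ζ|^(k-1) |dζ| and k - 1 = n/2 it follows that |d(ζ^k)| is k/√C times √|φ|
|dz|. The rotation by `v` has no effect on norms. -/
theorem IsNatCoord.isFlatChart (hZ : IsNatCoord φ M n C ρ Z) {v : ℂ} (hv : v ≠ 0)
    (hv1 : ‖v‖ = 1) : IsFlatChart φ M (√C / expt n) (natChart n Z v hv) := by
  have hk := expt_pos n
  refine ⟨div_pos (Real.sqrt_pos.2 hZ.C_pos) hk, fun z hz => hZ.source_subset hz.1,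
    fun z hz => ?_⟩
  obtain ⟨hz1, hz2⟩ := hz
  obtain ⟨d, hd0, hd, hφ⟩ := hZ.exists_hasDerivAt z hz1
  have hz0 : v⁻¹ * Z z ≠ 0 := Complex.slitPlane_ne_zero hz2.1
  have hder : HasDerivAt (natChart n Z v hv)
      ((expt n : ℂ) * (v⁻¹ * Z z) ^ (((expt n - 1 : ℝ)) : ℂ) * (v⁻¹ * d)) z := by
    have := (hd.const_mul v⁻¹).cpow_const (c := ((expt n : ℝ) : ℂ)) hz2.1
    rwa [← Complex.ofReal_one, ← Complex.ofReal_sub] at this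
  refine ⟨_, mul_ne_zero (mul_ne_zero (by exact_mod_cast hk.ne') (cpow_ofReal_ne_zero hz0 _))
    (mul_ne_zero (inv_ne_zero hv) hd0), hder, ?_⟩
  have hn : ‖v⁻¹ * Z z‖ = ‖Z z‖ := by rw [norm_mul, norm_inv, hv1, inv_one, one_mul]
  rw [norm_mul, norm_mul, norm_mul v⁻¹ d, Complex.norm_cpow_real, hn, norm_inv, hv1, inv_one, one_mul,
    Complex.norm_real, Real.norm_of_nonneg hk.le, hφ]
  have h2 : C * ‖Z z‖ ^ n * ‖d‖ ^ 2 = (√C * ‖Z z‖ ^ (expt n - 1) * ‖d‖) ^ 2 := by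
    rw [mul_pow, mul_pow, Real.sq_sqrt hZ.C_pos.le, ← Real.rpow_natCast (‖Z z‖ ^ _),
      ← Real.rpow_mul (norm_nonneg _), ← Real.rpow_natCast ‖Z z‖ n]
    congr 3
    rw [expt]; push_cast; ring
  rw [h2, Real.sqrt_sq (by positivity)]
  field_simp

end

/-! ### Polar coordinates and tiles -/

/-- The unit complex number of argument `β`. -/
noncomputable def cis (β : ℝ) : ℂ := Complex.exp (β * Complex.I)

theorem norm_cis (β : ℝ) : ‖cis β‖ = 1 := Complex.norm_exp_ofReal_mul_I β

theorem cis_ne_zero (β : ℝ) : cis β ≠ 0 := Complex.exp_ne_zero _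

theorem cis_zero : cis 0 = 1 := by simp [cis]

theorem cis_add (β γ : ℝ) : cis (β + γ) = cis β * cis γ := by
  rw [cis, cis, cis, ← Complex.exp_add]; push_cast; ring_nf

theorem cis_add_int_mul (β : ℝ) (j : ℤ) : cis (β + 2 * Real.pi * j) = cis β := by
  rw [cis, cis, Complex.exp_eq_exp_iff_exists_int]
  exact ⟨j, by push_cast; ring⟩

theorem continuous_cis : Continuous cis := by unfold cis; fun_prop

theorem arg_cis {β : ℝ} (h : |β| < Real.pi) : (cis β).arg = β := by
  have := abs_lt.1 h
  rw [cis, Complex.arg_exp_mul_I, toIocMod_eq_self]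
  exact ⟨this.1, by linarith [this.2]⟩

theorem norm_mul_cis_arg (z : ℂ) : (‖z‖ : ℂ) * cis z.arg = z := Complex.norm_mul_exp_arg_mul_I z

theorem arg_ofReal_mul_cis {r β : ℝ} (hr : 0 < r) (h : |β| < Real.pi) :
    ((r : ℂ) * cis β).arg = β := by
  rw [Complex.arg_real_mul _ hr, arg_cis h]

theorem norm_ofReal_mul_cis {r : ℝ} (hr : 0 ≤ r) (β : ℝ) : ‖(r : ℂ) * cis β‖ = r := by
  rw [norm_mul, norm_cis, mul_one, Complex.norm_real, Real.norm_of_nonneg hr]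

theorem eq_of_ofReal_mul_cis_eq {r r' β β' : ℝ} (hr : 0 < r) (hr' : 0 < r')
    (h : (r : ℂ) * cis β = r' * cis β') : r = r' ∧ ∃ j : ℤ, β = β' + 2 * Real.pi * j := by
  have h1 : r = r' := by
    rw [← norm_ofReal_mul_cis hr.le β, h, norm_ofReal_mul_cis hr'.le]
  refine ⟨h1, ?_⟩
  subst h1
  have h2 := mul_left_cancel₀ (by exact_mod_cast hr.ne') h
  obtain ⟨j, hj⟩ := Complex.exp_eq_exp_iff_exists_int.1 h2
  refine ⟨j, ?_⟩
  have h3 : ((β : ℂ) - (β' + 2 * Real.pi * j)) * Complex.I = 0 := by rw [sub_mul, hj]; ring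
  have h4 := (mul_eq_zero.1 h3).resolve_right Complex.I_ne_zero
  exact_mod_cast sub_eq_zero.1 h4

theorem sectorChart_symm_eq_polar (n : ℕ) (μ : ℝ) {W : ℂ} (hW : W ≠ 0) :
    (sectorChart n (cis μ) (cis_ne_zero μ)).symm W =
      ((‖W‖ ^ (1 / expt n) : ℝ) : ℂ) * cis (μ + W.arg / expt n) := by
  have hn : (0 : ℝ) < ‖W‖ := norm_pos_iff.2 hW
  have h : W ^ ((1 / expt n : ℝ) : ℂ) = ((‖W‖ ^ (1 / expt n) : ℝ) : ℂ) * cis (W.arg / expt n) := by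
    rw [cpow_eq_exp hW, cis, Complex.ofReal_cpow hn.le, cpow_eq_exp (by exact_mod_cast hn.ne'),
      ← Complex.exp_add, Complex.log, ← Complex.ofReal_log hn.le]
    push_cast
    ring_nf
  rw [sectorChart_symm_apply, h, cis_add]
  ring

/-- The opening angle of a hyperbolic sector. -/
noncomputable def gap (n : ℕ) : ℝ := Real.pi / expt n

theorem gap_pos (n : ℕ) : 0 < gap n := div_pos Real.pi_pos (expt_pos n)

theorem weight_h (n : ℕ) : Letter.h.weight n = gap n := by
  simp only [Letter.weight, gap, expt]
  have : (n : ℝ) + 2 ≠ 0 := by positivity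
  field_simp

theorem expt_mul_gap (n : ℕ) : expt n * gap n = Real.pi := by
  rw [gap, mul_div_cancel₀ _ (expt_pos n).ne']

/-- The hypothesis `1 ≤ n` enters through this bound. It keeps a hyperbolic sector so narrow that
lifts of arguments can be chosen unambiguously in `modelRel_iff_exists_isTile`. -/
theorem gap_le {n : ℕ} (hn : 1 ≤ n) : gap n ≤ 2 * Real.pi / 3 := by
  have : (1 : ℝ) ≤ n := by exact_mod_cast hn
  have hk : 3 / 2 ≤ expt n := by rw [expt]; linarith
  rw [gap, div_le_div_iff₀ (expt_pos n) (by norm_num)]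
  nlinarith [Real.pi_pos]

/-- The level function of a model sector, `δ` being the angle from a boundary radius. -/
noncomputable def level (n : ℕ) : Letter → ℝ → ℝ → ℝ
  | .h, r, δ => r ^ expt n * Real.sin (expt n * δ)
  | .p _, _, δ => δ

/-- Points given in polar coordinates lie on the same level in the model sector of type `s` whose
first boundary ray has argument `c`. -/
def TileRel (n : ℕ) (c : ℝ) (s : Letter) (r β r' β' : ℝ) : Prop :=
  β ∈ Icc (c - s.weight n) c ∧ β' ∈ Icc (c - s.weight n) c ∧
    level n s r (c - β) = level n s r' (c - β')

theorem TileRel.symm {n : ℕ} {c : ℝ} {s : Letter} {r β r' β' : ℝ} (h : TileRel n c s r β r' β') :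
    TileRel n c s r' β' r β := ⟨h.2.1, h.1, h.2.2.symm⟩

theorem TileRel.sectorRel {n : ℕ} {c : ℝ} {s : Letter} {r β r' β' : ℝ} (hr : 0 < r) (hr' : 0 < r')
    (h : TileRel n c s r β r' β') : SectorRel n c s (r * cis β) (r' * cis β') := by
  obtain ⟨h1, h2, h3⟩ := h
  refine ⟨r, r', c - β, c - β', hr, hr', ⟨by linarith [h1.2], by linarith [h1.1]⟩,
    ⟨by linarith [h2.2], by linarith [h2.1]⟩, by rw [sub_sub_cancel]; rfl,
    by rw [sub_sub_cancel]; rfl, ?_⟩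
  cases s <;> exact h3

theorem SectorRel.exists_tileRel {n : ℕ} {c : ℝ} {s : Letter} {r β r' β' : ℝ} (hr : 0 < r)
    (hr' : 0 < r') (h : SectorRel n c s (r * cis β) (r' * cis β')) :
    ∃ j j' : ℤ, TileRel n c s r (β + 2 * Real.pi * j) r' (β' + 2 * Real.pi * j') := by
  obtain ⟨r1, r1', δ, δ', hr1, hr1', hδ, hδ', ha, hb, hlev⟩ := h
  obtain ⟨rfl, j, hj⟩ := eq_of_ofReal_mul_cis_eq hr hr1 ha
  obtain ⟨rfl, j', hj'⟩ := eq_of_ofReal_mul_cis_eq hr' hr1' hb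
  have e1 : β + 2 * Real.pi * ((-j : ℤ) : ℝ) = c - δ := by rw [hj]; push_cast; ring
  have e2 : β' + 2 * Real.pi * ((-j' : ℤ) : ℝ) = c - δ' := by rw [hj']; push_cast; ring
  refine ⟨-j, -j', ?_, ?_, ?_⟩
  · rw [e1]; exact ⟨by linarith [hδ.2], by linarith [hδ.1]⟩
  · rw [e2]; exact ⟨by linarith [hδ'.2], by linarith [hδ'.1]⟩
  · rw [e1, e2, sub_sub_cancel, sub_sub_cancel]
    cases s <;> exact hlev

/-- The sectors of the singularity `w`, with the arguments of their first boundary rays. -/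
noncomputable def tiles (n : ℕ) : ℝ → Word → List (ℝ × Letter)
  | _, [] => []
  | θ, s :: w => (θ, s) :: tiles n (θ - s.weight n) w

theorem modelRel_iff_exists_tile (n : ℕ) (θ : ℝ) (w : Word) (a b : ℂ) :
    ModelRel n θ w a b ↔ ∃ c s, (c, s) ∈ tiles n θ w ∧ SectorRel n c s a b := by
  induction w generalizing θ with
  | nil => simp [ModelRel, tiles]
  | cons s w ih =>
    simp only [ModelRel, tiles, ih, List.mem_cons, Prod.mk.injEq]
    constructor
    · rintro (h | ⟨c, t, h1, h2⟩)
      · exact ⟨θ, s, Or.inl ⟨rfl, rfl⟩, h⟩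
      · exact ⟨c, t, Or.inr h1, h2⟩
    · rintro ⟨c, t, ⟨rfl, rfl⟩ | h1, h2⟩
      · exact Or.inl h2
      · exact Or.inr ⟨c, t, h1, h2⟩

theorem bounds_of_mem_tiles {n : ℕ} {θ : ℝ} {w : Word} {c : ℝ} {s : Letter}
    (h : (c, s) ∈ tiles n θ w) : θ - wordWeight n w ≤ c - s.weight n ∧ c ≤ θ := by
  induction w generalizing θ with
  | nil => simp [tiles] at h
  | cons t w ih =>
    have hw : 0 ≤ wordWeight n w := List.sum_nonneg fun x hx => by
      obtain ⟨y, -, rfl⟩ := List.mem_map.1 hx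
      exact (y.weight_pos n).le
    have ht := t.weight_pos n
    rw [wordWeight_cons]
    rcases List.mem_cons.1 h with h | h
    · obtain ⟨rfl, rfl⟩ := Prod.mk.inj h
      exact ⟨by linarith, le_rfl⟩
    · have := ih h
      exact ⟨by linarith [this.1], by linarith [this.2]⟩

theorem eq_or_le_of_mem_tiles {n : ℕ} {θ : ℝ} {w : Word} {c c' : ℝ} {s s' : Letter}
    (h : (c, s) ∈ tiles n θ w) (h' : (c', s') ∈ tiles n θ w) :
    (c = c' ∧ s = s') ∨ c ≤ c' - s'.weight n ∨ c' ≤ c - s.weight n := by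
  induction w generalizing θ with
  | nil => simp [tiles] at h
  | cons t w ih =>
    rcases List.mem_cons.1 h with h1 | h1 <;> rcases List.mem_cons.1 h' with h2 | h2
    · obtain ⟨rfl, rfl⟩ := Prod.mk.inj h1
      obtain ⟨rfl, rfl⟩ := Prod.mk.inj h2
      exact Or.inl ⟨rfl, rfl⟩
    · obtain ⟨rfl, rfl⟩ := Prod.mk.inj h1
      exact Or.inr (Or.inr (bounds_of_mem_tiles h2).2)
    · obtain ⟨rfl, rfl⟩ := Prod.mk.inj h2
      exact Or.inr (Or.inl (bounds_of_mem_tiles h1).2)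
    · exact ih h1 h2

theorem exists_mem_tiles_right {n : ℕ} {θ : ℝ} {w : Word} {β : ℝ} (h : θ - wordWeight n w ≤ β)
    (h' : β < θ) : ∃ c s, (c, s) ∈ tiles n θ w ∧ c - s.weight n ≤ β ∧ β < c := by
  induction w generalizing θ with
  | nil => rw [wordWeight_nil] at h; linarith
  | cons t w ih =>
    rcases le_or_gt (θ - t.weight n) β with h1 | h1
    · exact ⟨θ, t, List.mem_cons_self, h1, h'⟩
    · obtain ⟨c, s, h2, h3⟩ := ih (by rw [wordWeight_cons] at h; linarith) h1
      exact ⟨c, s, List.mem_cons_of_mem _ h2, h3⟩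

theorem exists_mem_tiles_left {n : ℕ} {θ : ℝ} {w : Word} {β : ℝ} (h : θ - wordWeight n w < β)
    (h' : β ≤ θ) : ∃ c s, (c, s) ∈ tiles n θ w ∧ c - s.weight n < β ∧ β ≤ c := by
  induction w generalizing θ with
  | nil => rw [wordWeight_nil] at h; linarith
  | cons t w ih =>
    rcases lt_or_ge (θ - t.weight n) β with h1 | h1
    · exact ⟨θ, t, List.mem_cons_self, h1, h'⟩
    · obtain ⟨c, s, h2, h3⟩ := ih (by rw [wordWeight_cons] at h; linarith) h1
      exact ⟨c, s, List.mem_cons_of_mem _ h2, h3⟩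

/-- The sectors of the singularity `w`, lifted to the universal cover of `ℂ \ {0}`. -/
def IsTile (n : ℕ) (θ : ℝ) (w : Word) (c : ℝ) (s : Letter) : Prop :=
  ∃ j : ℤ, (c + 2 * Real.pi * j, s) ∈ tiles n θ w

theorem exists_int_add_mem_Ico (β θ : ℝ) :
    ∃ j : ℤ, θ - 2 * Real.pi ≤ β + 2 * Real.pi * j ∧ β + 2 * Real.pi * j < θ := by
  have hp : (0 : ℝ) < 2 * Real.pi := by positivity
  obtain ⟨j, hj, -⟩ := existsUnique_add_zsmul_mem_Ico hp β (θ - 2 * Real.pi)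
  refine ⟨j, ?_⟩
  rw [zsmul_eq_mul] at hj
  exact ⟨by linarith [hj.1], by linarith [hj.2]⟩

theorem exists_int_add_mem_Ioc (β θ : ℝ) :
    ∃ j : ℤ, θ - 2 * Real.pi < β + 2 * Real.pi * j ∧ β + 2 * Real.pi * j ≤ θ := by
  have hp : (0 : ℝ) < 2 * Real.pi := by positivity
  obtain ⟨j, hj, -⟩ := existsUnique_add_zsmul_mem_Ioc hp β (θ - 2 * Real.pi)
  refine ⟨j, ?_⟩
  rw [zsmul_eq_mul] at hj
  exact ⟨by linarith [hj.1], by linarith [hj.2]⟩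

section Tiles

variable {n : ℕ} {θ : ℝ} {w : Word}

/-- On a ray between two tiles this selects the one on the side of larger arguments, and
`exists_isTile_left` the one on the side of smaller arguments. -/
theorem exists_isTile_right (hw : wordWeight n w = 2 * Real.pi) (β : ℝ) :
    ∃ c s, IsTile n θ w c s ∧ c - s.weight n ≤ β ∧ β < c := by
  obtain ⟨j, h1, h2⟩ := exists_int_add_mem_Ico β θ
  obtain ⟨c, s, h, h3, h4⟩ := exists_mem_tiles_right (by rw [hw]; exact h1) h2
  exact ⟨c - 2 * Real.pi * j, s, ⟨j, by rwa [sub_add_cancel]⟩, by linarith, by linarith⟩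

theorem exists_isTile_left (hw : wordWeight n w = 2 * Real.pi) (β : ℝ) :
    ∃ c s, IsTile n θ w c s ∧ c - s.weight n < β ∧ β ≤ c := by
  obtain ⟨j, h1, h2⟩ := exists_int_add_mem_Ioc β θ
  obtain ⟨c, s, h, h3, h4⟩ := exists_mem_tiles_left (by rw [hw]; exact h1) h2
  exact ⟨c - 2 * Real.pi * j, s, ⟨j, by rwa [sub_add_cancel]⟩, by linarith, by linarith⟩

/-- The tiles of one turn fill an interval of length exactly 2π, so their translates by different
multiples of 2π do not overlap either. -/
theorem IsTile.eq_or_le (hw : wordWeight n w = 2 * Real.pi) {c c' : ℝ} {s s' : Letter}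
    (h : IsTile n θ w c s) (h' : IsTile n θ w c' s') :
    (c = c' ∧ s = s') ∨ c ≤ c' - s'.weight n ∨ c' ≤ c - s.weight n := by
  obtain ⟨j, hj⟩ := h
  obtain ⟨j', hj'⟩ := h'
  have hb := bounds_of_mem_tiles hj
  have hb' := bounds_of_mem_tiles hj'
  rw [hw] at hb hb'
  have hp := Real.pi_pos
  rcases lt_trichotomy j j' with h | rfl | h
  · have : ((j : ℝ) + 1) ≤ j' := by exact_mod_cast h
    right; right
    nlinarith [hb.1, hb'.2]
  · rcases eq_or_le_of_mem_tiles hj hj' with ⟨h1, h2⟩ | h1 | h1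
    · exact Or.inl ⟨by linarith, h2⟩
    · exact Or.inr (Or.inl (by linarith))
    · exact Or.inr (Or.inr (by linarith))
  · have : ((j' : ℝ) + 1) ≤ j := by exact_mod_cast h
    right; left
    nlinarith [hb.2, hb'.1]

/-- Passage from points to real arguments. The sector determines lifts of `β` and `β'` with integers
`j` and `j'` that could differ. Within a hyperbolic tile the lifts are at most 2π/3 apart, within a
parabolic one they are related only if equal. As `β` and `β'` differ by less than 4π/3, the
difference `j - j'` is less than 1 in absolute value. -/
theorem modelRel_iff_exists_isTile (hn : 1 ≤ n) {r r' β β' : ℝ} (hr : 0 < r) (hr' : 0 < r')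
    (hβ : |β - β'| < 4 * Real.pi / 3) :
    ModelRel n θ w (r * cis β) (r' * cis β') ↔
      ∃ c s, IsTile n θ w c s ∧ TileRel n c s r β r' β' := by
  have hp := Real.pi_pos
  rw [modelRel_iff_exists_tile]
  constructor
  · rintro ⟨c, s, hc, h⟩
    obtain ⟨j, j', h1, h2, h3⟩ := h.exists_tileRel hr hr'
    have hjj : j = j' := by
      have hlt : |2 * Real.pi * ((j - j' : ℤ) : ℝ)| < 2 * Real.pi * 1 := by
        have hβ' := abs_lt.1 hβ
        rw [abs_lt]
        cases s with
        | h =>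
          rw [weight_h] at h1 h2
          have := gap_le hn
          push_cast
          constructor <;> linarith [h1.1, h1.2, h2.1, h2.2]
        | p α =>
          simp only [level] at h3
          push_cast
          constructor <;> linarith
      rw [abs_mul, abs_of_pos (by positivity)] at hlt
      have h4 := lt_of_mul_lt_mul_left hlt (by positivity)
      have h5 : |j - j'| < 1 := by exact_mod_cast h4
      have := Int.abs_lt_one_iff.1 h5
      omega
    subst hjj
    refine ⟨c - 2 * Real.pi * j, s, ⟨j, by rwa [sub_add_cancel]⟩,
      ⟨by linarith [h1.1], by linarith [h1.2]⟩, ⟨by linarith [h2.1], by linarith [h2.2]⟩, ?_⟩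
    rw [show c - 2 * Real.pi * j - β = c - (β + 2 * Real.pi * j) by ring,
      show c - 2 * Real.pi * j - β' = c - (β' + 2 * Real.pi * j) by ring]
    exact h3
  · rintro ⟨c, s, ⟨j, hj⟩, h1, h2, h3⟩
    refine ⟨_, s, hj, ?_⟩
    rw [← cis_add_int_mul β j, ← cis_add_int_mul β' j]
    refine TileRel.sectorRel hr hr' ⟨⟨by linarith [h1.1], by linarith [h1.2]⟩,
      ⟨by linarith [h2.1], by linarith [h2.2]⟩, ?_⟩
    rwa [add_sub_add_right_eq_sub, add_sub_add_right_eq_sub]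

end Tiles

/-! ### Foliation charts of the singularity of a word -/

theorem abs_arg_div_expt_le (n : ℕ) {W : ℂ} (hW : 0 ≤ W.re) : |W.arg / expt n| ≤ gap n / 2 := by
  have h := Complex.abs_arg_le_pi_div_two_iff.2 hW
  rw [abs_div, abs_of_pos (expt_pos n), gap, div_le_iff₀ (expt_pos n)]
  calc |W.arg| ≤ Real.pi / 2 := h
    _ = Real.pi / expt n / 2 * expt n := by field_simp [(expt_pos n).ne']

theorem abs_arg_div_expt_lt (n : ℕ) {W : ℂ} (hW : 0 < W.re) : |W.arg / expt n| < gap n / 2 := by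
  have h := Complex.abs_arg_lt_pi_div_two_iff.2 (Or.inl hW)
  rw [abs_div, abs_of_pos (expt_pos n), gap, div_lt_iff₀ (expt_pos n)]
  calc |W.arg| < Real.pi / 2 := h
    _ = Real.pi / expt n / 2 * expt n := by field_simp [(expt_pos n).ne']

theorem level_h_eq_re (n : ℕ) (μ : ℝ) (W : ℂ) :
    level n .h (‖W‖ ^ (1 / expt n)) (μ + gap n / 2 - (μ + W.arg / expt n)) = W.re := by
  have hk := expt_pos n
  rw [level, ← Real.rpow_mul (norm_nonneg _), one_div_mul_cancel hk.ne', Real.rpow_one]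
  have : expt n * (μ + gap n / 2 - (μ + W.arg / expt n)) = Real.pi / 2 - W.arg := by
    rw [← expt_mul_gap n]; field_simp; ring
  rw [this, Real.sin_pi_div_two_sub, Complex.norm_mul_cos_arg]

/-- In the natural parameter, the leaves of a hyperbolic sector are vertical lines. -/
theorem tileRel_h_iff (n : ℕ) (μ : ℝ) {W W' : ℂ} (hr : 0 ≤ W.re) (hr' : 0 ≤ W'.re) :
    TileRel n (μ + gap n / 2) .h (‖W‖ ^ (1 / expt n)) (μ + W.arg / expt n)
      (‖W'‖ ^ (1 / expt n)) (μ + W'.arg / expt n) ↔ W.re = W'.re := by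
  have h := abs_le.1 (abs_arg_div_expt_le n hr)
  have h' := abs_le.1 (abs_arg_div_expt_le n hr')
  rw [TileRel, level_h_eq_re n μ W, level_h_eq_re n μ W', weight_h]
  refine ⟨fun h => h.2.2, fun h3 => ⟨⟨?_, ?_⟩, ⟨?_, ?_⟩, h3⟩⟩ <;> linarith

section Charts

variable {n : ℕ} {θ : ℝ} {w : Word}

theorem IsTile.modelRel_h (hn : 1 ≤ n) {μ : ℝ} (h : IsTile n θ w (μ + gap n / 2) .h) {W W' : ℂ}
    (hW : W ≠ 0) (hW' : W' ≠ 0) (hr : 0 ≤ W.re) (hr' : 0 ≤ W'.re) (hre : W.re = W'.re) :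
    ModelRel n θ w ((sectorChart n (cis μ) (cis_ne_zero μ)).symm W)
      ((sectorChart n (cis μ) (cis_ne_zero μ)).symm W') := by
  rw [sectorChart_symm_eq_polar n μ hW, sectorChart_symm_eq_polar n μ hW',
    modelRel_iff_exists_isTile hn (Real.rpow_pos_of_pos (norm_pos_iff.2 hW) _)
      (Real.rpow_pos_of_pos (norm_pos_iff.2 hW') _)]
  · exact ⟨_, _, h, (tileRel_h_iff n μ hr hr').2 hre⟩
  · have h1 := abs_le.1 (abs_arg_div_expt_le n hr)
    have h2 := abs_le.1 (abs_arg_div_expt_le n hr')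
    have h3 := gap_le hn
    have h4 := Real.pi_pos
    rw [abs_lt]
    constructor <;> linarith

end Charts

/-- A chart can be shrunk to one whose target is a box. -/
theorem exists_shrink_box {X : Type*} [TopologicalSpace X] (e : OpenPartialHomeomorph X (ℝ × ℝ))
    {x : X} (hx : x ∈ e.source) {S : Set X} (hS : S ∈ 𝓝 x) :
    ∃ E : OpenPartialHomeomorph X (ℝ × ℝ), (∀ z, E z = e z) ∧ x ∈ E.source ∧
      E.source ⊆ S ∩ e.source ∧ ∃ a b c d : ℝ, E.target = Ioo a b ×ˢ Ioo c d := by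
  have h1 : e.symm ⁻¹' S ∩ e.target ∈ 𝓝 (e x) := by
    refine inter_mem ?_ (e.open_target.mem_nhds (e.map_source hx))
    have := e.symm.continuousAt (e.map_source hx)
    rw [ContinuousAt, e.left_inv hx] at this
    exact this hS
  obtain ⟨r, hr, hball⟩ := Metric.mem_nhds_iff.1 h1
  have hbox : Metric.ball (e x) r =
      Ioo ((e x).1 - r) ((e x).1 + r) ×ˢ Ioo ((e x).2 - r) ((e x).2 + r) := by
    rw [← Real.ball_eq_Ioo, ← Real.ball_eq_Ioo, ball_prod_same]
  have hsrc : ∀ z, z ∈ (e.symm.restrOpen (Metric.ball (e x) r) Metric.isOpen_ball).symm.source ↔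
      z ∈ e.source ∧ e z ∈ Metric.ball (e x) r := fun z => Iff.rfl
  refine ⟨(e.symm.restrOpen (Metric.ball (e x) r) Metric.isOpen_ball).symm, fun _ => rfl, ?_,
    fun z hz => ?_, (e x).1 - r, (e x).1 + r, (e x).2 - r, (e x).2 + r, ?_⟩
  · rw [hsrc]; exact ⟨hx, Metric.mem_ball_self hr⟩
  · rw [hsrc] at hz
    refine ⟨?_, hz.1⟩
    have := (hball hz.2).1
    rwa [mem_preimage, e.left_inv hz.1] at this
  · rw [← hbox, OpenPartialHomeomorph.symm_target, OpenPartialHomeomorph.restrOpen_source,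
      OpenPartialHomeomorph.symm_source]
    exact inter_eq_right.2 fun p hp => (hball hp).2

/-- `E` is a foliation chart of the singularity `w`. -/
def IsModelChart (n : ℕ) (θ : ℝ) (w : Word) (E : OpenPartialHomeomorph ℂ (ℝ × ℝ)) : Prop :=
  ∀ q ∈ E.source, ∀ q' ∈ E.source, (E q).2 = (E q').2 ↔ ModelRel n θ w q q'

section Charts

variable {n : ℕ} {θ : ℝ} {w : Word}

/-- The chart is (Im W, Re W) on the half-plane Re W > 0. An interior point of a hyperbolic tile
lies in no other tile, so no relation besides Re W = Re W' can occur. -/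
theorem IsTile.exists_isModelChart_h (hn : 1 ≤ n) (hw : wordWeight n w = 2 * Real.pi) {μ : ℝ}
    (h : IsTile n θ w (μ + gap n / 2) .h) {W₀ : ℂ} (hW₀ : 0 < W₀.re) :
    ∃ E, IsModelChart n θ w E ∧ (sectorChart n (cis μ) (cis_ne_zero μ)).symm W₀ ∈ E.source := by
  set σ := sectorChart n (cis μ) (cis_ne_zero μ) with hσ
  let P : ℂ ≃ₜ ℝ × ℝ := Complex.equivRealProdCLM.toHomeomorph.trans (Homeomorph.prodComm ℝ ℝ)
  have hP : ∀ z, (P z).2 = z.re := fun z => rfl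
  have hO : IsOpen {W : ℂ | 0 < W.re} := isOpen_lt continuous_const Complex.continuous_re
  have hs : {W : ℂ | 0 < W.re} ⊆ Complex.slitPlane := fun W hW => Or.inl hW
  set E : OpenPartialHomeomorph ℂ (ℝ × ℝ) :=
    (σ.symm.restrOpen _ hO).symm.trans P.toOpenPartialHomeomorph with hE
  have hEs : ∀ z, z ∈ E.source ↔ z ∈ σ.source ∧ 0 < (σ z).re := fun z => by
    simp [hE]
  have hEc : ∀ z, (E z).2 = (σ z).re := fun z => rfl
  refine ⟨E, fun q hq q' hq' => ?_, ?_⟩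
  · rw [hEs] at hq hq'
    rw [hEc, hEc]
    have e1 := σ.left_inv hq.1
    have e2 := σ.left_inv hq'.1
    generalize σ q = W at *
    generalize σ q' = W' at *
    have hW : W ≠ 0 := by rintro rfl; simp at hq
    have hW' : W' ≠ 0 := by rintro rfl; simp at hq'
    refine ⟨fun h3 => ?_, fun h3 => ?_⟩
    · rw [← e1, ← e2]
      exact h.modelRel_h hn hW hW' hq.2.le hq'.2.le h3
    · rw [← e1, ← e2, sectorChart_symm_eq_polar n μ hW, sectorChart_symm_eq_polar n μ hW'] at h3
      have h1 := abs_lt.1 (abs_arg_div_expt_lt n hq.2)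
      have h2 := abs_lt.1 (abs_arg_div_expt_lt n hq'.2)
      rw [modelRel_iff_exists_isTile hn (Real.rpow_pos_of_pos (norm_pos_iff.2 hW) _)
        (Real.rpow_pos_of_pos (norm_pos_iff.2 hW') _)] at h3
      · obtain ⟨c, s, hc, hrel⟩ := h3
        rcases hc.eq_or_le hw h with ⟨rfl, rfl⟩ | h4 | h4
        · exact (tileRel_h_iff n μ hq.2.le hq'.2.le).1 hrel
        · rw [weight_h] at h4
          linarith [hrel.1.2]
        · linarith [hrel.1.1]
      · have h3 := gap_le hn
        have h4 := Real.pi_pos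
        rw [abs_lt]
        constructor <;> linarith
  · rw [hEs]
    have : W₀ ∈ σ.target := hs hW₀
    exact ⟨σ.map_target this, by rwa [σ.right_inv this]⟩

end Charts

/-! ### Flow boxes of the model around a ray outside the open hyperbolic sectors -/

theorem level_zero (n : ℕ) (s : Letter) (r : ℝ) : level n s r 0 = 0 := by
  cases s <;> simp [level]

theorem level_strictMonoOn (n : ℕ) (s : Letter) {r : ℝ} (hr : 0 < r) :
    StrictMonoOn (level n s r) (Icc 0 (gap n / 2)) := by
  cases s with
  | p α => exact strictMonoOn_id
  | h =>
    intro u hu u' hu' huu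
    have hk := expt_pos n
    have hg := expt_mul_gap n
    have h1 : ∀ x ∈ Icc 0 (gap n / 2), expt n * x ∈ Icc (-(Real.pi / 2)) (Real.pi / 2) := fun x hx =>
      ⟨by nlinarith [hx.1, Real.pi_pos], by nlinarith [hx.2]⟩
    exact mul_lt_mul_of_pos_left (Real.strictMonoOn_sin (h1 u hu) (h1 u' hu')
      (mul_lt_mul_of_pos_left huu hk)) (Real.rpow_pos_of_pos hr _)

theorem continuous_level (n : ℕ) (s : Letter) : Continuous fun p : ℝ × ℝ => level n s p.1 p.2 := by
  cases s with
  | p α => exact continuous_snd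
  | h =>
    exact (continuous_fst.rpow_const fun _ => Or.inr (expt_pos n).le).mul (by fun_prop)

theorem level_h_gap_sub (n : ℕ) (r u : ℝ) : level n .h r (gap n - u) = level n .h r u := by
  rw [level, mul_sub, expt_mul_gap, Real.sin_pi_sub, level]

/-- The level function near a ray between two sectors: it is given by the level functions of the
left sector `s` and of the right sector `s'`, with opposite signs. -/
noncomputable def rayLevel (n : ℕ) (s s' : Letter) (r u : ℝ) : ℝ :=
  if 0 ≤ u then level n s' r u else - level n s r (-u)

theorem continuous_rayLevel (n : ℕ) (s s' : Letter) :
    Continuous fun p : ℝ × ℝ => rayLevel n s s' p.1 p.2 := by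
  refine Continuous.if_le (continuous_level n s')
    ((continuous_level n s).comp (continuous_fst.prodMk continuous_snd.neg)).neg
    continuous_const continuous_snd fun p hp => ?_
  simp [← hp, level_zero]

theorem rayLevel_strictMonoOn (n : ℕ) (s s' : Letter) {r : ℝ} (hr : 0 < r) :
    StrictMonoOn (rayLevel n s s' r) (Icc (-(gap n / 2)) (gap n / 2)) := by
  have hg := gap_pos n
  have h0 : (0 : ℝ) ∈ Icc 0 (gap n / 2) := ⟨le_rfl, by linarith⟩
  have hl := level_strictMonoOn n s hr
  have hl' := level_strictMonoOn n s' hr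
  intro u hu u' hu' huu
  unfold rayLevel
  split_ifs with h1 h2 h2
  · exact hl' ⟨h1, hu.2⟩ ⟨h2, hu'.2⟩ huu
  · linarith
  · have h3 := hl h0 ⟨by linarith, by linarith [hu.1]⟩ (by linarith : 0 < -u)
    have h4 := hl'.monotoneOn h0 ⟨h2, hu'.2⟩ h2
    rw [level_zero] at h3 h4
    linarith
  · exact neg_lt_neg (hl ⟨by linarith, by linarith [hu'.1]⟩ ⟨by linarith, by linarith [hu.1]⟩
      (by linarith))

section Charts

variable {n : ℕ} {θ : ℝ} {w : Word}

/-- Near a ray which is not inside a hyperbolic sector, the leaves are the levels of `rayLevel`. -/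
theorem modelRel_iff_rayLevel_eq (hn : 1 ≤ n) (hw : wordWeight n w = 2 * Real.pi)
    {c c' β ε : ℝ} {s s' : Letter} (h : IsTile n θ w c s) (h' : IsTile n θ w c' s')
    (hβ : c - s.weight n < β) (hβc : β ≤ c) (hβ' : c' - s'.weight n ≤ β) (hβc' : β < c')
    (hs : s = .h → β = c) (hs' : s' = .h → β = c' - s'.weight n)
    (hε : ε < β - (c - s.weight n)) (hε' : ε < c' - β) (hεg : ε ≤ gap n / 2)
    {r r' u u' : ℝ} (hr : 0 < r) (hr' : 0 < r') (hu : u ∈ Icc (-ε) ε) (hu' : u' ∈ Icc (-ε) ε) :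
    ModelRel n θ w (r * cis (β + u)) (r' * cis (β + u')) ↔
      rayLevel n s s' r u = rayLevel n s s' r' u' := by
  have hpi := Real.pi_pos
  have hgl := gap_le hn
  have hg := gap_pos n
  rw [modelRel_iff_exists_isTile hn hr hr'
    (by rw [abs_lt]; constructor <;> linarith [hu.1, hu.2, hu'.1, hu'.2])]
  -- conversion of the levels on either side
  have cR : ∀ x y : ℝ, ∀ ρ ρ' : ℝ,
      level n s' ρ (c' - (β + x)) = level n s' ρ' (c' - (β + y)) ↔
        level n s' ρ x = level n s' ρ' y := fun x y ρ ρ' => by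
    cases s' with
    | p α => simp [level]
    | h =>
      rw [weight_h] at hs'
      have : ∀ z, c' - (β + z) = gap n - z := fun z => by rw [hs' rfl]; ring
      rw [this, this, level_h_gap_sub, level_h_gap_sub]
  have cL : ∀ x y : ℝ, ∀ ρ ρ' : ℝ,
      level n s ρ (c - (β + x)) = level n s ρ' (c - (β + y)) ↔
        level n s ρ (-x) = level n s ρ' (-y) := fun x y ρ ρ' => by
    cases s with
    | p α => simp [level]
    | h =>
      have : ∀ z, c - (β + z) = -z := fun z => by rw [hs rfl]; ring
      rw [this, this]
  have hpos : ∀ t : Letter, ∀ {ρ x : ℝ}, 0 < ρ → 0 < x → x ≤ ε → 0 < level n t ρ x :=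
    fun t ρ x hρ hx hxε => by
      have := level_strictMonoOn n t hρ ⟨le_rfl, by linarith⟩ ⟨hx.le, by linarith⟩ hx
      rwa [level_zero] at this
  have hnonneg : ∀ t : Letter, ∀ {ρ x : ℝ}, 0 < ρ → 0 ≤ x → x ≤ ε → 0 ≤ level n t ρ x :=
    fun t ρ x hρ hx hxε => by
      rcases hx.eq_or_lt with rfl | hx
      · rw [level_zero]
      · exact (hpos t hρ hx hxε).le
  -- points on different sides are not related
  have opp : ∀ {ρ ρ' x y : ℝ}, 0 < ρ → 0 < ρ' → x ∈ Icc (-ε) ε → y ∈ Icc (-ε) ε → 0 ≤ x → y < 0 →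
      ¬ ∃ c s, IsTile n θ w c s ∧ TileRel n c s ρ (β + x) ρ' (β + y) := by
    rintro ρ ρ' x y hρ hρ' hx hy hx0 hy0 ⟨c₂, s₂, h₂, hrel⟩
    rcases h₂.eq_or_le hw h with ⟨rfl, rfl⟩ | h4 | h4
    · have h5 := (cL x y ρ ρ').1 hrel.2.2
      cases s₂ with
      | p α =>
        simp only [level] at h5
        linarith
      | h =>
        have h6 : x = 0 := le_antisymm (by linarith [hrel.1.2, hs rfl]) hx0
        rw [h6, neg_zero, level_zero] at h5
        linarith [hpos .h hρ' (by linarith : 0 < -y) (by linarith [hy.1])]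
    · linarith [hrel.2.1.2, hy.1]
    · linarith [hrel.2.1.1]
  unfold rayLevel
  split_ifs with h1 h2 h2
  · constructor
    · rintro ⟨c₂, s₂, h₂, hrel⟩
      rcases h₂.eq_or_le hw h' with ⟨rfl, rfl⟩ | h4 | h4
      · exact (cR u u' r r').1 hrel.2.2
      · have e1 : u = 0 := le_antisymm (by linarith [hrel.1.2]) h1
        have e2 : u' = 0 := le_antisymm (by linarith [hrel.2.1.2]) h2
        rw [e1, e2, level_zero, level_zero]
      · linarith [hrel.1.1, hu.2]
    · intro h3
      exact ⟨c', s', h', ⟨by linarith, by linarith [hu.2]⟩, ⟨by linarith, by linarith [hu'.2]⟩,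
        (cR u u' r r').2 h3⟩
  · refine iff_of_false (opp hr hr' hu hu' h1 (not_le.1 h2)) fun h3 => ?_
    linarith [hnonneg s' hr h1 hu.2, hpos s hr' (by linarith : 0 < -u') (by linarith [hu'.1])]
  · refine iff_of_false ?_ fun h3 => ?_
    · rintro ⟨c₂, s₂, h₂, hrel⟩
      exact opp hr' hr hu' hu h2 (not_le.1 h1) ⟨c₂, s₂, h₂, hrel.symm⟩
    · linarith [hnonneg s' hr' h2 hu'.2, hpos s hr (by linarith : 0 < -u) (by linarith [hu.1])]
  · rw [neg_inj]
    constructor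
    · rintro ⟨c₂, s₂, h₂, hrel⟩
      rcases h₂.eq_or_le hw h with ⟨rfl, rfl⟩ | h4 | h4
      · exact (cL u u' r r').1 hrel.2.2
      · linarith [hrel.1.2, hu.1]
      · linarith [hrel.1.1]
    · intro h3
      exact ⟨c, s, h, ⟨by linarith [hu.1], by linarith⟩, ⟨by linarith [hu'.1], by linarith⟩,
        (cL u u' r r').2 h3⟩

/-- The flow box is ζ ↦ (|ζ|, level). On each circle the level is strictly increasing in the angle,
so this map is injective on a compact polar rectangle. The number `η` bounds the levels on the two
lateral sides away from 0 uniformly in the radius. Hence the box of half-height `η` is covered, and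
its preimage avoids the boundary of the rectangle. -/
theorem exists_isModelChart_ray (hn : 1 ≤ n) (hw : wordWeight n w = 2 * Real.pi)
    {c c' β : ℝ} {s s' : Letter} (h : IsTile n θ w c s) (h' : IsTile n θ w c' s')
    (hβ : c - s.weight n < β) (hβc : β ≤ c) (hβ' : c' - s'.weight n ≤ β) (hβc' : β < c')
    (hs : s = .h → β = c) (hs' : s' = .h → β = c' - s'.weight n) {r : ℝ} (hr : 0 < r) :
    ∃ E, IsModelChart n θ w E ∧ (r : ℂ) * cis β ∈ E.source := by
  have hg := gap_pos n
  obtain ⟨ε, hε0, hε⟩ := exists_between (lt_min (lt_min (sub_pos.2 hβ) (sub_pos.2 hβc'))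
    (half_pos hg))
  have hε1 : ε < β - (c - s.weight n) := hε.trans_le ((min_le_left _ _).trans (min_le_left _ _))
  have hε2 : ε < c' - β := hε.trans_le ((min_le_left _ _).trans (min_le_right _ _))
  have hε3 : ε ≤ gap n / 2 := (hε.trans_le (min_le_right _ _)).le
  have hεpi : ε < Real.pi := by linarith [gap_le hn, Real.pi_pos]
  have hsub : Icc (-ε) ε ⊆ Icc (-(gap n / 2)) (gap n / 2) := Icc_subset_Icc (by linarith) hε3
  set Q : Set (ℝ × ℝ) := Icc (r / 2) (2 * r) ×ˢ Icc (-ε) ε with hQ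
  have hQpos : ∀ p ∈ Q, 0 < p.1 := fun p hp => by linarith [hp.1.1]
  set m : ℝ × ℝ → ℂ := fun p => (p.1 : ℂ) * cis (β + p.2) with hm
  have hmc : Continuous m := by
    refine (Complex.continuous_ofReal.comp continuous_fst).mul (continuous_cis.comp ?_)
    fun_prop
  set f : ℂ → ℝ × ℝ := fun ζ => (‖ζ‖, rayLevel n s s' ‖ζ‖ ((cis β)⁻¹ * ζ).arg) with hf
  have hrot : ∀ p, (cis β)⁻¹ * m p = (p.1 : ℂ) * cis p.2 := fun p => by
    simp only [hm]
    rw [cis_add]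
    field_simp [cis_ne_zero β]
  have hnorm : ∀ p ∈ Q, ‖m p‖ = p.1 := fun p hp => norm_ofReal_mul_cis (hQpos p hp).le _
  have harg : ∀ p ∈ Q, ((cis β)⁻¹ * m p).arg = p.2 := fun p hp => by
    rw [hrot, arg_ofReal_mul_cis (hQpos p hp)]
    rw [abs_lt]
    exact ⟨by linarith [hp.2.1], by linarith [hp.2.2]⟩
  have hfm : ∀ p ∈ Q, f (m p) = (p.1, rayLevel n s s' p.1 p.2) := fun p hp => by
    simp only [hf]
    rw [hnorm p hp, harg p hp]
  have hslit : ∀ p ∈ Q, (cis β)⁻¹ * m p ∈ Complex.slitPlane := fun p hp => by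
    refine mem_slitPlane_of_abs_arg_lt ?_ ?_
    · rw [hrot]
      exact mul_ne_zero (by exact_mod_cast (hQpos p hp).ne') (cis_ne_zero _)
    · rw [harg p hp, abs_lt]
      exact ⟨by linarith [hp.2.1], by linarith [hp.2.2]⟩
  have hfc : ∀ ζ, (cis β)⁻¹ * ζ ∈ Complex.slitPlane → ContinuousAt f ζ := fun ζ hζ => by
    have h1 : ContinuousAt (fun ζ : ℂ => ((cis β)⁻¹ * ζ).arg) ζ :=
      (Complex.continuousAt_arg hζ).comp (f := fun ζ : ℂ => (cis β)⁻¹ * ζ) (by fun_prop)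
    have h2 : ContinuousAt (fun ζ : ℂ => ‖ζ‖) ζ := by fun_prop
    exact h2.prodMk ((continuous_rayLevel n s s').continuousAt.comp
      (f := fun ζ : ℂ => (‖ζ‖, ((cis β)⁻¹ * ζ).arg)) (h2.prodMk h1))
  -- the box
  obtain ⟨η, hη0, hη⟩ : ∃ η > 0, ∀ ρ ∈ Icc (r / 2) (2 * r),
      η ≤ rayLevel n s s' ρ ε ∧ rayLevel n s s' ρ (-ε) ≤ -η := by
    have hlow : ∀ t : Letter, ∃ η > 0, ∀ ρ ∈ Icc (r / 2) (2 * r), η ≤ level n t ρ ε := fun t => by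
      obtain ⟨ρ₀, hρ₀, hmin⟩ := (isCompact_Icc (a := r / 2) (b := 2 * r)).exists_isMinOn
        ⟨r, by constructor <;> linarith⟩ (((continuous_level n t).comp
          (Continuous.prodMk_left ε)).continuousOn)
      refine ⟨level n t ρ₀ ε, ?_, fun ρ hρ => hmin hρ⟩
      have := level_strictMonoOn n t (by linarith [hρ₀.1] : 0 < ρ₀) ⟨le_rfl, by linarith⟩
        ⟨hε0.le, hε3⟩ hε0
      rwa [level_zero] at this
    obtain ⟨η1, h1, h1'⟩ := hlow s
    obtain ⟨η2, h2, h2'⟩ := hlow s'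
    refine ⟨min η1 η2, lt_min h1 h2, fun ρ hρ => ⟨?_, ?_⟩⟩
    · rw [rayLevel, if_pos hε0.le]
      exact (min_le_right _ _).trans (h2' ρ hρ)
    · rw [rayLevel, if_neg (by linarith), neg_neg]
      exact neg_le_neg ((min_le_left _ _).trans (h1' ρ hρ))
  set V : Set (ℝ × ℝ) := Ioo (r / 2) (2 * r) ×ˢ Ioo (-η) η with hV
  have hmono : ∀ p ∈ Q, StrictMonoOn (rayLevel n s s' p.1) (Icc (-ε) ε) := fun p hp =>
    (rayLevel_strictMonoOn n s s' (hQpos p hp)).mono hsub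
  obtain ⟨E, hE, hEs, hEt⟩ := exists_openPartialHomeomorph_of_compact (K := m '' Q) (f := f) (V := V)
    ((isCompact_Icc.prod isCompact_Icc).image hmc)
    (by rintro _ ⟨p, hp, rfl⟩; exact (hfc _ (hslit p hp)).continuousWithinAt)
    (by
      rintro _ ⟨p, hp, rfl⟩ _ ⟨p', hp', rfl⟩ hpp
      rw [hfm p hp, hfm p' hp', Prod.mk.injEq] at hpp
      obtain ⟨h1, h2⟩ := hpp
      rw [← h1] at h2
      have h3 := (hmono p hp).injOn hp.2 hp'.2 h2
      rw [Prod.ext h1 h3])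
    (isOpen_Ioo.prod isOpen_Ioo)
    (by
      rintro ⟨ρ, y⟩ ⟨hρ, hy⟩
      have hρ' := Ioo_subset_Icc_self hρ
      have hc : ContinuousOn (fun u => rayLevel n s s' ρ u) (Icc (-ε) ε) :=
        ((continuous_rayLevel n s s').comp (Continuous.prodMk_right ρ)).continuousOn
      obtain ⟨u, hu, hu'⟩ := intermediate_value_Icc (by linarith) hc
        (show y ∈ Icc _ _ from ⟨(hη ρ hρ').2.trans hy.1.le, hy.2.le.trans (hη ρ hρ').1⟩)
      have hq : (ρ, u) ∈ Q := ⟨hρ', hu⟩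
      refine ⟨m (ρ, u), ⟨_, hq, rfl⟩, ?_⟩
      rw [hfm _ hq]
      exact Prod.ext rfl hu')
    (by
      rintro _ ⟨p, hp, rfl⟩ hpV
      rw [hfm p hp] at hpV
      have hu : p.2 ∈ Ioo (-ε) ε := by
        refine ⟨lt_of_le_of_ne hp.2.1 fun h0 => ?_, lt_of_le_of_ne hp.2.2 fun h0 => ?_⟩
        · have h1 := hpV.2.1
          simp only [← h0] at h1
          linarith [(hη p.1 hp.1).2]
        · have h1 := hpV.2.2
          simp only [h0] at h1
          linarith [(hη p.1 hp.1).1]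
      rw [mem_interior_iff_mem_nhds]
      have h1 : ContinuousAt (fun ζ : ℂ => (‖ζ‖, ((cis β)⁻¹ * ζ).arg)) (m p) := by
        refine ContinuousAt.prodMk (by fun_prop) ?_
        exact (Complex.continuousAt_arg (hslit p hp)).comp (f := fun ζ : ℂ => (cis β)⁻¹ * ζ)
          (by fun_prop)
      have h2 : Ioo (r / 2) (2 * r) ×ˢ Ioo (-ε) ε ∈ 𝓝 (‖m p‖, ((cis β)⁻¹ * m p).arg) := by
        rw [hnorm p hp, harg p hp]
        exact (isOpen_Ioo.prod isOpen_Ioo).mem_nhds ⟨hpV.1, hu⟩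
      filter_upwards [h1 h2] with ζ hζ
      refine ⟨_, ⟨Ioo_subset_Icc_self hζ.1, Ioo_subset_Icc_self hζ.2⟩, ?_⟩
      simp only [hm]
      rw [cis_add, mul_left_comm]
      have h3 := norm_mul_cis_arg ((cis β)⁻¹ * ζ)
      rw [norm_mul, norm_inv, norm_cis, inv_one, one_mul] at h3
      rw [h3, mul_inv_cancel_left₀ (cis_ne_zero β)])
  refine ⟨E, ?_, ?_⟩
  · intro q hq q' hq'
    rw [hEs] at hq hq'
    obtain ⟨⟨p, hp, rfl⟩, -⟩ := hq
    obtain ⟨⟨p', hp', rfl⟩, -⟩ := hq'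
    rw [hE, hE, hfm p hp, hfm p' hp']
    exact (modelRel_iff_rayLevel_eq hn hw h h' hβ hβc hβ' hβc' hs hs' hε1 hε2 hε3 (hQpos p hp)
      (hQpos p' hp') hp.2 hp'.2).symm
  · have hp : (r, (0 : ℝ)) ∈ Q := ⟨⟨by linarith, by linarith⟩, by linarith, hε0.le⟩
    have hmr : m (r, 0) = r * cis β := by simp [hm]
    rw [hEs, ← hmr]
    refine ⟨⟨_, hp, rfl⟩, ?_⟩
    rw [mem_preimage, hfm _ hp]
    refine ⟨⟨by linarith, by linarith⟩, ?_⟩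
    simp only [rayLevel, le_refl, if_true, level_zero]
    exact ⟨by linarith, hη0⟩

/-- The singularity has a foliation chart at every point except `0`. -/
theorem exists_isModelChart (hn : 1 ≤ n) (hw : wordWeight n w = 2 * Real.pi) {ζ : ℂ} (hζ : ζ ≠ 0) :
    ∃ E, IsModelChart n θ w E ∧ ζ ∈ E.source := by
  have hr : 0 < ‖ζ‖ := norm_pos_iff.2 hζ
  rw [← norm_mul_cis_arg ζ]
  generalize ζ.arg = β
  generalize ‖ζ‖ = r at hr
  obtain ⟨c, s, h, h1, h2⟩ := exists_isTile_left (θ := θ) hw β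
  obtain ⟨c', s', h', h1', h2'⟩ := exists_isTile_right (θ := θ) hw β
  have key : ∀ c₀, IsTile n θ w c₀ .h → c₀ - gap n < β → β < c₀ →
      ∃ E, IsModelChart n θ w E ∧ (r : ℂ) * cis β ∈ E.source := fun c₀ h0 hl hu => by
    set μ := c₀ - gap n / 2 with hμ
    have hk := expt_pos n
    have hkg := expt_mul_gap n
    have hR : 0 < r ^ expt n := Real.rpow_pos_of_pos hr _
    have hlt : |expt n * (β - μ)| < Real.pi / 2 := by
      rw [abs_mul, abs_of_pos hk]
      have : |β - μ| < gap n / 2 := by rw [abs_lt]; constructor <;> linarith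
      nlinarith
    have hlt' : |expt n * (β - μ)| < Real.pi := by linarith [Real.pi_pos]
    set W₀ : ℂ := ((r ^ expt n : ℝ) : ℂ) * cis (expt n * (β - μ)) with hW₀
    have hWarg : W₀.arg = expt n * (β - μ) := arg_ofReal_mul_cis hR hlt'
    have hWn : ‖W₀‖ = r ^ expt n := norm_ofReal_mul_cis hR.le _
    have hW0 : W₀ ≠ 0 := norm_pos_iff.1 (by rw [hWn]; exact hR)
    have hre : 0 < W₀.re :=
      (Complex.abs_arg_lt_pi_div_two_iff.1 (by rwa [hWarg])).resolve_right hW0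
    obtain ⟨E, hE, hmem⟩ := IsTile.exists_isModelChart_h (μ := μ) hn hw
      (by rwa [hμ, sub_add_cancel]) hre
    refine ⟨E, hE, ?_⟩
    rwa [sectorChart_symm_eq_polar n μ hW0, hWn, hWarg, ← Real.rpow_mul hr.le,
      mul_one_div_cancel hk.ne', Real.rpow_one, mul_div_cancel_left₀ _ hk.ne',
      add_sub_cancel] at hmem
  -- Either the ray is interior to a hyperbolic tile, or each adjacent hyperbolic tile ends at the
  -- ray and each other adjacent tile is parabolic.
  by_cases hs : s = .h ∧ β ≠ c
  · obtain ⟨rfl, hne⟩ := hs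
    rw [weight_h] at h1
    exact key c h h1 (lt_of_le_of_ne h2 hne)
  by_cases hs' : s' = .h ∧ β ≠ c' - s'.weight n
  · obtain ⟨rfl, hne⟩ := hs'
    rw [weight_h] at h1' hne
    exact key c' h' (lt_of_le_of_ne h1' (Ne.symm hne)) h2'
  push Not at hs hs'
  exact exists_isModelChart_ray hn hw h h' h1 h2 h1' h2' hs hs' hr

end Charts

/-! ### Straightness of the leaves of the model -/

section Charts

variable {n : ℕ} {θ : ℝ} {w : Word}

theorem exists_sectorChart_symm_eq {n : ℕ} {r β μ : ℝ} (hr : 0 < r)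
    (h : |expt n * (β - μ)| < Real.pi) :
    ∃ W : ℂ, W ∈ Complex.slitPlane ∧ W = ((r ^ expt n : ℝ) : ℂ) * cis (expt n * (β - μ)) ∧
      (sectorChart n (cis μ) (cis_ne_zero μ)).symm W = r * cis β := by
  have hk := expt_pos n
  have hR : 0 < r ^ expt n := Real.rpow_pos_of_pos hr _
  have hWarg := arg_ofReal_mul_cis hR h
  have hWn := norm_ofReal_mul_cis hR.le (expt n * (β - μ))
  have hW0 : ((r ^ expt n : ℝ) : ℂ) * cis (expt n * (β - μ)) ≠ 0 :=
    norm_pos_iff.1 (by rw [hWn]; exact hR)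
  refine ⟨_, mem_slitPlane_of_abs_arg_lt hW0 (by rwa [hWarg]), rfl, ?_⟩
  rw [sectorChart_symm_eq_polar n μ hW0, hWn, hWarg, ← Real.rpow_mul hr.le,
    mul_one_div_cancel hk.ne', Real.rpow_one, mul_div_cancel_left₀ _ hk.ne', add_sub_cancel]

/-- The leaf of the singularity through any point is straight in the natural parameter. -/
theorem exists_modelRel_line (hn : 1 ≤ n) (hw : wordWeight n w = 2 * Real.pi) {ζ : ℂ} (hζ : ζ ≠ 0) :
    ∃ (μ : ℝ) (W u : ℂ), W ∈ Complex.slitPlane ∧ ‖u‖ = 1 ∧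
      (sectorChart n (cis μ) (cis_ne_zero μ)).symm W = ζ ∧
      ∀ᶠ t : ℝ in 𝓝 0, ModelRel n θ w
        ((sectorChart n (cis μ) (cis_ne_zero μ)).symm (W + t * u)) ζ := by
  have hr : 0 < ‖ζ‖ := norm_pos_iff.2 hζ
  rw [← norm_mul_cis_arg ζ]
  generalize ζ.arg = β
  generalize ‖ζ‖ = r at hr
  have hk := expt_pos n
  have hg := gap_pos n
  obtain ⟨c, s, h, h1, h2⟩ := exists_isTile_right (θ := θ) hw β
  cases s with
  | p α =>
    obtain ⟨W, hW, hWe, hWs⟩ := exists_sectorChart_symm_eq (n := n) (μ := β) (β := β) hr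
      (by simp [Real.pi_pos])
    refine ⟨β, W, 1, hW, norm_one, hWs, ?_⟩
    rw [sub_self, mul_zero, cis_zero, mul_one] at hWe
    have hR : 0 < r ^ expt n := Real.rpow_pos_of_pos hr _
    filter_upwards [eventually_gt_nhds (neg_lt_zero.2 hR)] with t ht
    have hpos : 0 < r ^ expt n + t := by linarith
    rw [hWe, mul_one, ← Complex.ofReal_add,
      sectorChart_symm_eq_polar n β (by exact_mod_cast hpos.ne'), Complex.arg_ofReal_of_nonneg hpos.le,
      zero_div, add_zero, modelRel_iff_exists_isTile hn (Real.rpow_pos_of_pos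
        (norm_pos_iff.2 (by exact_mod_cast hpos.ne')) _) hr (by simp [Real.pi_pos])]
    exact ⟨c, _, h, ⟨h1, h2.le⟩, ⟨h1, h2.le⟩, rfl⟩
  | h =>
    rw [weight_h] at h1
    set μ := c - gap n / 2 with hμ
    have hkg := expt_mul_gap n
    have habs : |β - μ| ≤ gap n / 2 := by rw [abs_le]; constructor <;> linarith
    have hle : |expt n * (β - μ)| ≤ Real.pi / 2 := by
      rw [abs_mul, abs_of_pos hk]
      nlinarith
    have hlt : |expt n * (β - μ)| < Real.pi := by linarith [Real.pi_pos]
    obtain ⟨W, hW, hWe, hWs⟩ := exists_sectorChart_symm_eq (n := n) (μ := μ) (β := β) hr hlt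
    have hre : 0 ≤ W.re := by
      rw [← Complex.abs_arg_le_pi_div_two_iff, hWe,
        arg_ofReal_mul_cis (Real.rpow_pos_of_pos hr _) hlt]
      exact hle
    have hW0 := Complex.slitPlane_ne_zero hW
    -- The boundary radius is included: there `W` is imaginary, and the direction `I` is radial.
    refine ⟨μ, W, Complex.I, hW, Complex.norm_I, hWs, ?_⟩
    have hc : ContinuousAt (fun t : ℝ => W + t * Complex.I) 0 := by fun_prop
    have hne : ∀ᶠ t : ℝ in 𝓝 0, W + t * Complex.I ≠ 0 :=
      hc.eventually_ne (by simpa using hW0)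
    filter_upwards [hne] with t ht
    have ht' : (W + t * Complex.I).re = W.re := by simp
    rw [← hWs]
    exact IsTile.modelRel_h hn (by rwa [hμ, sub_add_cancel]) ht hW0 (by rwa [ht']) hre ht'

end Charts

/-! ### Straight segments as shortest arcs -/

section FlatChart

variable {φ : ℂ → ℂ} {M : Set ℂ} {κ : ℝ} {X : OpenPartialHomeomorph ℂ ℂ}

theorem IsFlatChart.restrOpen (hX : IsFlatChart φ M κ X) {U : Set ℂ} (hU : IsOpen U) :
    IsFlatChart φ U κ (X.restrOpen U hU) := by
  have hs : (X.restrOpen U hU).source = X.source ∩ U := X.restrOpen_source U hU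
  refine ⟨hX.pos, by rw [hs]; exact inter_subset_right, fun z hz => ?_⟩
  rw [hs] at hz
  exact hX.exists_hasDerivAt z hz.1

/-- The lower bound of `IsFlatChart.le_length` is attained by the segment, whose speed is constantly
`κ * ‖W' - W‖`. -/
theorem IsFlatChart.isShortestArc (hφ : ContinuousOn φ M) (hX : IsFlatChart φ M κ X) {W₀ W W' : ℂ}
    {r : ℝ} (hr : Metric.closedBall W₀ (3 * r) ⊆ X.target) (hW : dist W W₀ < r)
    (hW' : dist W' W₀ < r) :
    IsShortestArc φ M (X.symm W) (X.symm W') (X.symm '' segment ℝ W W') := by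
  have hr0 : 0 < r := dist_nonneg.trans_lt hW
  have hball : ∀ V, dist V W₀ < r → V ∈ Metric.closedBall W₀ (3 * r) := fun V hV => by
    rw [Metric.mem_closedBall]; linarith
  have hseg : segment ℝ W W' ⊆ X.target :=
    ((convex_closedBall _ _).segment_subset (hball W hW) (hball W' hW')).trans hr
  set l : ℝ → ℂ := fun t => W + t • (W' - W) with hl
  have hlI : l '' Icc 0 1 = segment ℝ W W' := (segment_eq_image' ℝ W W').symm
  have hlt : ∀ t ∈ Icc (0 : ℝ) 1, l t ∈ X.target := fun t ht => hseg (hlI ▸ mem_image_of_mem l ht)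
  have hld : ∀ t, HasDerivAt l (W' - W) t := fun t => by
    have := ((hasDerivAt_id t).smul_const (W' - W)).const_add W
    rwa [one_smul] at this
  have hXC : ContDiffOn ℝ 1 X.symm X.target := by
    have : DifferentiableOn ℂ X.symm X.target := fun w hw => by
      obtain ⟨d, hd, -⟩ := hX.hasDerivAt_symm hw
      exact hd.differentiableAt.differentiableWithinAt
    exact (this.contDiffOn X.open_target).restrict_scalars ℝ
  have hpath : IsPath M (X.symm W) (X.symm W') (X.symm ∘ l) := by
    refine ⟨hXC.comp ?_ hlt, fun t ht => hX.source_subset (X.map_target (hlt t ht)), by simp [hl],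
      by simp [hl]⟩
    exact (contDiff_const.add (contDiff_id.smul contDiff_const)).contDiffOn
  refine ⟨X.symm ∘ l, hpath, by rw [image_comp, hlI], fun η hη => ?_⟩
  refine le_trans (le_of_eq ?_) (hX.le_length hφ hr hW hW' hη)
  have hconst : ∀ t ∈ uIcc (0 : ℝ) 1, √‖φ ((X.symm ∘ l) t)‖ *
      ‖derivWithin (X.symm ∘ l) (Icc 0 1) t‖ = κ * ‖W' - W‖ := fun t ht => by
    rw [uIcc_of_le zero_le_one] at ht
    obtain ⟨d, hd, hκ⟩ := hX.hasDerivAt_symm (hlt t ht)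
    have h1 := (hd.comp t (hld t)).hasDerivWithinAt (s := Icc 0 1)
    rw [h1.derivWithin (uniqueDiffOn_Icc one_pos t ht), norm_mul, Function.comp_apply, ← mul_assoc, hκ]
  rw [length, intervalIntegral.integral_congr hconst]
  simp

/-- If a straight segment through `z` lies in a plaque, then the plaque contains a shortest arc with
`z` in its interior. -/
theorem IsFlatChart.exists_isShortestArc_plaque (hφ : ContinuousOn φ M) (hX : IsFlatChart φ M κ X)
    {W u : ℂ} (hu : ‖u‖ = 1) (hW : W ∈ X.target) {e : OpenPartialHomeomorph ℂ (ℝ × ℝ)}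
    (h : ∀ᶠ t : ℝ in 𝓝 0, X.symm (W + t * u) ∈ e.source ∧
      (e (X.symm (W + t * u))).2 = (e (X.symm W)).2) :
    ∃ s t : ℝ, s < (e (X.symm W)).1 ∧ (e (X.symm W)).1 < t ∧
      Icc s t ×ˢ {(e (X.symm W)).2} ⊆ e.target ∧
      IsShortestArc φ M (e.symm (s, (e (X.symm W)).2)) (e.symm (t, (e (X.symm W)).2))
        (e.symm '' (Icc s t ×ˢ {(e (X.symm W)).2})) := by
  obtain ⟨R, hR, hRt⟩ := Metric.nhds_basis_closedBall.mem_iff.1 (X.open_target.mem_nhds hW)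
  obtain ⟨δ, hδ, hδe⟩ := Metric.nhds_basis_closedBall.mem_iff.1 h
  rw [Real.closedBall_eq_Icc, zero_sub, zero_add] at hδe
  set ε := min δ (R / 6) with hε
  have hε0 : 0 < ε := lt_min hδ (by linarith)
  have hεR : ε ≤ R / 6 := min_le_right _ _
  have hIcc : ∀ t ∈ Icc (-ε) ε, X.symm (W + t * u) ∈ e.source ∧
      (e (X.symm (W + t * u))).2 = (e (X.symm W)).2 := fun t ht =>
    hδe ⟨by linarith [ht.1, min_le_left δ (R / 6)], by linarith [ht.2, min_le_left δ (R / 6)]⟩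
  have hdist : ∀ t ∈ Icc (-ε) ε, dist (W + t * u) W < R / 3 := fun t ht => by
    rw [dist_eq_norm, add_sub_cancel_left, norm_mul, hu, mul_one, Complex.norm_real,
      Real.norm_eq_abs]
    have := abs_le.2 ht
    linarith
  have hmemt : ∀ t ∈ Icc (-ε) ε, W + t * u ∈ X.target := fun t ht => hRt (by
    rw [Metric.mem_closedBall]
    linarith [hdist t ht])
  have hu0 : u ≠ 0 := norm_pos_iff.1 (by rw [hu]; exact one_pos)
  -- the monotone case, for either orientation of the line
  have key : ∀ v : ℂ, segment ℝ (W + (-ε : ℝ) * v) (W + ε * v) =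
      (fun t : ℝ => W + t * v) '' Icc (-ε) ε := fun v => by
    rw [show (fun t : ℝ => W + t * v) = fun t : ℝ => AffineMap.lineMap W (W + v) t by
      ext t; simp [AffineMap.lineMap_apply, add_comm], ← segment_eq_Icc (by linarith : -ε ≤ ε),
      image_segment]
    simp [AffineMap.lineMap_apply, add_comm]
  have main : ∀ v : ℂ, (∀ t ∈ Icc (-ε) ε, X.symm (W + t * v) ∈ e.source ∧
      (e (X.symm (W + t * v))).2 = (e (X.symm W)).2) →
      (∀ t ∈ Icc (-ε) ε, dist (W + t * v) W < R / 3) →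
      ContinuousOn (fun t : ℝ => (e (X.symm (W + t * v))).1) (Icc (-ε) ε) →
      StrictMonoOn (fun t : ℝ => (e (X.symm (W + t * v))).1) (Icc (-ε) ε) →
      ∃ s t : ℝ, s < (e (X.symm W)).1 ∧ (e (X.symm W)).1 < t ∧
        Icc s t ×ˢ {(e (X.symm W)).2} ⊆ e.target ∧
        IsShortestArc φ M (e.symm (s, (e (X.symm W)).2)) (e.symm (t, (e (X.symm W)).2))
          (e.symm '' (Icc s t ×ˢ {(e (X.symm W)).2})) := by
    intro v hv hd hc hmono
    have hl : -ε ∈ Icc (-ε) ε := ⟨le_rfl, by linarith⟩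
    have hr : ε ∈ Icc (-ε) ε := ⟨by linarith, le_rfl⟩
    have h0 : (0 : ℝ) ∈ Icc (-ε) ε := ⟨by linarith, hε0.le⟩
    set g : ℝ → ℝ := fun t => (e (X.symm (W + t * v))).1 with hg
    have hg0 : g 0 = (e (X.symm W)).1 := by simp [hg]
    have heg : ∀ t ∈ Icc (-ε) ε, e (X.symm (W + t * v)) = (g t, (e (X.symm W)).2) := fun t ht =>
      Prod.ext rfl (hv t ht).2
    have hes : ∀ t ∈ Icc (-ε) ε, e.symm (g t, (e (X.symm W)).2) = X.symm (W + t * v) :=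
      fun t ht => by rw [← heg t ht, e.left_inv (hv t ht).1]
    have himg : g '' Icc (-ε) ε = Icc (g (-ε)) (g ε) := by
      refine Subset.antisymm ?_ (intermediate_value_Icc (by linarith) hc)
      rintro _ ⟨t, ht, rfl⟩
      exact ⟨hmono.monotoneOn hl ht ht.1, hmono.monotoneOn ht hr ht.2⟩
    have hset : Icc (g (-ε)) (g ε) ×ˢ {(e (X.symm W)).2} =
        (fun t => (g t, (e (X.symm W)).2)) '' Icc (-ε) ε := by
      rw [← himg, prod_singleton, image_image]
    refine ⟨g (-ε), g ε, by rw [← hg0]; exact hmono hl h0 (by linarith),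
      by rw [← hg0]; exact hmono h0 hr hε0, ?_, ?_⟩
    · rw [hset]
      rintro _ ⟨t, ht, rfl⟩
      beta_reduce
      rw [← heg t ht]
      exact e.map_source (hv t ht).1
    · have hA : e.symm '' (Icc (g (-ε)) (g ε) ×ˢ {(e (X.symm W)).2}) =
          X.symm '' segment ℝ (W + (-ε : ℝ) * v) (W + ε * v) := by
        rw [hset, key, image_image, image_image]
        exact image_congr hes
      rw [hA, hes _ hl, hes _ hr]
      exact hX.isShortestArc hφ (r := R / 3)
        ((Metric.closedBall_subset_closedBall (by linarith)).trans hRt) (hd _ hl) (hd _ hr)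
  have hcu : ContinuousOn (fun t : ℝ => (e (X.symm (W + t * u))).1) (Icc (-ε) ε) := by
    have h1 : ContinuousOn (fun t : ℝ => W + t * u) (Icc (-ε) ε) := by fun_prop
    exact continuous_fst.comp_continuousOn (e.continuousOn.comp
      (X.symm.continuousOn.comp h1 hmemt) fun t ht => (hIcc t ht).1)
  have hinj : InjOn (fun t : ℝ => (e (X.symm (W + t * u))).1) (Icc (-ε) ε) := by
    intro t ht t' ht' htt
    have h1 := e.injOn (hIcc t ht).1 (hIcc t' ht').1
      (Prod.ext htt ((hIcc t ht).2.trans (hIcc t' ht').2.symm))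
    have h2 := X.symm.injOn (hmemt t ht) (hmemt t' ht') h1
    exact_mod_cast mul_right_cancel₀ hu0 (add_left_cancel h2)
  have hneg : ∀ t ∈ Icc (-ε) ε, -t ∈ Icc (-ε) ε := fun t ht =>
    ⟨by linarith [ht.2], by linarith [ht.1]⟩
  have hswap : ∀ t : ℝ, W + (t : ℂ) * -u = W + ((-t : ℝ) : ℂ) * u := fun t => by push_cast; ring
  -- A continuous injective function on an interval is monotone; if it decreases, the line is run in
  -- the opposite direction.
  rcases hcu.strictMonoOn_of_injOn_Icc' (by linarith) hinj with hm | hm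
  · exact main u hIcc hdist hcu hm
  · refine main (-u) (fun t ht => ?_) (fun t ht => ?_) ?_ ?_
    · rw [hswap]; exact hIcc _ (hneg t ht)
    · rw [hswap]; exact hdist _ (hneg t ht)
    · simp only [hswap]
      exact hcu.comp continuous_neg.continuousOn hneg
    · simp only [hswap]
      exact fun t ht t' ht' htt => hm (hneg t' ht') (hneg t ht) (neg_lt_neg htt)

end FlatChart

/-! ### The geodesic foliation with a given singularity -/

theorem IsZeroNbhd.mono {φ : ℂ → ℂ} {n : ℕ} {M U : Set ℂ} (hM : IsZeroNbhd φ n M) (hU : IsOpen U)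
    (hsc : IsSimplyConnected U) (h0 : (0 : ℂ) ∈ U) (hUM : U ⊆ M) : IsZeroNbhd φ n U :=
  ⟨hU, hsc, h0, hM.holomorphic.mono hUM, fun z hz => hM.zero_iff z (hUM hz), hM.order⟩

theorem isSimplyConnected_ball {r : ℝ} (hr : 0 < r) :
    IsSimplyConnected (Metric.ball (0 : ℂ) r) := by
  have : ContractibleSpace (Metric.ball (0 : ℂ) r) :=
    (convex_ball 0 r).contractibleSpace (Metric.nonempty_ball.2 hr)
  exact inferInstanceAs (SimplyConnectedSpace (Metric.ball (0 : ℂ) r))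

section

variable {φ : ℂ → ℂ} {M : Set ℂ} {n : ℕ} {C ρ : ℝ} {Z : OpenPartialHomeomorph ℂ ℂ}

theorem IsNatCoord.apply_ne_zero (hZ : IsNatCoord φ M n C ρ Z) {z : ℂ} (hz : z ∈ Z.source)
    (h0 : z ≠ 0) : Z z ≠ 0 := fun h =>
  h0 (Z.injOn hz hZ.zero_mem (h.trans hZ.map_zero.symm))

/-- The pullback of the singularity `w` under the natural coordinate. -/
noncomputable def modelFoliation (hn : 1 ≤ n) {w : Word} (hw : wordWeight n w = 2 * Real.pi)
    (hZ : IsNatCoord φ M n C ρ Z) {U : Set ℂ} (hU : IsOpen U) (hUZ : U ⊆ Z.source) :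
    Foliation (U \ {0}) where
  -- All boxes with the right plaques are admitted. Compatibility and the description of the
  -- singularity then follow from membership alone, and only covering needs the model charts.
  atlas := {e | e.source ⊆ U \ {0} ∧ (∃ a b c d : ℝ, e.target = Ioo a b ×ˢ Ioo c d) ∧
    ∀ z ∈ e.source, ∀ᶠ q : ℂ × ℂ in 𝓝 (z, z),
      (e q.1).2 = (e q.2).2 ↔ ModelRel n 0 w (Z q.1) (Z q.2)}
  source_subset e he := he.1
  cover z hz := by
    have hzs := hUZ hz.1
    obtain ⟨E, hE, hzE⟩ := exists_isModelChart (θ := 0) hn hw (hZ.apply_ne_zero hzs hz.2)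
    obtain ⟨e, hec, hze, hes, hbox⟩ := exists_shrink_box (Z.trans E) (x := z) ⟨hzs, hzE⟩
      ((hU.sdiff isClosed_singleton).mem_nhds hz)
    refine ⟨e, ⟨fun x hx => (hes hx).1, hbox, fun x hx => ?_⟩, hze⟩
    have hx' := e.open_source.mem_nhds hx
    rw [nhds_prod_eq]
    filter_upwards [prod_mem_prod hx' hx'] with q hq
    rw [hec, hec]
    exact hE _ (hes hq.1).2.2 _ (hes hq.2).2.2
  target_eq e he := he.2.1
  compatible e he e' he' z hz := by
    filter_upwards [he.2.2 z hz.1, he'.2.2 z hz.2] with q h1 h2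
    rw [h1, h2]

/-- The model leaf through a point contains a straight segment of some natural parameter around it.
Cut short enough, the segment is a shortest arc, which the plaque then contains. -/
theorem modelFoliation_isGeodesic (hn : 1 ≤ n) {w : Word} (hw : wordWeight n w = 2 * Real.pi)
    (hZ : IsNatCoord φ M n C ρ Z) {U : Set ℂ} (hU : IsOpen U) (hUZ : U ⊆ Z.source)
    (hφ : ContinuousOn φ U) : (modelFoliation hn hw hZ hU hUZ).IsGeodesic φ U := by
  intro z₀ _ z _ e he hze
  have hz := he.1 hze
  have hzs := hUZ hz.1
  obtain ⟨μ, W, u, hW, hu, hWz, hline⟩ :=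
    exists_modelRel_line (θ := 0) hn hw (hZ.apply_ne_zero hzs hz.2)
  set X := natChart n Z (cis μ) (cis_ne_zero μ) with hX
  have hWX : W ∈ X.target := by
    refine ⟨hW, ?_⟩
    rw [mem_preimage, hWz]
    exact Z.map_source hzs
  have hXz : X.symm W = z := by
    rw [hX, natChart_symm_apply, hWz, Z.left_inv hzs]
  have hflat := (hZ.isFlatChart (cis_ne_zero μ) (norm_cis μ)).restrOpen hU
  have hW' : W ∈ (X.restrOpen U hU).target := by
    have h1 : z ∈ (X.restrOpen U hU).source := by
      rw [OpenPartialHomeomorph.restrOpen_source]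
      exact ⟨hXz ▸ X.map_target hWX, hz.1⟩
    have h2 := (X.restrOpen U hU).map_source h1
    have h3 : (X.restrOpen U hU) z = W := by
      change X z = W
      rw [← hXz, X.right_inv hWX]
    rwa [h3] at h2
  have hc : ContinuousAt (fun t : ℝ => X.symm (W + t * u)) 0 := by
    have h1 : ContinuousAt (fun t : ℝ => W + t * u) 0 := by fun_prop
    refine ContinuousAt.comp (g := X.symm) ?_ h1
    simpa using X.symm.continuousAt hWX
  have hc0 : X.symm (W + ((0 : ℝ) : ℂ) * u) = z := by simpa using hXz
  have htgt : ∀ᶠ t : ℝ in 𝓝 0, W + t * u ∈ X.target := by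
    have h1 : ContinuousAt (fun t : ℝ => W + t * u) 0 := by fun_prop
    exact h1 (by simpa using X.open_target.mem_nhds hWX)
  have hsrc : ∀ᶠ t : ℝ in 𝓝 0, X.symm (W + t * u) ∈ e.source :=
    hc (by beta_reduce; rw [hc0]; exact e.open_source.mem_nhds hze)
  have hrel : ∀ᶠ t : ℝ in 𝓝 0, (e (X.symm (W + t * u))).2 = (e z).2 ↔
      ModelRel n 0 w (Z (X.symm (W + t * u))) (Z z) := by
    have h1 : Tendsto (fun t : ℝ => (X.symm (W + t * u), z)) (𝓝 0) (𝓝 (z, z)) := by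
      have := hc.tendsto
      rw [hc0] at this
      exact this.prodMk_nhds tendsto_const_nhds
    exact h1.eventually (he.2.2 z hze)
  have key := hflat.exists_isShortestArc_plaque hφ hu hW' (e := e) (by
    change ∀ᶠ t : ℝ in 𝓝 0, X.symm (W + t * u) ∈ e.source ∧
      (e (X.symm (W + t * u))).2 = (e (X.symm W)).2
    filter_upwards [htgt, hsrc, hrel, hline] with t h1 h2 h3 h4
    refine ⟨h2, ?_⟩
    rw [hXz, h3, hX, natChart_symm_apply, Z.right_inv h1.2]
    exact h4)
  change ∃ s t : ℝ, s < (e (X.symm W)).1 ∧ (e (X.symm W)).1 < t ∧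
      Icc s t ×ˢ {(e (X.symm W)).2} ⊆ e.target ∧
      IsShortestArc φ U (e.symm (s, (e (X.symm W)).2)) (e.symm (t, (e (X.symm W)).2))
        (e.symm '' (Icc s t ×ˢ {(e (X.symm W)).2})) at key
  rwa [hXz] at key

/-- The natural coordinate itself serves as `Ψ`; its derivative at 0 was normalized to 1. -/
theorem modelFoliation_hasSingularity (hn : 1 ≤ n) {w : Word}
    (hw : wordWeight n w = 2 * Real.pi) (hZ : IsNatCoord φ M n C ρ Z) {U : Set ℂ} (hU : IsOpen U)
    (hUZ : U ⊆ Z.source) (h0 : (0 : ℂ) ∈ U) :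
    (modelFoliation hn hw hZ hU hUZ).HasSingularity n w := by
  have hs : (Z.restrOpen U hU).source = Z.source ∩ U := Z.restrOpen_source U hU
  refine ⟨0, Z.restrOpen U hU, ?_, hZ.map_zero, ?_, hZ.hasDerivAt_zero, ?_⟩
  · rw [hs]; exact ⟨hZ.zero_mem, h0⟩
  · rw [hs]; exact fun z hz => ⟨hz.1.2, hz.2⟩
  · intro z _ e he hze
    exact he.2.2 z hze

end

/-- Every normalized class is realized by a geodesic foliation near the zero. -/
theorem exists_foliation_hasSingularity {n : ℕ} (hn : 1 ≤ n) {φ : ℂ → ℂ} {M : Set ℂ}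
    (hM : IsZeroNbhd φ n M) (c : WordClass) (hc : c.IsNormalized n) :
    ∃ U : Set ℂ, U ⊆ M ∧ IsZeroNbhd φ n U ∧ ∃ F : Foliation (U \ {0}), F.IsGeodesic φ U ∧
      ∀ w : Word, w.toClass = c → F.HasSingularity n w := by
  obtain ⟨w, rfl⟩ := Quotient.exists_rep c
  have hw : wordWeight n w = 2 * Real.pi := hc w rfl
  obtain ⟨C, ρ, Z, hZ⟩ := exists_isNatCoord hM
  obtain ⟨r, hr, hrZ⟩ := Metric.mem_nhds_iff.1 (Z.open_source.mem_nhds hZ.zero_mem)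
  have hU : IsOpen (Metric.ball (0 : ℂ) r) := Metric.isOpen_ball
  have hUM : Metric.ball (0 : ℂ) r ⊆ M := hrZ.trans hZ.source_subset
  have h0 : (0 : ℂ) ∈ Metric.ball (0 : ℂ) r := Metric.mem_ball_self hr
  refine ⟨_, hUM, hM.mono hU (isSimplyConnected_ball hr) h0 hUM, modelFoliation hn hw hZ hU hrZ,
    modelFoliation_isGeodesic hn hw hZ hU hrZ (hM.holomorphic.continuousOn.mono hUM),
    fun w' h => ?_⟩
  exact (modelFoliation_hasSingularity hn hw hZ hU hrZ h0).of_toClass_eq hw h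

/-! ### Leaf directions of a geodesic foliation -/

/-- In the chart `X`, the leaf of `F` through the point with coordinate `W` has direction `u`. -/
def LeafDir {U : Set ℂ} (F : Foliation U) (X : OpenPartialHomeomorph ℂ ℂ) (W u : ℂ) : Prop :=
  W ∈ X.target ∧ ∀ e ∈ F.atlas, X.symm W ∈ e.source →
    ∀ᶠ t : ℝ in 𝓝 0, (e (X.symm (W + t * u))).2 = (e (X.symm W)).2

theorem continuousAt_chart_line (X : OpenPartialHomeomorph ℂ ℂ) {W : ℂ} (u : ℂ) {t : ℝ}
    (h : W + t * u ∈ X.target) : ContinuousAt (fun t : ℝ => X.symm (W + t * u)) t := by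
  have h1 : ContinuousAt (fun t : ℝ => W + t * u) t := by fun_prop
  exact ContinuousAt.comp (g := X.symm) (X.symm.continuousAt h) h1

theorem eventually_line_mem_target (X : OpenPartialHomeomorph ℂ ℂ) {W : ℂ} (u : ℂ) {t : ℝ}
    (h : W + t * u ∈ X.target) : ∀ᶠ s : ℝ in 𝓝 t, W + s * u ∈ X.target := by
  have h1 : ContinuousAt (fun t : ℝ => W + t * u) t := by fun_prop
  exact h1 (X.open_target.mem_nhds h)

section Dir

variable {φ : ℂ → ℂ} {M U : Set ℂ} {κ : ℝ} {X : OpenPartialHomeomorph ℂ ℂ} {F : Foliation U}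
  {W u v : ℂ}

theorem LeafDir.of_chart (hW : W ∈ X.target) {e : OpenPartialHomeomorph ℂ (ℝ × ℝ)}
    (he : e ∈ F.atlas) (hz : X.symm W ∈ e.source)
    (h : ∀ᶠ t : ℝ in 𝓝 0, (e (X.symm (W + t * u))).2 = (e (X.symm W)).2) : LeafDir F X W u := by
  refine ⟨hW, fun e' he' hz' => ?_⟩
  have hc := (continuousAt_chart_line X (W := W) u (t := 0) (by simpa using hW)).tendsto
  rw [Complex.ofReal_zero, zero_mul, add_zero] at hc
  have h1 : Tendsto (fun t : ℝ => (X.symm (W + t * u), X.symm W)) (𝓝 0)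
      (𝓝 (X.symm W, X.symm W)) := hc.prodMk_nhds tendsto_const_nhds
  filter_upwards [h, h1.eventually (F.compatible e he e' he' _ ⟨hz, hz'⟩)] with t h2 h3
  exact h3.1 h2

theorem LeafDir.real_mul (h : LeafDir F X W u) (c : ℝ) : LeafDir F X W (c * u) := by
  refine ⟨h.1, fun e he hz => ?_⟩
  have h1 : Tendsto (fun t : ℝ => t * c) (𝓝 0) (𝓝 0) := by
    have : Continuous fun t : ℝ => t * c := by fun_prop
    simpa using this.tendsto 0
  filter_upwards [h1.eventually (h.2 e he hz)] with t ht
  rw [← ht]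
  push_cast
  ring_nf

theorem LeafDir.neg (h : LeafDir F X W u) : LeafDir F X W (-u) := by
  have := h.real_mul (-1)
  simpa using this

/-- The geodesic property provides a shortest arc of the plaque having the point in its interior,
and there the arc contains a straight segment of the chart. -/
theorem exists_leafDir (hF : F.IsGeodesic φ M) (hφ : ContinuousOn φ M) (hX : IsFlatChart φ M κ X)
    (hXU : X.source ⊆ U) (hW : W ∈ X.target) : ∃ u : ℂ, ‖u‖ = 1 ∧ LeafDir F X W u := by
  have hz := X.map_target hW
  obtain ⟨e, he, hze⟩ := F.cover _ (hXU hz)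
  obtain ⟨s, t, hs, ht, hst, hA⟩ := hF _ (hXU hz) _ (Relation.EqvGen.refl _) e he hze
  have hmem : ∀ x ∈ Icc s t, (x, (e (X.symm W)).2) ∈ e.target := fun x hx => hst ⟨hx, rfl⟩
  have hne : ∀ x ∈ Icc s t, x ≠ (e (X.symm W)).1 →
      e.symm (x, (e (X.symm W)).2) ≠ X.symm W := fun x hx hxe h => by
    have := e.right_inv (hmem x hx)
    rw [h] at this
    exact hxe (congrArg Prod.fst this).symm
  obtain ⟨u, hu, ε, hε, h⟩ := hX.exists_segment_subset hφ hA
    ⟨e (X.symm W), ⟨⟨hs.le, ht.le⟩, rfl⟩, e.left_inv hze⟩ hz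
    (hne s ⟨le_rfl, (hs.trans ht).le⟩ hs.ne) (hne t ⟨(hs.trans ht).le, le_rfl⟩ ht.ne')
  refine ⟨u, hu, LeafDir.of_chart hW he hze ?_⟩
  filter_upwards [Icc_mem_nhds (neg_lt_zero.2 hε) hε] with τ hτ
  have h1 := (h τ hτ).2
  rw [X.right_inv hW] at h1
  obtain ⟨⟨x, y⟩, ⟨hx, hy⟩, hxy⟩ := h1
  obtain rfl : y = _ := hy
  rw [← hxy, e.right_inv (hmem x hx)]

/-- Near a point, the plaque is contained in the line of the leaf direction. -/
theorem LeafDir.eventually_mem_line (h : LeafDir F X W u) (hu : u ≠ 0)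
    {e : OpenPartialHomeomorph ℂ (ℝ × ℝ)} (he : e ∈ F.atlas) (hz : X.symm W ∈ e.source) :
    ∀ᶠ V in 𝓝 W, (e (X.symm V)).2 = (e (X.symm W)).2 → ∃ t : ℝ, V = W + t * u := by
  have hW0 : W + ((0 : ℝ) : ℂ) * u ∈ X.target := by simpa using h.1
  have hc := (continuousAt_chart_line X u hW0)
  have hs : ∀ᶠ t : ℝ in 𝓝 0, X.symm (W + t * u) ∈ e.source :=
    hc (by simpa using e.open_source.mem_nhds hz)
  obtain ⟨ε, hε, hεs⟩ := Metric.nhds_basis_closedBall.mem_iff.1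
    ((eventually_line_mem_target X u hW0).and (hs.and (h.2 e he hz)))
  rw [Real.closedBall_eq_Icc, zero_sub, zero_add] at hεs
  have h0 : X.symm (W + ((0 : ℝ) : ℂ) * u) = X.symm W := by simp
  have key := eventually_mem_arc e hε (c := fun t : ℝ => X.symm (W + t * u))
    (fun t ht => (continuousAt_chart_line X u (hεs ht).1).continuousWithinAt)
    (fun t ht t' ht' htt => by
      have := X.symm.injOn (hεs ht).1 (hεs ht').1 htt
      exact_mod_cast mul_right_cancel₀ hu (add_left_cancel this))
    (fun t ht => (hεs ht).2.1) (fun t ht => by simp only [h0]; exact (hεs ht).2.2)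
  simp only [h0] at key
  filter_upwards [(X.symm.continuousAt h.1).eventually key, X.open_target.mem_nhds h.1]
    with V hV hVt hVe
  obtain ⟨t, ht, htV⟩ := hV hVe
  exact ⟨t, (X.symm.injOn (hεs (Ioo_subset_Icc_self ht)).1 hVt htV).symm⟩

theorem LeafDir.exists_cover (hXU : X.source ⊆ U) (h : LeafDir F X W u) :
    ∃ e ∈ F.atlas, X.symm W ∈ e.source :=
  F.cover _ (hXU (X.map_target h.1))

/-- The leaf direction is unique. -/
theorem LeafDir.eq_real_mul (hXU : X.source ⊆ U) (h : LeafDir F X W u) (h' : LeafDir F X W v)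
    (hu : u ≠ 0) : ∃ c : ℝ, v = c * u := by
  obtain ⟨e, he, hz⟩ := h.exists_cover hXU
  have hc : Tendsto (fun t : ℝ => W + t * v) (𝓝 0) (𝓝 W) := by
    have : Continuous fun t : ℝ => W + t * v := by fun_prop
    simpa using this.tendsto 0
  have h1 := ((hc.eventually (h.eventually_mem_line hu he hz)).and (h'.2 e he hz))
  obtain ⟨t, ⟨h2, h3⟩, ht⟩ := ((h1.filter_mono nhdsWithin_le_nhds).and
    (self_mem_nhdsWithin (a := (0 : ℝ)) (s := {0}ᶜ))).exists
  obtain ⟨s, hs⟩ := h2 h3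
  have ht0 : (t : ℂ) ≠ 0 := by exact_mod_cast ht
  refine ⟨s / t, ?_⟩
  have := add_left_cancel hs
  push_cast
  field_simp
  linear_combination this

theorem LeafDir.eventually_add (hXU : X.source ⊆ U) (h : LeafDir F X W u) :
    ∀ᶠ t : ℝ in 𝓝 0, LeafDir F X (W + t * u) u := by
  obtain ⟨e, he, hz⟩ := h.exists_cover hXU
  have hW0 : W + ((0 : ℝ) : ℂ) * u ∈ X.target := by simpa using h.1
  have hs : ∀ᶠ t : ℝ in 𝓝 0, X.symm (W + t * u) ∈ e.source :=
    (continuousAt_chart_line X u hW0) (by simpa using e.open_source.mem_nhds hz)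
  filter_upwards [eventually_line_mem_target X u hW0, hs, (h.2 e he hz).eventually_nhds]
    with t h1 h2 h3
  refine LeafDir.of_chart h1 he h2 ?_
  have hadd : Tendsto (fun s : ℝ => t + s) (𝓝 0) (𝓝 t) := by
    have : Continuous fun s : ℝ => t + s := by fun_prop
    simpa using this.tendsto 0
  filter_upwards [hadd.eventually h3] with s hs
  rw [h3.self_of_nhds, ← hs]
  push_cast
  ring_nf

/-- The leaf at the endpoint has some direction `v`. By continuity the points shortly before the
endpoint lie on its plaque, which near the endpoint is contained in the line of direction `v`. Hence
`u` is a multiple of `v`. -/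
theorem LeafDir.of_Ico (hF : F.IsGeodesic φ M) (hφ : ContinuousOn φ M) (hX : IsFlatChart φ M κ X)
    (hXU : X.source ⊆ U) {x : ℝ} (hx : 0 < x) (hxt : W + x * u ∈ X.target)
    (h : ∀ s ∈ Ico 0 x, LeafDir F X (W + s * u) u) : LeafDir F X (W + x * u) u := by
  obtain ⟨v, hv, hdir⟩ := exists_leafDir hF hφ hX hXU hxt
  have hv0 : v ≠ 0 := norm_pos_iff.1 (by rw [hv]; exact one_pos)
  obtain ⟨e, he, hz⟩ := hdir.exists_cover hXU
  have hc := continuousAt_chart_line X u hxt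
  have hs : ∀ᶠ t : ℝ in 𝓝 x, X.symm (W + t * u) ∈ e.source := hc (e.open_source.mem_nhds hz)
  have hline : Tendsto (fun t : ℝ => W + t * u) (𝓝 x) (𝓝 (W + x * u)) := by
    have : Continuous fun t : ℝ => W + t * u := by fun_prop
    exact this.tendsto x
  obtain ⟨ε, hε, hεs⟩ := Metric.nhds_basis_ball.mem_iff.1
    ((eventually_line_mem_target X u hxt).and
      (hs.and (hline.eventually (hdir.eventually_mem_line hv0 he hz))))
  rw [Real.ball_eq_Ioo] at hεs
  set a := max 0 (x - ε) with ha
  have hax : a < x := max_lt hx (by linarith)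
  have hI : ∀ s ∈ Ioo a x, s ∈ Ico 0 x ∧ s ∈ Ioo (x - ε) (x + ε) := fun s hs =>
    ⟨⟨(le_max_left _ _).trans hs.1.le, hs.2⟩, (le_max_right _ _).trans_lt hs.1, by linarith [hs.2]⟩
  have hconst : ∀ s ∈ Ioo a x, ∀ s' ∈ Ioo a x,
      (e (X.symm (W + s * u))).2 = (e (X.symm (W + s' * u))).2 := fun s hs s' hs' => by
    refine eq_of_locally_eq (f := fun s : ℝ => (e (X.symm (W + s * u))).2) isPreconnected_Ioo
      (fun y hy => nhdsWithin_le_nhds ?_) hs hs'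
    have h1 := (h y (hI y hy).1).2 e he (hεs (hI y hy).2).2.1
    have hsub : Tendsto (fun s : ℝ => s - y) (𝓝 y) (𝓝 0) := by
      have : Continuous fun s : ℝ => s - y := by fun_prop
      simpa using this.tendsto y
    filter_upwards [hsub.eventually h1] with s hs
    rw [← hs]
    push_cast
    ring_nf
  have hcont : ContinuousAt (fun t : ℝ => (e (X.symm (W + t * u))).2) x :=
    continuousAt_snd.comp (ContinuousAt.comp (g := e) (e.continuousAt hz) hc)
  obtain ⟨s, hsI⟩ := nonempty_Ioo.2 hax
  have hlim : (e (X.symm (W + s * u))).2 = (e (X.symm (W + x * u))).2 := by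
    have h1 : Tendsto (fun t : ℝ => (e (X.symm (W + t * u))).2) (𝓝[<] x)
        (𝓝 (e (X.symm (W + x * u))).2) := hcont.tendsto.mono_left nhdsWithin_le_nhds
    refine tendsto_nhds_unique (tendsto_const_nhds.congr' ?_) h1
    filter_upwards [Ioo_mem_nhdsLT hax] with t ht
    exact hconst s hsI t ht
  obtain ⟨t, ht⟩ := (hεs (hI s hsI).2).2.2 hlim
  have hne : ((s : ℂ) - x) ≠ 0 := sub_ne_zero.2 (by exact_mod_cast hsI.2.ne)
  have hu : u = ((t / (s - x) : ℝ) : ℂ) * v := by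
    push_cast
    field_simp
    linear_combination ht
  have := hdir.real_mul (t / (s - x))
  rwa [← hu] at this

/-- The leaf through `W` contains the line in its direction, as far as it stays in the chart. -/
theorem LeafDir.add_mul (hF : F.IsGeodesic φ M) (hφ : ContinuousOn φ M) (hX : IsFlatChart φ M κ X)
    (hXU : X.source ⊆ U) (h : LeafDir F X W u) {b : ℝ}
    (ht : ∀ s ∈ Icc 0 b, W + s * u ∈ X.target) : ∀ s ∈ Icc 0 b, LeafDir F X (W + s * u) u := by
  set S : Set ℝ := {s | ∀ s' ∈ Icc 0 s, LeafDir F X (W + s' * u) u} with hS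
  have h0 : LeafDir F X (W + ((0 : ℝ) : ℂ) * u) u := by simpa using h
  have hsub : Icc 0 b ⊆ S := by
    -- Continuous induction: closedness comes from `LeafDir.of_Ico`, openness to the right from
    -- `LeafDir.eventually_add`.
    refine IsClosed.Icc_subset_of_forall_mem_nhdsWithin ?_ ?_ ?_
    · refine isClosed_of_closure_subset fun x hx => ?_
      have hxI : x ∈ Icc 0 b :=
        isClosed_Icc.closure_subset (closure_mono inter_subset_right hx)
      have hlt : ∀ s ∈ Ico 0 x, LeafDir F X (W + s * u) u := fun s hs => by
        obtain ⟨y, hy, hyS⟩ := mem_closure_iff.1 hx (Ioi s) isOpen_Ioi hs.2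
        exact hyS.1 s ⟨hs.1, le_of_lt hy⟩
      refine ⟨fun s hs => ?_, hxI⟩
      rcases hs.2.lt_or_eq with h1 | rfl
      · exact hlt s ⟨hs.1, h1⟩
      · rcases hs.1.eq_or_lt with rfl | h1
        · exact h0
        · exact LeafDir.of_Ico hF hφ hX hXU h1 (ht s hxI) hlt
    · intro s hs
      obtain rfl : s = 0 := le_antisymm hs.2 hs.1
      exact h0
    · rintro x ⟨hxS, hxI⟩
      have h1 := (hxS x ⟨hxI.1, le_rfl⟩).eventually_add hXU
      obtain ⟨ε, hε, hεs⟩ := Metric.nhds_basis_ball.mem_iff.1 h1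
      rw [Real.ball_eq_Ioo, zero_sub, zero_add] at hεs
      filter_upwards [Ioo_mem_nhdsGT (by linarith : x < x + ε)] with y hy s hs
      rcases le_or_gt s x with h2 | h2
      · exact hxS s ⟨hs.1, h2⟩
      · have h3 : LeafDir F X (W + x * u + ((s - x : ℝ) : ℂ) * u) u :=
          hεs ⟨by linarith, by linarith [hs.2, hy.2]⟩
        convert h3 using 1
        push_cast
        ring
  exact fun s hs => hsub hs s ⟨hs.1, le_rfl⟩

/-- Leaf directions propagate along segments. -/
theorem LeafDir.of_segment (hF : F.IsGeodesic φ M) (hφ : ContinuousOn φ M)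
    (hX : IsFlatChart φ M κ X) (hXU : X.source ⊆ U) (h : LeafDir F X W u) {t : ℝ}
    (ht : segment ℝ W (W + t * u) ⊆ X.target) : LeafDir F X (W + t * u) u := by
  rcases eq_or_ne t 0 with rfl | ht0
  · simpa using h
  have h1 := LeafDir.add_mul hF hφ hX hXU (h.real_mul t) (b := 1) (fun s hs => ht (by
    rw [segment_eq_image']
    exact ⟨s, hs, by simp⟩)) 1 ⟨zero_le_one, le_rfl⟩
  rw [Complex.ofReal_one, one_mul] at h1
  have h2 := h1.real_mul t⁻¹
  have ht0' : (t : ℂ) ≠ 0 := by exact_mod_cast ht0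
  rwa [Complex.ofReal_inv, inv_mul_cancel_left₀ ht0'] at h2

/-- The leaf direction is a closed relation. -/
theorem LeafDir.of_tendsto (hF : F.IsGeodesic φ M) (hφ : ContinuousOn φ M)
    (hX : IsFlatChart φ M κ X) (hXU : X.source ⊆ U) {ι : Type*} {l : Filter ι} [l.NeBot]
    {f g : ι → ℂ} (hf : Tendsto f l (𝓝 W)) (hg : Tendsto g l (𝓝 u)) (hW : W ∈ X.target)
    (h : ∀ᶠ i in l, LeafDir F X (f i) (g i)) : LeafDir F X W u := by
  obtain ⟨e, he, hz⟩ := F.cover _ (hXU (X.map_target hW))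
  refine LeafDir.of_chart hW he hz ?_
  have hsrc : ∀ᶠ V in 𝓝 W, V ∈ X.target ∧ X.symm V ∈ e.source :=
    Filter.Eventually.and (X.open_target.mem_nhds hW)
      ((X.symm.continuousAt hW) (e.open_source.mem_nhds hz))
  obtain ⟨δ, hδ, hδs⟩ := Metric.eventually_nhds_iff_ball.1 hsrc
  have hu1 : 0 < ‖u‖ + 1 := by positivity
  have hτ : 0 < δ / 2 / (‖u‖ + 1) := by positivity
  -- For a fixed small `t`, the points `f i` and `f i + t * g i` lie on one plaque of `e`, because
  -- the leaf follows the segment between them and this segment stays in the chart. The equality of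
  -- second coordinates then passes to the limit. The size of `t` keeps all these segments within
  -- distance `δ` of `W`.
  filter_upwards [Metric.ball_mem_nhds 0 hτ] with t ht
  rw [mem_ball_zero_iff, Real.norm_eq_abs, lt_div_iff₀ hu1] at ht
  have hf' : ∀ᶠ i in l, ‖f i - W‖ < δ / 2 := by
    have := hf.eventually (Metric.ball_mem_nhds W (half_pos hδ))
    simpa only [Metric.mem_ball, dist_eq_norm] using this
  have hg' : ∀ᶠ i in l, ‖g i‖ < ‖u‖ + 1 :=
    hg.norm.eventually (gt_mem_nhds (by linarith))
  have hdist : ∀ᶠ i in l, ∀ s : ℝ, |s| ≤ |t| → f i + s * g i ∈ Metric.ball W δ := by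
    filter_upwards [hf', hg'] with i h1 h2 s hs
    rw [mem_ball_iff_norm]
    have h3 : ‖(s : ℂ) * g i‖ ≤ |t| * (‖u‖ + 1) := by
      rw [norm_mul, Complex.norm_real, Real.norm_eq_abs]
      exact mul_le_mul hs h2.le (norm_nonneg _) (abs_nonneg _)
    calc ‖f i + s * g i - W‖ = ‖(f i - W) + s * g i‖ := by ring_nf
      _ ≤ ‖f i - W‖ + ‖(s : ℂ) * g i‖ := norm_add_le _ _
      _ < δ := by linarith
  have hWt : W + t * u ∈ Metric.ball W δ := by
    rw [mem_ball_iff_norm, add_sub_cancel_left, norm_mul, Complex.norm_real, Real.norm_eq_abs]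
    nlinarith [abs_nonneg t, norm_nonneg u]
  have heq : ∀ᶠ i in l, (e (X.symm (f i + t * g i))).2 = (e (X.symm (f i))).2 := by
    filter_upwards [h, hdist] with i hi hd
    -- move from `0` to `t` along the leaf
    have hI : ∀ s ∈ Icc (0 : ℝ) 1, f i + s * (t * g i) ∈ Metric.ball W δ := fun s hs => by
      have h1 := hd (s * t) (by
        rw [abs_mul, abs_of_nonneg hs.1]
        nlinarith [hs.2, abs_nonneg t])
      push_cast at h1
      rwa [← mul_assoc]
    have hdir := LeafDir.add_mul hF hφ hX hXU (hi.real_mul t) (b := 1)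
      fun s hs => (hδs _ (hI s hs)).1
    have key := eq_of_locally_eq (S := Icc (0 : ℝ) 1)
      (f := fun s : ℝ => (e (X.symm (f i + s * (t * g i)))).2) isPreconnected_Icc (fun y hy => ?_)
      (right_mem_Icc.2 zero_le_one) (left_mem_Icc.2 zero_le_one)
    · simpa using key
    · refine nhdsWithin_le_nhds ?_
      have h1 := (hdir y hy).2 e he (hδs _ (hI y hy)).2
      have hsub : Tendsto (fun s : ℝ => s - y) (𝓝 y) (𝓝 0) := by
        have : Continuous fun s : ℝ => s - y := by fun_prop
        simpa using this.tendsto y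
      filter_upwards [hsub.eventually h1] with s hs
      rw [← hs]
      push_cast
      ring_nf
  have hcont : ∀ V ∈ Metric.ball W δ, ContinuousAt (fun V => (e (X.symm V)).2) V := fun V hV =>
    continuousAt_snd.comp (ContinuousAt.comp (g := e) (e.continuousAt (hδs V hV).2)
      (X.symm.continuousAt (hδs V hV).1))
  have h1 : Tendsto (fun i => (e (X.symm (f i + t * g i))).2) l
      (𝓝 (e (X.symm (W + t * u))).2) :=
    (hcont _ hWt).tendsto.comp (hf.add (hg.const_mul (t : ℂ)))
  have h2 : Tendsto (fun i => (e (X.symm (f i))).2) l (𝓝 (e (X.symm W)).2) :=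
    (hcont _ (Metric.mem_ball_self hδ)).tendsto.comp hf
  exact tendsto_nhds_unique (h1.congr' heq) h2

end Dir

/-! ### Radial leaves and gaps -/

/-- The natural parameter on the sector around the ray of argument `μ`. -/
noncomputable def coneChart (n : ℕ) (Z : OpenPartialHomeomorph ℂ ℂ) (μ : ℝ) :
    OpenPartialHomeomorph ℂ ℂ :=
  natChart n Z (cis μ) (cis_ne_zero μ)

theorem coneChart_congr {n : ℕ} {Z : OpenPartialHomeomorph ℂ ℂ} {μ μ' : ℝ} (h : cis μ = cis μ') :
    coneChart n Z μ = coneChart n Z μ' := by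
  simp only [coneChart, h]

theorem coneChart_symm_eq_polar (n : ℕ) (Z : OpenPartialHomeomorph ℂ ℂ) (μ : ℝ) {W : ℂ}
    (hW : W ≠ 0) : (coneChart n Z μ).symm W =
      Z.symm (((‖W‖ ^ (1 / expt n) : ℝ) : ℂ) * cis (μ + W.arg / expt n)) := by
  rw [coneChart, natChart_symm_apply, sectorChart_symm_eq_polar n μ hW]

theorem LeafDir.congr {U : Set ℂ} {F : Foliation U} {X X' : OpenPartialHomeomorph ℂ ℂ}
    {W W' u u' : ℂ} (h : LeafDir F X W u) (hW' : W' ∈ X'.target)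
    (heq : ∀ᶠ t : ℝ in 𝓝 0, X'.symm (W' + t * u') = X.symm (W + t * u)) :
    LeafDir F X' W' u' := by
  have h0 : X'.symm W' = X.symm W := by simpa using heq.self_of_nhds
  refine ⟨hW', fun e he hz => ?_⟩
  rw [h0] at hz ⊢
  filter_upwards [heq, h.2 e he hz] with t h1 h2
  rw [h1, h2]

section Geodesic

variable {φ : ℂ → ℂ} {M : Set ℂ} {n : ℕ} {C ρ : ℝ} {Z : OpenPartialHomeomorph ℂ ℂ}

theorem IsNatCoord.mem_target (hZ : IsNatCoord φ M n C ρ Z) (μ : ℝ) {W : ℂ} :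
    W ∈ (coneChart n Z μ).target ↔ W ∈ Complex.slitPlane ∧ ‖W‖ < ρ ^ expt n :=
  hZ.mem_target_natChart (cis_ne_zero μ) (norm_cis μ)

theorem IsNatCoord.isFlatChart_coneChart (hZ : IsNatCoord φ M n C ρ Z) (μ : ℝ) :
    IsFlatChart φ M (√C / expt n) (coneChart n Z μ) :=
  hZ.isFlatChart (cis_ne_zero μ) (norm_cis μ)

theorem IsNatCoord.coneChart_source_subset (hZ : IsNatCoord φ M n C ρ Z) (μ : ℝ) :
    (coneChart n Z μ).source ⊆ M \ {0} := by
  rintro z ⟨hz, hz'⟩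
  refine ⟨hZ.source_subset hz, fun h => ?_⟩
  rw [mem_singleton_iff] at h
  have := Complex.slitPlane_ne_zero hz'.1
  change (cis μ)⁻¹ * Z z ≠ 0 at this
  rw [h, hZ.map_zero, mul_zero] at this
  exact this rfl

theorem IsNatCoord.rpow_pos (hZ : IsNatCoord φ M n C ρ Z) : 0 < ρ ^ expt n :=
  Real.rpow_pos_of_pos hZ.ρ_pos _

/-- The ray of argument `β` is a leaf. -/
def IsRay {U : Set ℂ} (F : Foliation U) (n : ℕ) (ρ : ℝ) (Z : OpenPartialHomeomorph ℂ ℂ) (β : ℝ) :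
    Prop :=
  ∀ x : ℝ, 0 < x → x < ρ ^ expt n → LeafDir F (coneChart n Z β) x 1

variable {F : Foliation (M \ {0})}

theorem IsRay.add_int_mul {β : ℝ} (j : ℤ) (h : IsRay F n ρ Z β) :
    IsRay F n ρ Z (β + 2 * Real.pi * j) := by
  unfold IsRay
  rwa [coneChart_congr (cis_add_int_mul β j)]

theorem isRay_add_int_mul_iff {β : ℝ} (j : ℤ) :
    IsRay F n ρ Z (β + 2 * Real.pi * j) ↔ IsRay F n ρ Z β := by
  unfold IsRay
  rw [coneChart_congr (cis_add_int_mul β j)]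

/-- Turning the axis by γ/k turns the W-plane by γ. A radial line of any chart can thus be treated
as the positive real axis of another. -/
theorem eventually_ofReal_add_mul_cis {x γ : ℝ} (hx : 0 < x) (hγ : |γ| < Real.pi) (n : ℕ)
    (Z : OpenPartialHomeomorph ℂ ℂ) (μ : ℝ) :
    ∀ᶠ t : ℝ in 𝓝 0, (coneChart n Z μ).symm (x * cis γ + t * cis γ) =
      (coneChart n Z (μ + γ / expt n)).symm (x + t * 1) := by
  filter_upwards [eventually_gt_nhds (neg_lt_zero.2 hx)] with t ht
  have hpos : 0 < x + t := by linarith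
  have hne : ((x + t : ℝ) : ℂ) ≠ 0 := by exact_mod_cast hpos.ne'
  rw [mul_one, ← add_mul, ← Complex.ofReal_add, coneChart_symm_eq_polar n Z _ hne,
    coneChart_symm_eq_polar n Z _ (mul_ne_zero hne (cis_ne_zero γ)), arg_ofReal_mul_cis hpos hγ,
    norm_ofReal_mul_cis hpos.le, Complex.arg_ofReal_of_nonneg hpos.le, Complex.norm_real,
    Real.norm_of_nonneg hpos.le, zero_div, add_zero]

/-- A direction proportional to `W` is radial. In the chart centred at this ray the leaf follows the
positive real axis, and the direction propagates along all of it. -/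
theorem IsNatCoord.isRay_of_leafDir (hZ : IsNatCoord φ M n C ρ Z) (hF : F.IsGeodesic φ M)
    (hφ : ContinuousOn φ M) {μ : ℝ} {W u : ℂ} (h : LeafDir F (coneChart n Z μ) W u) {c : ℝ}
    (hc : W = c * u) : IsRay F n ρ Z (μ + W.arg / expt n) := by
  obtain ⟨hW, hWρ⟩ := (hZ.mem_target μ).1 h.1
  have hW0 := Complex.slitPlane_ne_zero hW
  have hn : 0 < ‖W‖ := norm_pos_iff.2 hW0
  have harg := abs_arg_lt_of_mem_slitPlane hW
  have hmem : ∀ x : ℝ, 0 < x → x < ρ ^ expt n →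
      (x : ℂ) ∈ (coneChart n Z (μ + W.arg / expt n)).target := fun x hx hx' => by
    rw [hZ.mem_target, Complex.norm_real, Real.norm_of_nonneg hx.le]
    exact ⟨Complex.ofReal_mem_slitPlane.2 hx, hx'⟩
  have h1 : LeafDir F (coneChart n Z μ) (‖W‖ * cis W.arg) (cis W.arg) := by
    have h2 := h.real_mul (c / ‖W‖)
    have h3 : ((c / ‖W‖ : ℝ) : ℂ) * u = cis W.arg := by
      have h4 := norm_mul_cis_arg W
      have h5 : (‖W‖ : ℂ) ≠ 0 := by exact_mod_cast hn.ne'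
      push_cast
      rw [div_mul_eq_mul_div, ← hc]
      field_simp
      exact h4.symm
    rw [h3] at h2
    rwa [norm_mul_cis_arg]
  have h2 : LeafDir F (coneChart n Z (μ + W.arg / expt n)) (‖W‖ : ℝ) 1 :=
    h1.congr (hmem _ hn hWρ)
      ((eventually_ofReal_add_mul_cis hn harg n Z μ).mono fun t ht => ht.symm)
  intro x hx hx'
  have h3 := LeafDir.of_segment hF hφ (hZ.isFlatChart_coneChart _)
    (hZ.coneChart_source_subset _) h2 (t := x - ‖W‖) ?_
  · convert h3 using 1
    push_cast
    ring
  · intro y hy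
    rw [show ((‖W‖ : ℝ) : ℂ) + ((x - ‖W‖ : ℝ) : ℂ) * 1 = (x : ℂ) by push_cast; ring] at hy
    obtain ⟨a, b, ha, hb, hab, rfl⟩ := hy
    have e : a • ((‖W‖ : ℝ) : ℂ) + b • (x : ℂ) = ((a * ‖W‖ + b * x : ℝ) : ℂ) := by
      simp
    rw [e]
    have hpos : 0 < a * ‖W‖ + b * x := by
      rcases ha.eq_or_lt with rfl | ha
      · have : b = 1 := by linarith
        subst this; linarith
      · have := mul_pos ha hn
        have := mul_nonneg hb hx.le
        linarith
    refine hmem _ hpos ?_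
    have h4 : a * ‖W‖ + b * x ≤ a * max ‖W‖ x + b * max ‖W‖ x :=
      add_le_add (mul_le_mul_of_nonneg_left (le_max_left _ _) ha)
        (mul_le_mul_of_nonneg_left (le_max_right _ _) hb)
    rw [← add_mul, hab, one_mul] at h4
    exact h4.trans_lt (max_lt hWρ hx')

theorem IsNatCoord.leafDir_of_isRay (hZ : IsNatCoord φ M n C ρ Z) {μ x γ : ℝ} (hx : 0 < x)
    (hxρ : x < ρ ^ expt n) (hγ : |γ| < Real.pi) (h : IsRay F n ρ Z (μ + γ / expt n)) :
    LeafDir F (coneChart n Z μ) (x * cis γ) (cis γ) := by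
  refine (h x hx hxρ).congr ?_ (eventually_ofReal_add_mul_cis hx hγ n Z μ)
  rw [hZ.mem_target, norm_ofReal_mul_cis hx.le]
  refine ⟨mem_slitPlane_of_abs_arg_lt ?_ ?_, hxρ⟩
  · exact mul_ne_zero (by exact_mod_cast hx.ne') (cis_ne_zero _)
  · rwa [arg_ofReal_mul_cis hx hγ]

/-- The sector of opening `π / k` with axis of argument `μ` is bounded by two radial leaves and
contains no other radial leaf. -/
structure IsGap (F : Foliation (M \ {0})) (n : ℕ) (ρ : ℝ) (Z : OpenPartialHomeomorph ℂ ℂ)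
    (μ : ℝ) : Prop where
  left : IsRay F n ρ Z (μ - gap n / 2)
  right : IsRay F n ρ Z (μ + gap n / 2)
  not_isRay : ∀ β, |β - μ| < gap n / 2 → ¬ IsRay F n ρ Z β

/-- In the chart around the ray, take points `x j` of the positive axis tending to 0. The leaf
directions there are not real and may be taken in the upper half-plane. The line through `x j` meets
the real axis only at `x j`, so it avoids the slit and belongs to the leaf as far as the radius of
the chart permits. A limit direction `u₀` yields a line through 0 both of whose halves are radial
leaves, at an angle π in W and `gap n` at 0. Between them there is no radial leaf, since the lines
through `x j` near 0 would cross it. -/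
theorem IsNatCoord.exists_isGap (hZ : IsNatCoord φ M n C ρ Z) (hF : F.IsGeodesic φ M)
    (hφ : ContinuousOn φ M) {β : ℝ} (hβ : ¬ IsRay F n ρ Z β) :
    ∃ μ, IsGap F n ρ Z μ ∧ |β - μ| < gap n / 2 := by
  have hR := hZ.rpow_pos
  have hk := expt_pos n
  have hkg := expt_mul_gap n
  set R := ρ ^ expt n with hRdef
  set X := coneChart n Z β with hX
  have hflat := hZ.isFlatChart_coneChart β
  have hsrc := hZ.coneChart_source_subset β
  set x : ℕ → ℝ := fun j => R / (j + 2) with hx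
  have hx0 : ∀ j, 0 < x j := fun j => by positivity
  have hxlim : Tendsto x atTop (𝓝 0) := by
    refine tendsto_const_nhds.div_atTop ?_
    exact tendsto_atTop_add_const_right _ _ tendsto_natCast_atTop_atTop
  have hxR : ∀ j, x j < R := fun j => by
    rw [hx, div_lt_iff₀ (by positivity)]
    have : (0 : ℝ) ≤ j := j.cast_nonneg
    nlinarith
  have hxt : ∀ j, ((x j : ℝ) : ℂ) ∈ X.target := fun j => by
    rw [hX, hZ.mem_target, Complex.norm_real, Real.norm_of_nonneg (hx0 j).le]
    exact ⟨Complex.ofReal_mem_slitPlane.2 (hx0 j), hxR j⟩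
  have hex : ∀ j, ∃ u : ℂ, ‖u‖ = 1 ∧ 0 < u.im ∧ LeafDir F X (x j) u := fun j => by
    obtain ⟨u, hu, hdir⟩ := exists_leafDir hF hφ hflat hsrc (hxt j)
    rcases lt_trichotomy u.im 0 with h | h | h
    · exact ⟨-u, by rwa [norm_neg], by simpa using h, hdir.neg⟩
    · exfalso
      have h1 : u = (u.re : ℂ) := Complex.ext rfl (by simpa using h)
      have h2 : u.re ≠ 0 := fun h3 => by
        rw [h1, h3, Complex.ofReal_zero, norm_zero] at hu
        exact zero_ne_one hu
      have h3 := hZ.isRay_of_leafDir hF hφ hdir (c := x j / u.re) (by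
        refine Complex.ext ?_ ?_
        · rw [Complex.re_ofReal_mul, Complex.ofReal_re, div_mul_cancel₀ _ h2]
        · rw [Complex.im_ofReal_mul, Complex.ofReal_im, h, mul_zero])
      rw [Complex.arg_ofReal_of_nonneg (hx0 j).le, zero_div, add_zero] at h3
      exact hβ h3
    · exact ⟨u, hu, h, hdir⟩
  choose u hu hupos hdir using hex
  -- the leaf through `x j` crosses the whole sector
  have hline : ∀ j, ∀ s : ℝ, x j + |s| < R → LeafDir F X (x j + s * u j) (u j) := fun j s hs => by
    refine LeafDir.of_segment hF hφ hflat hsrc (hdir j) fun y hy => ?_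
    rw [segment_eq_image'] at hy
    obtain ⟨τ, hτ, rfl⟩ := hy
    have e : ((x j : ℝ) : ℂ) + τ • (((x j : ℝ) : ℂ) + s * u j - ((x j : ℝ) : ℂ)) =
        (x j : ℂ) + ((τ * s : ℝ) : ℂ) * u j := by
      rw [Complex.real_smul]; push_cast; ring
    beta_reduce
    rw [e, hZ.mem_target]
    constructor
    · rcases eq_or_ne (τ * s) 0 with h0 | h0
      · rw [h0]; simpa using Complex.ofReal_mem_slitPlane.2 (hx0 j)
      · right
        rw [Complex.add_im, Complex.ofReal_im, zero_add, Complex.im_ofReal_mul]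
        exact mul_ne_zero h0 (hupos j).ne'
    · refine lt_of_le_of_lt (norm_add_le _ _) ?_
      rw [norm_mul, hu, mul_one, Complex.norm_real, Complex.norm_real, Real.norm_of_nonneg (hx0 j).le,
        Real.norm_eq_abs, abs_mul, abs_of_nonneg hτ.1]
      have := mul_le_of_le_one_left (abs_nonneg s) hτ.2
      linarith
  obtain ⟨u₀, hu₀, ψ, hψ, hlim⟩ := (isCompact_sphere (0 : ℂ) 1).tendsto_subseq
    (x := u) fun j => by rw [mem_sphere_zero_iff_norm]; exact hu j
  rw [mem_sphere_zero_iff_norm] at hu₀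
  have hxψ : Tendsto (fun j => x (ψ j)) atTop (𝓝 0) := hxlim.comp hψ.tendsto_atTop
  have hxψC : Tendsto (fun j => ((x (ψ j) : ℝ) : ℂ)) atTop (𝓝 0) := by
    rw [← Complex.ofReal_zero]
    exact (Complex.continuous_ofReal.tendsto 0).comp hxψ
  have hray : ∀ s : ℝ, s ≠ 0 → |s| < R → (s : ℂ) * u₀ ∈ Complex.slitPlane →
      IsRay F n ρ Z (β + ((s : ℂ) * u₀).arg / expt n) := fun s hs0 hs hsl => by
    have hmem : (s : ℂ) * u₀ ∈ X.target := by
      rw [hX, hZ.mem_target]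
      refine ⟨hsl, ?_⟩
      rwa [norm_mul, hu₀, mul_one, Complex.norm_real, Real.norm_eq_abs]
    have h1 : Tendsto (fun j => ((x (ψ j) : ℝ) : ℂ) + s * u (ψ j)) atTop (𝓝 (s * u₀)) := by
      simpa using hxψC.add (hlim.const_mul (s : ℂ))
    have h2 : ∀ᶠ j in atTop, LeafDir F X (((x (ψ j) : ℝ) : ℂ) + s * u (ψ j)) (u (ψ j)) := by
      filter_upwards [hxψ.eventually (gt_mem_nhds (sub_pos.2 hs))] with j hj
      exact hline _ s (by linarith)
    exact hZ.isRay_of_leafDir hF hφ (LeafDir.of_tendsto hF hφ hflat hsrc h1 hlim hmem h2) rfl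
  have him0 : 0 ≤ u₀.im := by
    refine ge_of_tendsto ((Complex.continuous_im.tendsto u₀).comp hlim) ?_
    exact Eventually.of_forall fun j => (hupos (ψ j)).le
  -- A real limit direction would make the original ray a leaf. The factor `u₀.re`, equal to 1 or
  -- -1, only puts the chosen point on the positive half of the axis.
  have him : 0 < u₀.im := by
    refine lt_of_le_of_ne him0 fun h0 => hβ ?_
    have h1 : u₀ = (u₀.re : ℂ) := Complex.ext rfl (by simpa using h0.symm)
    have h2 : |u₀.re| = 1 := by
      rw [h1, Complex.norm_real, Real.norm_eq_abs] at hu₀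
      exact hu₀
    have h3 : u₀.re ≠ 0 := fun h => by rw [h, abs_zero] at h2; exact zero_ne_one h2
    have hpos : 0 < R / 2 * u₀.re * u₀.re := by
      rw [mul_assoc]
      exact mul_pos (by positivity) (mul_self_pos.2 h3)
    have e : ((R / 2 * u₀.re : ℝ) : ℂ) * u₀ = ((R / 2 * u₀.re * u₀.re : ℝ) : ℂ) := by
      conv_lhs => rw [h1, ← Complex.ofReal_mul, Complex.ofReal_re]
    have h4 := hray (R / 2 * u₀.re) (by positivity) (by
      rw [abs_mul, h2, abs_of_pos (by positivity)]; linarith) (by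
      rw [e]
      exact Complex.ofReal_mem_slitPlane.2 hpos)
    rwa [e, Complex.arg_ofReal_of_nonneg hpos.le, zero_div,
      add_zero] at h4
  set α := u₀.arg with hα
  have hα0 : 0 < α := by
    have := Complex.arg_nonneg_iff.2 him0
    refine lt_of_le_of_ne this fun h => ?_
    have := Complex.arg_eq_zero_iff.1 h.symm
    exact him.ne' this.2
  have hαpi : α < Real.pi := by
    refine lt_of_le_of_ne (Complex.arg_le_pi _) fun h => ?_
    exact him.ne' (Complex.arg_eq_pi_iff.1 h).2
  have hu₀cis : u₀ = cis α := by
    have := norm_mul_cis_arg u₀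
    rw [hu₀, Complex.ofReal_one, one_mul] at this
    exact this.symm
  have hR2 : 0 < R / 2 := by positivity
  have hleft : IsRay F n ρ Z (β + α / expt n) := by
    have h1 := hray (R / 2) hR2.ne' (by rw [abs_of_pos hR2]; linarith) (by
      right
      rw [Complex.im_ofReal_mul]
      positivity)
    rwa [Complex.arg_real_mul _ hR2] at h1
  have hright : IsRay F n ρ Z (β + (α - Real.pi) / expt n) := by
    have e : ((-(R / 2) : ℝ) : ℂ) * u₀ = ((R / 2 : ℝ) : ℂ) * -u₀ := by push_cast; ring
    have h1 := hray (-(R / 2)) (by linarith) (by rw [abs_neg, abs_of_pos hR2]; linarith) (by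
      right
      rw [Complex.im_ofReal_mul]
      exact mul_ne_zero (by linarith) him.ne')
    rwa [e, Complex.arg_real_mul _ hR2, Complex.arg_neg_eq_arg_sub_pi_of_im_pos him] at h1
  have hgk : gap n = Real.pi / expt n := rfl
  have hαk : 0 < α / expt n := by positivity
  have hαk' : α / expt n < gap n := by rw [hgk]; gcongr
  refine ⟨β + α / expt n - gap n / 2, ⟨?_, ?_, fun β' hβ' hray' => ?_⟩, ?_⟩
  · convert hright using 1
    rw [hgk]; ring
  · rwa [sub_add_cancel]
  · -- a radial leaf inside the gap would cross the leaf through `x j`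
    set γ := expt n * (β' - β) with hγ
    have hβγ : β' = β + γ / expt n := by rw [hγ, mul_div_cancel_left₀ _ hk.ne']; ring
    have hγb : α - Real.pi < γ ∧ γ < α := by
      have h1 := abs_lt.1 hβ'
      have h2 : expt n * (α / expt n) = α := mul_div_cancel₀ _ hk.ne'
      constructor <;> nlinarith
    have hγpi : |γ| < Real.pi := abs_lt.2 ⟨by linarith, by linarith⟩
    have hD : 0 < (u₀ * cis (-γ)).im := by
      have h1 : (cis (α - γ)).im = Real.sin (α - γ) := Complex.exp_ofReal_mul_I_im _
      rw [hu₀cis, ← cis_add, ← sub_eq_add_neg, h1]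
      exact Real.sin_pos_of_pos_of_lt_pi (by linarith) (by linarith)
    have hDlim : Tendsto (fun j => (u (ψ j) * cis (-γ)).im) atTop (𝓝 (u₀ * cis (-γ)).im) :=
      (Complex.continuous_im.tendsto _).comp (hlim.mul_const _)
    have hslim : Tendsto (fun j => x (ψ j) + |x (ψ j) * Real.sin γ / (u (ψ j) * cis (-γ)).im|)
        atTop (𝓝 0) := by
      simpa using hxψ.add ((hxψ.mul_const (Real.sin γ)).div hDlim hD.ne').abs
    obtain ⟨j, hj, hjD⟩ := ((hslim.eventually (gt_mem_nhds hR)).and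
      (hDlim.eventually (lt_mem_nhds hD))).exists
    set D := (u (ψ j) * cis (-γ)).im with hDdef
    set v := u (ψ j) with hv
    have hcisre : (cis γ).re = Real.cos γ := Complex.exp_ofReal_mul_I_re _
    have hcisim : (cis γ).im = Real.sin γ := Complex.exp_ofReal_mul_I_im _
    have hcisre' : (cis (-γ)).re = Real.cos γ := by
      rw [← Real.cos_neg]; exact Complex.exp_ofReal_mul_I_re _
    have hcisim' : (cis (-γ)).im = - Real.sin γ := by
      rw [← Real.sin_neg]; exact Complex.exp_ofReal_mul_I_im _
    have hDe : D = v.im * Real.cos γ - v.re * Real.sin γ := by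
      rw [hDdef, Complex.mul_im, hcisre', hcisim']; ring
    -- Cramer's rule for the intersection of the line through `x (ψ j)` with the ray of argument
    -- `γ`. Both parameters are proportional to `x (ψ j)` with bounded factors for large `j`, so the
    -- crossing lies inside the chart.
    have hcross : (x (ψ j) : ℂ) + ((x (ψ j) * Real.sin γ / D : ℝ) : ℂ) * v =
        ((x (ψ j) * v.im / D : ℝ) : ℂ) * cis γ := by
      apply Complex.ext
      · rw [Complex.add_re, Complex.re_ofReal_mul, Complex.re_ofReal_mul, Complex.ofReal_re, hcisre]
        field_simp
        rw [hDe]; ring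
      · rw [Complex.add_im, Complex.im_ofReal_mul, Complex.im_ofReal_mul, Complex.ofReal_im, hcisim]
        field_simp
        ring
    have hy : 0 < x (ψ j) * v.im / D := div_pos (mul_pos (hx0 _) (hupos _)) hjD
    have h1 := hline _ _ hj
    rw [hcross] at h1
    have hyR : x (ψ j) * v.im / D < R := by
      have := ((hZ.mem_target β).1 h1.1).2
      rwa [norm_ofReal_mul_cis hy.le] at this
    have h2 := hZ.leafDir_of_isRay (μ := β) hy hyR hγpi (by rwa [← hβγ])
    -- By uniqueness of the leaf direction at the crossing, `v` is parallel to the ray, so that `D =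
    -- 0`.
    obtain ⟨c, hc⟩ := LeafDir.eq_real_mul hsrc h2 h1 (cis_ne_zero γ)
    rw [hDdef, show v = c * cis γ from hc, mul_assoc, ← cis_add, add_neg_cancel, cis_zero, mul_one, Complex.ofReal_im] at hjD
    exact lt_irrefl _ hjD
  · rw [abs_lt]
    constructor <;> linarith

end Geodesic

/-! ### Slopes of the leaves in a gap -/

section Geodesic

variable {φ : ℂ → ℂ} {M : Set ℂ} {n : ℕ} {C ρ : ℝ} {Z : OpenPartialHomeomorph ℂ ℂ}
  {F : Foliation (M \ {0})} {μ : ℝ} {W : ℂ} {m : ℝ}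

theorem ofReal_add_I_ne_zero (m : ℝ) : (m : ℂ) + Complex.I ≠ 0 := fun h => by
  have := congrArg Complex.im h
  simp at this

theorem IsNatCoord.mem_target_of_re_pos (hZ : IsNatCoord φ M n C ρ Z) (hW : 0 < W.re)
    (hWρ : ‖W‖ < ρ ^ expt n) : W ∈ (coneChart n Z μ).target :=
  (hZ.mem_target μ).2 ⟨Or.inl hW, hWρ⟩

theorem IsNatCoord.segment_subset_target (hZ : IsNatCoord φ M n C ρ Z) {V : ℂ} (hW : 0 < W.re)
    (hWρ : ‖W‖ < ρ ^ expt n) (hV : 0 ≤ V.re) (hV0 : V ∈ Complex.slitPlane)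
    (hVρ : ‖V‖ < ρ ^ expt n) : segment ℝ W V ⊆ (coneChart n Z μ).target := by
  rintro P ⟨a, b, ha, hb, hab, rfl⟩
  rw [hZ.mem_target]
  constructor
  · rcases ha.eq_or_lt with rfl | ha
    · rw [zero_add] at hab
      simpa [hab] using hV0
    · left
      simp only [Complex.add_re, Complex.real_smul, Complex.re_ofReal_mul]
      have := mul_pos ha hW
      have := mul_nonneg hb hV
      linarith
  · have h := (convex_ball (0 : ℂ) (ρ ^ expt n)) (mem_ball_zero_iff.2 hWρ) (mem_ball_zero_iff.2 hVρ)
      ha hb hab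
    exact mem_ball_zero_iff.1 h

/-- In the W-plane the gap is the right half-plane, bounded by two radial leaves on the imaginary
axis. A non-vertical leaf line through `W` meets this axis at some i y. For y = 0 the leaf would be
radial, and for 0 < |y| < ρ^k it would cross a bounding leaf in another direction. Hence |y| ≥ ρ^k:
the line rises by at least ρ^k / 2 over the horizontal distance Re W, which bounds the reciprocal
slope `m`. -/
theorem IsGap.exists_slope (h : IsGap F n ρ Z μ) (hZ : IsNatCoord φ M n C ρ Z)
    (hF : F.IsGeodesic φ M) (hφ : ContinuousOn φ M) (hW : 0 < W.re)
    (hWρ : ‖W‖ < ρ ^ expt n / 2) :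
    ∃ m : ℝ, LeafDir F (coneChart n Z μ) W (m + Complex.I) ∧ |m| ≤ 2 * W.re / ρ ^ expt n := by
  have hR := hZ.rpow_pos
  have hk := expt_pos n
  set R := ρ ^ expt n with hRdef
  have hWR : ‖W‖ < R := by linarith
  have hsrc := hZ.coneChart_source_subset μ
  have hflat := hZ.isFlatChart_coneChart μ
  obtain ⟨u, hu, hdir⟩ := exists_leafDir hF hφ hflat hsrc (hZ.mem_target_of_re_pos hW hWR)
  have huI : u.im ≠ 0 → LeafDir F (coneChart n Z μ) W ((u.re / u.im : ℝ) + Complex.I) := fun h0 => by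
    convert hdir.real_mul (1 / u.im) using 1
    apply Complex.ext
    · rw [Complex.re_ofReal_mul, Complex.add_re, Complex.ofReal_re, Complex.I_re]
      field_simp
      ring
    · rw [Complex.im_ofReal_mul, Complex.add_im, Complex.ofReal_im, Complex.I_im]
      field_simp
      ring
  rcases eq_or_ne u.re 0 with h0 | h0
  · have h1 : u.im ≠ 0 := fun h1 => by
      rw [show u = 0 from Complex.ext h0 h1, norm_zero] at hu
      exact zero_ne_one hu
    refine ⟨_, huI h1, ?_⟩
    rw [h0, zero_div, abs_zero]
    positivity
  set s : ℝ := -W.re / u.re with hs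
  set y : ℝ := W.im + s * u.im with hy
  have hsre : s * u.re = -W.re := by rw [hs]; field_simp
  have hP : W + s * u = y * Complex.I := by
    apply Complex.ext
    · rw [Complex.add_re, Complex.re_ofReal_mul, hsre]; simp
    · rw [Complex.add_im, Complex.im_ofReal_mul]; simp [hy]
  have hnormP : ‖W + s * u‖ = |y| := by
    rw [hP, norm_mul, Complex.norm_I, mul_one, Complex.norm_real, Real.norm_eq_abs]
  rcases eq_or_ne y 0 with hy0 | hy0
  · exfalso
    rw [hy0, Complex.ofReal_zero, zero_mul] at hP
    refine h.not_isRay _ ?_ (hZ.isRay_of_leafDir hF hφ hdir (c := -s) ?_)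
    · rw [add_sub_cancel_left]
      exact abs_arg_div_expt_lt n hW
    · push_cast
      rw [neg_mul]
      exact eq_neg_of_add_eq_zero_left hP
  rcases lt_or_ge |y| R with hyR | hyR
  · exfalso
    have h1 := LeafDir.of_segment hF hφ hflat hsrc hdir (t := s)
      (hZ.segment_subset_target hW hWR (by rw [hP]; simp) (Or.inr (by rw [hP]; simpa using hy0))
        (by rwa [hnormP]))
    have hpi := Real.pi_pos
    obtain ⟨γ, hγ, hyγ, hγre, hray⟩ : ∃ γ : ℝ, |γ| < Real.pi ∧ (y : ℂ) * Complex.I = |y| * cis γ ∧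
        (cis γ).re = 0 ∧ IsRay F n ρ Z (μ + γ / expt n) := by
      have hg : Real.pi / 2 / expt n = gap n / 2 := by unfold gap; ring
      have hc : cis (Real.pi / 2) = Complex.I := by
        unfold cis
        push_cast
        exact Complex.exp_pi_div_two_mul_I
      have hc' : cis (-(Real.pi / 2)) = -Complex.I := by
        unfold cis
        push_cast
        rw [neg_mul, Complex.exp_neg, Complex.exp_pi_div_two_mul_I, Complex.inv_I]
      rcases lt_or_gt_of_ne hy0 with hy' | hy'
      · refine ⟨-(Real.pi / 2), ?_, ?_, ?_, ?_⟩
        · rw [abs_neg, abs_of_pos (by positivity)]; linarith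
        · rw [abs_of_neg hy', hc']; push_cast; ring
        · rw [hc']; simp
        · rw [neg_div, hg, ← sub_eq_add_neg]
          exact h.left
      · refine ⟨Real.pi / 2, ?_, ?_, ?_, ?_⟩
        · rw [abs_of_pos (by positivity)]; linarith
        · rw [abs_of_pos hy', hc]
        · rw [hc]; simp
        · rw [hg]
          exact h.right
    have h2 := hZ.leafDir_of_isRay (abs_pos.2 hy0) hyR hγ hray
    rw [hP, hyγ] at h1
    obtain ⟨c, hc⟩ := LeafDir.eq_real_mul hsrc h2 h1 (cis_ne_zero γ)
    rw [hc, Complex.re_ofReal_mul, hγre, mul_zero] at h0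
    exact h0 rfl
  · have h1 : R / 2 ≤ |s * u.im| := by
      have h2 : |y| ≤ |W.im| + |s * u.im| := abs_add_le _ _
      have h3 := Complex.abs_im_le_norm W
      linarith
    have h2 : u.im ≠ 0 := fun h2 => by
      rw [h2, mul_zero, abs_zero] at h1
      linarith
    refine ⟨_, huI h2, ?_⟩
    have h3 : |s * u.im| = W.re / |u.re / u.im| := by
      rw [hs, abs_mul, abs_div, abs_div, abs_neg, abs_of_pos hW]
      have := abs_pos.2 h0
      have := abs_pos.2 h2
      field_simp
    have h4 : 0 < |u.re / u.im| := abs_pos.2 (div_ne_zero h0 h2)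
    rw [h3, le_div_iff₀ h4] at h1
    rw [le_div_iff₀ hR]
    linarith

theorem LeafDir.slope_unique {m' : ℝ} (hZ : IsNatCoord φ M n C ρ Z)
    (h : LeafDir F (coneChart n Z μ) W (m + Complex.I))
    (h' : LeafDir F (coneChart n Z μ) W (m' + Complex.I)) : m = m' := by
  obtain ⟨c, hc⟩ := LeafDir.eq_real_mul (hZ.coneChart_source_subset μ) h h' (ofReal_add_I_ne_zero m)
  have h1 := congrArg Complex.im hc
  have h2 := congrArg Complex.re hc
  simp only [Complex.im_ofReal_mul, Complex.re_ofReal_mul, Complex.add_im, Complex.add_re,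
    Complex.ofReal_im, Complex.ofReal_re, Complex.I_im, Complex.I_re, zero_add, add_zero,
    mul_one] at h1 h2
  rw [h2, ← h1, one_mul]

theorem IsGap.abs_slope_le (h : IsGap F n ρ Z μ) (hZ : IsNatCoord φ M n C ρ Z)
    (hF : F.IsGeodesic φ M) (hφ : ContinuousOn φ M) (hW : 0 < W.re)
    (hWρ : ‖W‖ < ρ ^ expt n / 2) (hm : LeafDir F (coneChart n Z μ) W (m + Complex.I)) :
    |m| ≤ 2 * W.re / ρ ^ expt n := by
  obtain ⟨m', h1, h2⟩ := h.exists_slope hZ hF hφ hW hWρ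
  rwa [hm.slope_unique hZ h1]

/-- This keeps the sheared point W - m Im W, and with it the crossing of the leaf with the axis, in
the open half-plane of the gap. -/
theorem IsGap.abs_slope_mul_im_lt (h : IsGap F n ρ Z μ) (hZ : IsNatCoord φ M n C ρ Z)
    (hF : F.IsGeodesic φ M) (hφ : ContinuousOn φ M) (hW : 0 < W.re)
    (hWρ : ‖W‖ < ρ ^ expt n / 2) (hm : LeafDir F (coneChart n Z μ) W (m + Complex.I)) :
    |m * W.im| < W.re := by
  have hR := hZ.rpow_pos
  have h1 := h.abs_slope_le hZ hF hφ hW hWρ hm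
  have h2 := Complex.abs_im_le_norm W
  rw [le_div_iff₀ hR] at h1
  rw [abs_mul]
  have h3 : |m| * |W.im| ≤ |m| * ‖W‖ := mul_le_mul_of_nonneg_left h2 (abs_nonneg m)
  rcases (abs_nonneg m).eq_or_lt with h4 | h4
  · rw [← h4, zero_mul]; exact hW
  · have : |m| * ‖W‖ < |m| * (ρ ^ expt n / 2) := mul_lt_mul_of_pos_left hWρ h4
    linarith

/-- The leaf through `W` crosses the axis of the gap. -/
theorem IsGap.leafDir_axis (h : IsGap F n ρ Z μ) (hZ : IsNatCoord φ M n C ρ Z)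
    (hF : F.IsGeodesic φ M) (hφ : ContinuousOn φ M) (hW : 0 < W.re)
    (hWρ : ‖W‖ < ρ ^ expt n / 2) (hm : LeafDir F (coneChart n Z μ) W (m + Complex.I)) :
    LeafDir F (coneChart n Z μ) ((W.re - m * W.im : ℝ) : ℂ) (m + Complex.I) := by
  have h1 := abs_lt.1 (h.abs_slope_mul_im_lt hZ hF hφ hW hWρ hm)
  have hpos : 0 < W.re - m * W.im := by linarith
  have e : W + ((-W.im : ℝ) : ℂ) * (m + Complex.I) = ((W.re - m * W.im : ℝ) : ℂ) := by
    apply Complex.ext <;> simp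
    ring
  rw [← e]
  have hre : (W + ((-W.im : ℝ) : ℂ) * (m + Complex.I)).re = W.re - m * W.im := by
    rw [e, Complex.ofReal_re]
  refine LeafDir.of_segment hF hφ (hZ.isFlatChart_coneChart μ) (hZ.coneChart_source_subset μ) hm
    (hZ.segment_subset_target hW (by linarith [hZ.rpow_pos]) (by rw [hre]; exact hpos.le)
      (Or.inl (by rw [hre]; exact hpos)) ?_)
  rw [e, Complex.norm_real, Real.norm_of_nonneg hpos.le]
  have := Complex.re_le_norm W
  linarith

/-- Slopes near `W` are bounded, and by closedness of the direction relation every cluster value is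
a slope at `W`. Uniqueness of the slope leaves one cluster value. -/
theorem IsGap.continuousAt_slope (h : IsGap F n ρ Z μ) (hZ : IsNatCoord φ M n C ρ Z)
    (hF : F.IsGeodesic φ M) (hφ : ContinuousOn φ M) (hW : 0 < W.re)
    (hWρ : ‖W‖ < ρ ^ expt n / 2) {f : ℂ → ℝ}
    (hf : ∀ᶠ V in 𝓝 W, LeafDir F (coneChart n Z μ) V (f V + Complex.I)) : ContinuousAt f W := by
  have hR := hZ.rpow_pos
  have hWR : ‖W‖ < ρ ^ expt n := by linarith
  refine (isCompact_Icc (a := (-1 : ℝ)) (b := 1)).tendsto_nhds_of_unique_mapClusterPt ?_ ?_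
  · have h1 : ∀ᶠ V in 𝓝 W, 0 < V.re :=
      Complex.continuous_re.continuousAt.eventually (lt_mem_nhds hW)
    have h2 : ∀ᶠ V in 𝓝 W, ‖V‖ < ρ ^ expt n / 2 :=
      continuous_norm.continuousAt.eventually (gt_mem_nhds hWρ)
    filter_upwards [hf, h1, h2] with V h3 h4 h5
    have h6 := h.abs_slope_le hZ hF hφ h4 h5 h3
    rw [le_div_iff₀ hR] at h6
    have h7 := Complex.re_le_norm V
    refine abs_le.1 ?_
    by_contra h8
    nlinarith
  · intro x _ hx
    obtain ⟨𝒰, hle, hlim⟩ := mapClusterPt_iff_ultrafilter.1 hx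
    have h1 : LeafDir F (coneChart n Z μ) W (x + Complex.I) :=
      LeafDir.of_tendsto hF hφ (hZ.isFlatChart_coneChart μ) (hZ.coneChart_source_subset μ)
        (f := id) (g := fun V => (f V : ℂ) + Complex.I) (l := (𝒰 : Filter ℂ)) hle
        (((Complex.continuous_ofReal.tendsto x).comp hlim).add_const Complex.I)
        (hZ.mem_target_of_re_pos hW hWR) (hle hf)
    exact h1.slope_unique hZ hf.self_of_nhds

/-- All gaps have the same width, so of two distinct overlapping gaps one would contain a bounding
leaf of the other in its interior. -/
theorem IsGap.eq_of_abs_sub_lt {μ' : ℝ} (h : IsGap F n ρ Z μ) (h' : IsGap F n ρ Z μ')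
    (hd : |μ - μ'| < gap n) : μ = μ' := by
  have hd := abs_lt.1 hd
  rcases lt_trichotomy μ μ' with h1 | h1 | h1
  · exact (h.not_isRay _ (abs_lt.2 ⟨by linarith, by linarith⟩) h'.left).elim
  · exact h1
  · exact (h.not_isRay _ (abs_lt.2 ⟨by linarith, by linarith⟩) h'.right).elim

theorem IsGap.add_int_mul (h : IsGap F n ρ Z μ) (j : ℤ) :
    IsGap F n ρ Z (μ + 2 * Real.pi * j) := by
  refine ⟨?_, ?_, fun β hβ hr => h.not_isRay (β - 2 * Real.pi * j) ?_ ?_⟩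
  · have := h.left.add_int_mul j
    convert this using 1; ring
  · have := h.right.add_int_mul j
    convert this using 1; ring
  · convert hβ using 2; ring
  · have := hr.add_int_mul (-j)
    convert this using 1
    push_cast; ring

/-- The ambiguity of arguments modulo 2π is moved to the gap, so that angles can be compared as real
numbers. -/
theorem IsGap.exists_lift (h : IsGap F n ρ Z μ) {r r' a β : ℝ} (hr : 0 < r) (hr' : 0 < r')
    (he : (r : ℂ) * cis (μ + a) = r' * cis β) :
    r = r' ∧ ∃ μ', IsGap F n ρ Z μ' ∧ cis μ' = cis μ ∧ β = μ' + a := by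
  obtain ⟨h1, j, hj⟩ := eq_of_ofReal_mul_cis_eq hr hr' he
  refine ⟨h1, μ + 2 * Real.pi * (-j : ℤ), h.add_int_mul _, cis_add_int_mul _ _, ?_⟩
  push_cast
  linarith

theorem IsGap.eq_of_symm_eq {μ' : ℝ} {W' : ℂ} (h : IsGap F n ρ Z μ) (h' : IsGap F n ρ Z μ')
    (hW : 0 < W.re) (hW' : 0 < W'.re)
    (he : (sectorChart n (cis μ) (cis_ne_zero μ)).symm W =
      (sectorChart n (cis μ') (cis_ne_zero μ')).symm W') : cis μ = cis μ' ∧ W = W' := by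
  have hW0 : W ≠ 0 := fun h => by simp [h] at hW
  have hW0' : W' ≠ 0 := fun h => by simp [h] at hW'
  have hk := expt_pos n
  rw [sectorChart_symm_eq_polar n _ hW0, sectorChart_symm_eq_polar n _ hW0'] at he
  have hn := norm_pos_iff.2 hW0
  have hn' := norm_pos_iff.2 hW0'
  obtain ⟨h1, μ'', hμ, hcis, h2⟩ := h.exists_lift (by positivity) (by positivity) he
  have h3 := abs_lt.1 (abs_arg_div_expt_lt n hW)
  have h4 := abs_lt.1 (abs_arg_div_expt_lt n hW')
  have h5 := hμ.eq_of_abs_sub_lt h' (abs_lt.2 ⟨by linarith, by linarith⟩)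
  subst h5
  refine ⟨hcis.symm, ?_⟩
  have h6 : W.arg = W'.arg := by
    have : W.arg / expt n = W'.arg / expt n := by linarith
    field_simp at this
    exact this
  have h7 : ‖W‖ = ‖W'‖ := by
    rwa [Real.rpow_left_inj hn.le hn'.le (by positivity)] at h1
  rw [← norm_mul_cis_arg W, h6, h7, norm_mul_cis_arg]

end Geodesic

/-! ### Straightening the leaves in the gaps -/

theorem mul_cpow_of_re_pos {a b : ℂ} (ha : 0 < a.re) (hb : 0 < b.re) (x : ℂ) :
    (a * b) ^ x = a ^ x * b ^ x := by
  have ha0 : a ≠ 0 := fun h => by simp [h] at ha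
  have hb0 : b ≠ 0 := fun h => by simp [h] at hb
  have h1 := abs_lt.1 (Complex.abs_arg_lt_pi_div_two_iff.2 (Or.inl ha))
  have h2 := abs_lt.1 (Complex.abs_arg_lt_pi_div_two_iff.2 (Or.inl hb))
  rw [Complex.cpow_def_of_ne_zero (mul_ne_zero ha0 hb0), Complex.cpow_def_of_ne_zero ha0,
    Complex.cpow_def_of_ne_zero hb0, Complex.log_mul ha0 hb0 ⟨by linarith, by linarith⟩, add_mul,
    Complex.exp_add]

/-- The sector chart around the ray of argument `μ`. -/
noncomputable abbrev sector (n : ℕ) (μ : ℝ) : OpenPartialHomeomorph ℂ ℂ :=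
  sectorChart n (cis μ) (cis_ne_zero μ)

theorem norm_sector_symm_rpow (n : ℕ) (μ : ℝ) (W : ℂ) : ‖(sector n μ).symm W‖ ^ expt n = ‖W‖ := by
  rw [norm_sectorChart_symm n _ (norm_cis μ), ← Real.rpow_mul (norm_nonneg W),
    one_div_mul_cancel (expt_pos n).ne', Real.rpow_one]

theorem sector_congr {n : ℕ} {μ μ' : ℝ} (h : cis μ = cis μ') : sector n μ = sector n μ' := by
  simp only [sector, h]

section Geodesic

variable {φ : ℂ → ℂ} {M : Set ℂ} {n : ℕ} {C ρ : ℝ} {Z : OpenPartialHomeomorph ℂ ℂ}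
  {F : Foliation (M \ {0})} {μ : ℝ} {W : ℂ} {q : ℂ → ℂ}

theorem IsNatCoord.isRay_or_gap (hZ : IsNatCoord φ M n C ρ Z) (hF : F.IsGeodesic φ M)
    (hφ : ContinuousOn φ M) {ζ : ℂ} (hζ : ζ ≠ 0) :
    (∃ r β : ℝ, 0 < r ∧ IsRay F n ρ Z β ∧ ζ = r * cis β) ∨
      ∃ (μ : ℝ) (W : ℂ), IsGap F n ρ Z μ ∧ 0 < W.re ∧ ζ = (sector n μ).symm W := by
  have hr : 0 < ‖ζ‖ := norm_pos_iff.2 hζ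
  by_cases hβ : IsRay F n ρ Z ζ.arg
  · exact Or.inl ⟨_, _, hr, hβ, (norm_mul_cis_arg ζ).symm⟩
  · right
    obtain ⟨μ, hμ, hd⟩ := hZ.exists_isGap hF hφ hβ
    have hk := expt_pos n
    have hkg := expt_mul_gap n
    have h1 : |expt n * (ζ.arg - μ)| < Real.pi / 2 := by
      rw [abs_mul, abs_of_pos hk]
      nlinarith
    obtain ⟨W, -, hW, he⟩ := exists_sectorChart_symm_eq hr
      (h1.trans (by linarith [Real.pi_pos]))
    refine ⟨μ, W, hμ, ?_, by rw [he, norm_mul_cis_arg]⟩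
    rw [hW, Complex.re_ofReal_mul]
    refine mul_pos (by positivity) ?_
    have : (cis (expt n * (ζ.arg - μ))).re = Real.cos (expt n * (ζ.arg - μ)) :=
      Complex.exp_ofReal_mul_I_re _
    rw [this]
    exact Real.cos_pos_of_mem_Ioo (abs_lt.1 h1)

theorem IsGap.ne_of_isRay (h : IsGap F n ρ Z μ) (hW : 0 < W.re) {r β : ℝ} (hr : 0 < r)
    (hβ : IsRay F n ρ Z β) : (r : ℂ) * cis β ≠ (sector n μ).symm W := fun he => by
  have hW0 : W ≠ 0 := fun h => by simp [h] at hW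
  have hn := norm_pos_iff.2 hW0
  rw [sectorChart_symm_eq_polar n _ hW0] at he
  obtain ⟨-, μ', hμ', -, hβ'⟩ := h.exists_lift (by positivity) hr he.symm
  refine hμ'.not_isRay β ?_ hβ
  rw [hβ', add_sub_cancel_left]
  exact abs_arg_div_expt_lt n hW

/-- Inside the gaps, `q` is the relative displacement that makes the leaves perpendicular to the
axis of the gap; it vanishes elsewhere. -/
def IsShearing (F : Foliation (M \ {0})) (n : ℕ) (ρ : ℝ) (Z : OpenPartialHomeomorph ℂ ℂ)
    (q : ℂ → ℂ) : Prop :=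
  ∀ ζ, ‖ζ‖ ^ expt n < ρ ^ expt n / 2 →
    (∃ (μ : ℝ) (W : ℂ) (m : ℝ), IsGap F n ρ Z μ ∧ 0 < W.re ∧ ζ = (sector n μ).symm W ∧
      LeafDir F (coneChart n Z μ) W (m + Complex.I) ∧ q ζ = ((m * W.im : ℝ) : ℂ) / W) ∨
    (q ζ = 0 ∧ ∀ (μ : ℝ) (W : ℂ), IsGap F n ρ Z μ → 0 < W.re → ζ ≠ (sector n μ).symm W)

theorem IsNatCoord.exists_isShearing (hZ : IsNatCoord φ M n C ρ Z) (hF : F.IsGeodesic φ M)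
    (hφ : ContinuousOn φ M) : ∃ q, IsShearing F n ρ Z q := by
  have key : ∀ ζ : ℂ, ∃ x : ℂ, ‖ζ‖ ^ expt n < ρ ^ expt n / 2 →
      (∃ (μ : ℝ) (W : ℂ) (m : ℝ), IsGap F n ρ Z μ ∧ 0 < W.re ∧ ζ = (sector n μ).symm W ∧
        LeafDir F (coneChart n Z μ) W (m + Complex.I) ∧ x = ((m * W.im : ℝ) : ℂ) / W) ∨
      (x = 0 ∧ ∀ (μ : ℝ) (W : ℂ), IsGap F n ρ Z μ → 0 < W.re → ζ ≠ (sector n μ).symm W) :=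
    fun ζ => by
    by_cases h : ∃ (μ : ℝ) (W : ℂ), IsGap F n ρ Z μ ∧ 0 < W.re ∧ ζ = (sector n μ).symm W
    · by_cases hζ : ‖ζ‖ ^ expt n < ρ ^ expt n / 2
      · obtain ⟨μ, W, hμ, hW, rfl⟩ := h
        rw [norm_sector_symm_rpow] at hζ
        obtain ⟨m, hm, -⟩ := hμ.exists_slope hZ hF hφ hW hζ
        exact ⟨_, fun _ => Or.inl ⟨μ, W, m, hμ, hW, rfl, hm, rfl⟩⟩
      · exact ⟨0, fun h => absurd h hζ⟩
    · push Not at h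
      exact ⟨0, fun _ => Or.inr ⟨rfl, h⟩⟩
  choose q hq using key
  exact ⟨q, hq⟩

theorem IsShearing.of_gap (hq : IsShearing F n ρ Z q) (h : IsGap F n ρ Z μ) (hW : 0 < W.re)
    (hWρ : ‖W‖ < ρ ^ expt n / 2) : ∃ m : ℝ, LeafDir F (coneChart n Z μ) W (m + Complex.I) ∧
      q ((sector n μ).symm W) = ((m * W.im : ℝ) : ℂ) / W := by
  rcases hq ((sector n μ).symm W) (by rwa [norm_sector_symm_rpow]) with
    ⟨μ', W', m, hμ', hW', he, hm, hqe⟩ | ⟨-, h2⟩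
  · obtain ⟨h3, h4⟩ := h.eq_of_symm_eq hμ' hW hW' he
    subst h4
    exact ⟨m, by rwa [coneChart_congr h3], hqe⟩
  · exact (h2 μ W h hW rfl).elim

theorem IsShearing.of_ray (hq : IsShearing F n ρ Z q) {r β : ℝ} (hr : 0 < r)
    (hβ : IsRay F n ρ Z β) (hrρ : r ^ expt n < ρ ^ expt n / 2) : q (r * cis β) = 0 := by
  rcases hq (r * cis β) (by rwa [norm_ofReal_mul_cis hr.le]) with ⟨μ, W, m, hμ, hW, he, -⟩ | h
  · exact (hμ.ne_of_isRay hW hr hβ he).elim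
  · exact h.1

theorem IsShearing.zero (hq : IsShearing F n ρ Z q) (hρ : 0 < ρ) : q 0 = 0 := by
  have hk := expt_pos n
  rcases hq 0 (by rw [norm_zero, Real.zero_rpow hk.ne']; positivity) with
    ⟨μ, W, m, hμ, hW, he, -⟩ | h
  · have := norm_sector_symm_rpow n μ W
    rw [← he, norm_zero, Real.zero_rpow hk.ne'] at this
    have := norm_eq_zero.1 this.symm
    simp [this] at hW
  · exact h.1

/-- This bound vanishes on the boundary of the gap and at 0; the continuity of `q` across radial
leaves and at 0 rests on it. -/
theorem IsShearing.norm_gap_le (hq : IsShearing F n ρ Z q) (h : IsGap F n ρ Z μ)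
    (hZ : IsNatCoord φ M n C ρ Z) (hF : F.IsGeodesic φ M) (hφ : ContinuousOn φ M) (hW : 0 < W.re)
    (hWρ : ‖W‖ < ρ ^ expt n / 2) : ‖q ((sector n μ).symm W)‖ ≤ 2 * W.re / ρ ^ expt n := by
  obtain ⟨m, hm, he⟩ := hq.of_gap h hW hWρ
  have hW0 : W ≠ 0 := fun h => by simp [h] at hW
  have hn := norm_pos_iff.2 hW0
  refine le_trans ?_ (h.abs_slope_le hZ hF hφ hW hWρ hm)
  rw [he, norm_div, Complex.norm_real, Real.norm_eq_abs, abs_mul, div_le_iff₀ hn]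
  exact mul_le_mul_of_nonneg_left (Complex.abs_im_le_norm W) (abs_nonneg m)

theorem IsShearing.norm_le (hq : IsShearing F n ρ Z q) (hZ : IsNatCoord φ M n C ρ Z)
    (hF : F.IsGeodesic φ M) (hφ : ContinuousOn φ M) {ζ : ℂ}
    (hζ : ‖ζ‖ ^ expt n < ρ ^ expt n / 2) : ‖q ζ‖ ≤ 2 * ‖ζ‖ ^ expt n / ρ ^ expt n := by
  have hR := hZ.rpow_pos
  by_cases h : ∃ (μ : ℝ) (W : ℂ), IsGap F n ρ Z μ ∧ 0 < W.re ∧ ζ = (sector n μ).symm W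
  · obtain ⟨μ, W, hμ, hW, rfl⟩ := h
    rw [norm_sector_symm_rpow] at hζ ⊢
    refine (hq.norm_gap_le hμ hZ hF hφ hW hζ).trans ?_
    have := Complex.re_le_norm W
    gcongr
  · have h0 : q ζ = 0 := by
      rcases eq_or_ne ζ 0 with rfl | h0
      · exact hq.zero hZ.ρ_pos
      · rcases hZ.isRay_or_gap hF hφ h0 with ⟨r, β, hr, hβ, rfl⟩ | h'
        · rw [norm_ofReal_mul_cis hr.le] at hζ
          exact hq.of_ray hr hβ hζ
        · exact absurd h' h
    rw [h0, norm_zero]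
    positivity

theorem IsShearing.norm_lt_one (hq : IsShearing F n ρ Z q) (hZ : IsNatCoord φ M n C ρ Z)
    (hF : F.IsGeodesic φ M) (hφ : ContinuousOn φ M) {ζ : ℂ}
    (hζ : ‖ζ‖ ^ expt n < ρ ^ expt n / 2) : ‖q ζ‖ < 1 := by
  refine (hq.norm_le hZ hF hφ hζ).trans_lt ?_
  rw [div_lt_one hZ.rpow_pos]
  linarith

theorem eventually_norm_rpow_lt {n : ℕ} {ζ : ℂ} {R : ℝ} (hζ : ‖ζ‖ ^ expt n < R) :
    ∀ᶠ ζ' in 𝓝 ζ, ‖ζ'‖ ^ expt n < R :=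
  (continuous_norm.rpow_const fun _ => Or.inr (expt_pos n).le).continuousAt.eventually
    (gt_mem_nhds hζ)

theorem IsShearing.continuousAt_gap (hq : IsShearing F n ρ Z q) (h : IsGap F n ρ Z μ)
    (hZ : IsNatCoord φ M n C ρ Z) (hF : F.IsGeodesic φ M) (hφ : ContinuousOn φ M) (hW : 0 < W.re)
    (hWρ : ‖W‖ < ρ ^ expt n / 2) : ContinuousAt q ((sector n μ).symm W) := by
  have hW0 : W ≠ 0 := fun h => by simp [h] at hW
  have hWt : W ∈ (sector n μ).target := Or.inl hW
  rw [(sector n μ).symm.continuousAt_iff_continuousAt_comp_right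
    (by simpa using (sector n μ).map_target hWt), OpenPartialHomeomorph.symm_symm,
    (sector n μ).right_inv hWt]
  have hev : ∀ᶠ V in 𝓝 W, 0 < V.re ∧ ‖V‖ < ρ ^ expt n / 2 :=
    (Complex.continuous_re.continuousAt.eventually (lt_mem_nhds hW)).and
      (continuous_norm.continuousAt.eventually (gt_mem_nhds hWρ))
  have hex : ∀ V : ℂ, ∃ m : ℝ, 0 < V.re ∧ ‖V‖ < ρ ^ expt n / 2 →
      LeafDir F (coneChart n Z μ) V (m + Complex.I) ∧
      q ((sector n μ).symm V) = ((m * V.im : ℝ) : ℂ) / V := fun V => by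
    by_cases hV : 0 < V.re ∧ ‖V‖ < ρ ^ expt n / 2
    · obtain ⟨m, hm⟩ := hq.of_gap h hV.1 hV.2
      exact ⟨m, fun _ => hm⟩
    · exact ⟨0, fun h => absurd h hV⟩
  choose f hf using hex
  have hfc : ContinuousAt f W :=
    h.continuousAt_slope hZ hF hφ hW hWρ (hev.mono fun V hV => (hf V hV).1)
  have h1 : ContinuousAt (fun V : ℂ => ((f V * V.im : ℝ) : ℂ) / V) W :=
    ((Complex.continuous_ofReal.continuousAt.comp
      (hfc.mul Complex.continuous_im.continuousAt))).div continuousAt_id hW0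
  exact h1.congr (hev.mono fun V hV => (hf V hV).2.symm)

/-- Near the ray, `q` is 0 or bounded by 2 Re W / ρ^k inside some gap. The ray lies outside that
gap, so a point at angle δ from the ray is within angle k|δ| of the imaginary axis in the W-plane.
Thus Re W ≤ ‖W‖ k|δ|, which gives ‖q‖ ≤ k|δ|. -/
theorem IsShearing.continuousAt_ray (hq : IsShearing F n ρ Z q) (hZ : IsNatCoord φ M n C ρ Z)
    (hF : F.IsGeodesic φ M) (hφ : ContinuousOn φ M) {r β : ℝ} (hr : 0 < r)
    (hβ : IsRay F n ρ Z β) (hrρ : r ^ expt n < ρ ^ expt n / 2) : ContinuousAt q (r * cis β) := by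
  have hR := hZ.rpow_pos
  have hk := expt_pos n
  have hkg := expt_mul_gap n
  set ζ₀ : ℂ := r * cis β with hζ₀
  have hζ0 : ζ₀ ≠ 0 := mul_ne_zero (by exact_mod_cast hr.ne') (cis_ne_zero β)
  have hq0 : q ζ₀ = 0 := hq.of_ray hr hβ hrρ
  unfold ContinuousAt
  rw [hq0]
  have harg : Tendsto (fun ζ : ℂ => expt n * |(ζ / ζ₀).arg|) (𝓝 ζ₀) (𝓝 0) := by
    have h1 : ContinuousAt (fun ζ : ℂ => ζ / ζ₀) ζ₀ := by fun_prop
    have h2 : ContinuousAt Complex.arg (ζ₀ / ζ₀) := by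
      rw [div_self hζ0]
      exact Complex.continuousAt_arg Complex.one_mem_slitPlane
    have h3 := (ContinuousAt.comp (f := fun ζ : ℂ => ζ / ζ₀) h2 h1).abs.const_mul (expt n)
    have h4 := h3.tendsto
    simpa [div_self hζ0] using h4
  refine squeeze_zero_norm' ?_ harg
  have hlt : ∀ᶠ ζ in 𝓝 ζ₀, ‖ζ‖ ^ expt n < ρ ^ expt n / 2 :=
    eventually_norm_rpow_lt (by rwa [hζ₀, norm_ofReal_mul_cis hr.le])
  filter_upwards [hlt, isOpen_ne.mem_nhds hζ0] with ζ hζ hne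
  rcases hZ.isRay_or_gap hF hφ hne with ⟨r', β', hr', hβ', rfl⟩ | ⟨μ, W, hμ, hW, rfl⟩
  · rw [norm_ofReal_mul_cis hr'.le] at hζ
    rw [hq.of_ray hr' hβ' hζ, norm_zero]
    positivity
  · rw [norm_sector_symm_rpow] at hζ
    refine (hq.norm_gap_le hμ hZ hF hφ hW hζ).trans ?_
    have hW0 : W ≠ 0 := fun h => by simp [h] at hW
    have hn := norm_pos_iff.2 hW0
    set δ := ((sector n μ).symm W / ζ₀).arg with hδ
    have he : (sector n μ).symm W =
        ((‖(sector n μ).symm W / ζ₀‖ * r : ℝ) : ℂ) * cis (β + δ) := by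
      have h1 := norm_mul_cis_arg ((sector n μ).symm W / ζ₀)
      rw [← hδ] at h1
      rw [cis_add]
      push_cast
      calc (sector n μ).symm W = (sector n μ).symm W / ζ₀ * ζ₀ := (div_mul_cancel₀ _ hζ0).symm
        _ = ‖(sector n μ).symm W / ζ₀‖ * cis δ * ζ₀ := by rw [h1]
        _ = _ := by
          generalize ‖(sector n μ).symm W / ζ₀‖ = x
          rw [hζ₀]
          ring
    have hpos : 0 < ‖(sector n μ).symm W / ζ₀‖ * r :=
      mul_pos (norm_pos_iff.2 (div_ne_zero hne hζ0)) hr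
    obtain ⟨-, μ', hμ', -, hβ'⟩ := hμ.exists_lift (by positivity) hpos
      ((sectorChart_symm_eq_polar n μ hW0).symm.trans he)
    have h1 : gap n / 2 ≤ |β - μ'| := not_lt.1 fun h => hμ'.not_isRay β h hβ
    have h2 : |β - μ'| ≤ |W.arg / expt n| + |δ| := by
      have : β - μ' = W.arg / expt n - δ := by linarith
      rw [this]
      exact abs_sub _ _
    have h3 : Real.pi / 2 - |W.arg| ≤ expt n * |δ| := by
      rw [abs_div, abs_of_pos hk] at h2
      have h4 : expt n * (|W.arg| / expt n) = |W.arg| := mul_div_cancel₀ _ hk.ne'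
      nlinarith
    have h4 : W.re = ‖W‖ * Real.sin (Real.pi / 2 - |W.arg|) := by
      rw [Real.sin_pi_div_two_sub, Real.cos_abs, Complex.norm_mul_cos_arg]
    have h5 : 0 ≤ Real.pi / 2 - |W.arg| := by
      have := Complex.abs_arg_lt_pi_div_two_iff.2 (Or.inl hW)
      linarith
    have h6 := Real.sin_le h5
    rw [div_le_iff₀ hR, h4]
    have h7 : ‖W‖ * Real.sin (Real.pi / 2 - |W.arg|) ≤ ‖W‖ * (expt n * |δ|) :=
      mul_le_mul_of_nonneg_left (h6.trans h3) hn.le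
    have h8 : ‖W‖ * (expt n * |δ|) ≤ ρ ^ expt n / 2 * (expt n * |δ|) :=
      mul_le_mul_of_nonneg_right hζ.le (by positivity)
    linarith

theorem IsShearing.tendsto_zero (hq : IsShearing F n ρ Z q) (hZ : IsNatCoord φ M n C ρ Z)
    (hF : F.IsGeodesic φ M) (hφ : ContinuousOn φ M) : Tendsto q (𝓝 0) (𝓝 0) := by
  have hk := expt_pos n
  have hR := hZ.rpow_pos
  have h0 : ‖(0 : ℂ)‖ ^ expt n < ρ ^ expt n / 2 := by
    rw [norm_zero, Real.zero_rpow hk.ne']; positivity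
  refine squeeze_zero_norm' (a := fun ζ : ℂ => 2 * ‖ζ‖ ^ expt n / ρ ^ expt n) ?_ ?_
  · filter_upwards [eventually_norm_rpow_lt h0] with ζ hζ using hq.norm_le hZ hF hφ hζ
  · have h1 : Continuous fun ζ : ℂ => 2 * ‖ζ‖ ^ expt n / ρ ^ expt n :=
      ((continuous_norm.rpow_const fun _ => Or.inr hk.le).const_mul 2).div_const _
    have h2 := h1.tendsto 0
    simpa [Real.zero_rpow hk.ne'] using h2

theorem IsShearing.continuousAt (hq : IsShearing F n ρ Z q) (hZ : IsNatCoord φ M n C ρ Z)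
    (hF : F.IsGeodesic φ M) (hφ : ContinuousOn φ M) {ζ : ℂ}
    (hζ : ‖ζ‖ ^ expt n < ρ ^ expt n / 2) : ContinuousAt q ζ := by
  rcases eq_or_ne ζ 0 with rfl | h0
  · unfold ContinuousAt
    rw [hq.zero hZ.ρ_pos]
    exact hq.tendsto_zero hZ hF hφ
  rcases hZ.isRay_or_gap hF hφ h0 with ⟨r, β, hr, hβ, rfl⟩ | ⟨μ, W, hμ, hW, rfl⟩
  · rw [norm_ofReal_mul_cis hr.le] at hζ
    exact hq.continuousAt_ray hZ hF hφ hr hβ hζ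
  · rw [norm_sector_symm_rpow] at hζ
    exact hq.continuousAt_gap hμ hZ hF hφ hW hζ

/-- The straightening map. -/
noncomputable def straighten (n : ℕ) (q : ℂ → ℂ) (ζ : ℂ) : ℂ :=
  ζ * (1 - q ζ) ^ ((1 / expt n : ℝ) : ℂ)

theorem one_sub_re_pos {x : ℂ} (hx : ‖x‖ < 1) : 0 < (1 - x).re := by
  have := Complex.re_le_norm x
  rw [Complex.sub_re, Complex.one_re]
  linarith

theorem norm_straighten_rpow (n : ℕ) (q : ℂ → ℂ) (ζ : ℂ) :
    ‖straighten n q ζ‖ ^ expt n = ‖ζ‖ ^ expt n * ‖1 - q ζ‖ := by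
  rw [straighten, norm_mul, Complex.norm_cpow_real, Real.mul_rpow (norm_nonneg _) (by positivity),
    ← Real.rpow_mul (norm_nonneg _), one_div_mul_cancel (expt_pos n).ne', Real.rpow_one]

theorem straighten_zero (n : ℕ) (q : ℂ → ℂ) : straighten n q 0 = 0 := by
  rw [straighten, zero_mul]

theorem IsShearing.straighten_ray (hq : IsShearing F n ρ Z q) {r β : ℝ} (hr : 0 < r)
    (hβ : IsRay F n ρ Z β) (hrρ : r ^ expt n < ρ ^ expt n / 2) :
    straighten n q (r * cis β) = r * cis β := by
  rw [straighten, hq.of_ray hr hβ hrρ, sub_zero, Complex.one_cpow, mul_one]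

/-- With q = m Im W / W the shear is multiplication of W by 1 - q. Both factors have positive real
part, so the power 1/k distributes over them. The map ζ (1 - q)^(1/k) thus expresses the shears of
all gaps, and the identity on rays, without reference to a chart. -/
theorem IsShearing.straighten_gap (hq : IsShearing F n ρ Z q) (h : IsGap F n ρ Z μ)
    (hZ : IsNatCoord φ M n C ρ Z) (hF : F.IsGeodesic φ M) (hφ : ContinuousOn φ M) (hW : 0 < W.re)
    (hWρ : ‖W‖ < ρ ^ expt n / 2) {m : ℝ} (hm : LeafDir F (coneChart n Z μ) W (m + Complex.I)) :
    straighten n q ((sector n μ).symm W) = (sector n μ).symm (W - ((m * W.im : ℝ) : ℂ)) := by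
  have hW0 : W ≠ 0 := fun h => by simp [h] at hW
  obtain ⟨m', hm', he⟩ := hq.of_gap h hW hWρ
  obtain rfl := hm'.slope_unique hZ hm
  have h1 := hq.norm_lt_one hZ hF hφ (ζ := (sector n μ).symm W) (by rwa [norm_sector_symm_rpow])
  have h2 := one_sub_re_pos h1
  have h3 : W - ((m' * W.im : ℝ) : ℂ) = W * (1 - ((m' * W.im : ℝ) : ℂ) / W) := by
    rw [mul_sub, mul_one, mul_div_cancel₀ _ hW0]
  rw [straighten, h3, ← he]
  generalize q ((sector n μ).symm W) = x at h2
  rw [sectorChart_symm_apply, sectorChart_symm_apply, mul_cpow_of_re_pos hW h2, mul_assoc]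

theorem IsShearing.continuousAt_straighten (hq : IsShearing F n ρ Z q)
    (hZ : IsNatCoord φ M n C ρ Z) (hF : F.IsGeodesic φ M) (hφ : ContinuousOn φ M) {ζ : ℂ}
    (hζ : ‖ζ‖ ^ expt n < ρ ^ expt n / 2) : ContinuousAt (straighten n q) ζ := by
  have h1 := hq.continuousAt hZ hF hφ hζ
  exact continuousAt_id.mul ((continuousAt_const.sub h1).cpow continuousAt_const
    (Or.inl (one_sub_re_pos (hq.norm_lt_one hZ hF hφ hζ))))

/-- The difference quotient at 0 is (1 - q)^(1/k), and q tends to 0. -/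
theorem IsShearing.hasDerivAt_straighten (hq : IsShearing F n ρ Z q)
    (hZ : IsNatCoord φ M n C ρ Z) (hF : F.IsGeodesic φ M) (hφ : ContinuousOn φ M) :
    HasDerivAt (straighten n q) 1 0 := by
  rw [hasDerivAt_iff_tendsto_slope_zero]
  have h1 : Tendsto (fun ζ => (1 - q ζ) ^ ((1 / expt n : ℝ) : ℂ)) (𝓝 0) (𝓝 1) := by
    have h2 : Tendsto (fun ζ => 1 - q ζ) (𝓝 0) (𝓝 1) := by
      simpa using (hq.tendsto_zero hZ hF hφ).const_sub 1
    have h3 : ContinuousAt (fun x : ℂ => x ^ ((1 / expt n : ℝ) : ℂ)) 1 :=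
      continuousAt_id.cpow continuousAt_const Complex.one_mem_slitPlane
    have h4 := h3.tendsto.comp h2
    rwa [Complex.one_cpow] at h4
  refine (h1.mono_left nhdsWithin_le_nhds).congr' ?_
  filter_upwards [self_mem_nhdsWithin] with ζ hζ
  have hζ0 : ζ ≠ 0 := hζ
  rw [zero_add, straighten_zero, sub_zero, straighten, smul_eq_mul, inv_mul_cancel_left₀ hζ0]

end Geodesic

/-! ### Bijectivity of the straightening map near 0 -/

section Geodesic

variable {φ : ℂ → ℂ} {M : Set ℂ} {n : ℕ} {C ρ : ℝ} {Z : OpenPartialHomeomorph ℂ ℂ}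
  {F : Foliation (M \ {0})} {μ : ℝ} {W : ℂ} {q : ℂ → ℂ}

theorem sub_ofReal_re_pos {m : ℝ} (h : |m * W.im| < W.re) :
    0 < (W - ((m * W.im : ℝ) : ℂ)).re := by
  have := abs_lt.1 h
  rw [Complex.sub_re, Complex.ofReal_re]
  linarith

/-- The image determines the point Re W - m Im W where the leaf crosses the axis. The slope there is
unique, so `m` and then `W` are determined. -/
theorem IsGap.shear_injective (h : IsGap F n ρ Z μ) (hZ : IsNatCoord φ M n C ρ Z)
    (hF : F.IsGeodesic φ M) (hφ : ContinuousOn φ M) {W' : ℂ} (hW : 0 < W.re)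
    (hWρ : ‖W‖ < ρ ^ expt n / 2) (hW' : 0 < W'.re) (hWρ' : ‖W'‖ < ρ ^ expt n / 2) {m m' : ℝ}
    (hm : LeafDir F (coneChart n Z μ) W (m + Complex.I))
    (hm' : LeafDir F (coneChart n Z μ) W' (m' + Complex.I))
    (he : W - ((m * W.im : ℝ) : ℂ) = W' - ((m' * W'.im : ℝ) : ℂ)) : W = W' := by
  have h1 := congrArg Complex.re he
  have h2 := congrArg Complex.im he
  simp only [Complex.sub_re, Complex.sub_im, Complex.ofReal_re, Complex.ofReal_im, sub_zero] at h1 h2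
  have h3 := h.leafDir_axis hZ hF hφ hW hWρ hm
  rw [h1] at h3
  obtain rfl := h3.slope_unique hZ (h.leafDir_axis hZ hF hφ hW' hWρ' hm')
  rw [h2] at h1
  exact Complex.ext (by linarith) h2

/-- The preimage is found by following the leaf through the axis point Re W up to the height Im W.
Since |m| ≤ 2 Re W / ρ^k and |Im W| < ρ^k / 4, the horizontal displacement is at most Re W / 2,
which keeps it in the half-plane. -/
theorem IsGap.exists_shear_eq (h : IsGap F n ρ Z μ) (hZ : IsNatCoord φ M n C ρ Z)
    (hF : F.IsGeodesic φ M) (hφ : ContinuousOn φ M) (hW : 0 < W.re) (hWρ : ‖W‖ < ρ ^ expt n / 4) :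
    ∃ (V : ℂ) (m : ℝ), 0 < V.re ∧ ‖V‖ ≤ 2 * ‖W‖ ∧
      LeafDir F (coneChart n Z μ) V (m + Complex.I) ∧ V - ((m * V.im : ℝ) : ℂ) = W := by
  have hR := hZ.rpow_pos
  set R := ρ ^ expt n with hRdef
  have hre := Complex.re_le_norm W
  have him := Complex.abs_im_le_norm W
  have htn : ‖(W.re : ℂ)‖ = W.re := by rw [Complex.norm_real, Real.norm_of_nonneg hW.le]
  obtain ⟨m, hm, hle⟩ := h.exists_slope hZ hF hφ (W := (W.re : ℂ)) (by simpa using hW)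
    (by rw [htn]; linarith)
  rw [Complex.ofReal_re, le_div_iff₀ hR] at hle
  have hmW : |m * W.im| ≤ W.re / 2 := by
    rw [abs_mul]
    have h1 : |m| * |W.im| ≤ |m| * (R / 4) :=
      mul_le_mul_of_nonneg_left (by linarith) (abs_nonneg m)
    linarith
  set V : ℂ := W + ((m * W.im : ℝ) : ℂ) with hV
  have hVe : V = (W.re : ℂ) + (W.im : ℝ) * (m + Complex.I) := by
    rw [hV]
    apply Complex.ext <;> simp
    ring
  have hVim : V.im = W.im := by simp [hV]
  have hVre : 0 < V.re := by
    have := abs_le.1 hmW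
    rw [hV, Complex.add_re, Complex.ofReal_re]
    linarith
  have hVn : ‖V‖ ≤ 2 * ‖W‖ := by
    refine (norm_add_le _ _).trans ?_
    rw [Complex.norm_real, Real.norm_eq_abs]
    linarith
  refine ⟨V, m, hVre, hVn, ?_, by rw [hVim, hV, add_sub_cancel_right]⟩
  rw [hVe]
  refine LeafDir.of_segment hF hφ (hZ.isFlatChart_coneChart μ) (hZ.coneChart_source_subset μ) hm ?_
  rw [← hVe]
  exact hZ.segment_subset_target (by simpa using hW) (by rw [htn]; linarith) hVre.le (Or.inl hVre)
    (by linarith)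

/-- Only 0 goes to 0, radial leaves are fixed pointwise, and each gap is mapped into itself. Points
in different pieces therefore have different images, and `IsGap.shear_injective` treats a single
gap. -/
theorem IsShearing.injOn_straighten (hq : IsShearing F n ρ Z q) (hZ : IsNatCoord φ M n C ρ Z)
    (hF : F.IsGeodesic φ M) (hφ : ContinuousOn φ M) :
    InjOn (straighten n q) {ζ | ‖ζ‖ ^ expt n < ρ ^ expt n / 2} := by
  have hk := expt_pos n
  have h0 : ∀ ζ : ℂ, ‖ζ‖ ^ expt n < ρ ^ expt n / 2 → straighten n q ζ = 0 → ζ = 0 :=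
    fun ζ hζ he => by
    have h1 := norm_straighten_rpow n q ζ
    have h2 := one_sub_re_pos (hq.norm_lt_one hZ hF hφ hζ)
    have h3 := Complex.re_le_norm (1 - q ζ)
    rw [he, norm_zero, Real.zero_rpow hk.ne', eq_comm, mul_eq_zero] at h1
    have h4 := h1.resolve_right (by linarith)
    exact norm_eq_zero.1 ((Real.rpow_eq_zero (norm_nonneg ζ) hk.ne').1 h4)
  have hgap : ∀ (μ : ℝ) (W : ℂ), IsGap F n ρ Z μ → 0 < W.re → ‖W‖ < ρ ^ expt n / 2 →
      ∃ m : ℝ, LeafDir F (coneChart n Z μ) W (m + Complex.I) ∧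
        0 < (W - ((m * W.im : ℝ) : ℂ)).re ∧
        straighten n q ((sector n μ).symm W) = (sector n μ).symm (W - ((m * W.im : ℝ) : ℂ)) :=
    fun μ W hμ hW hWρ => by
    obtain ⟨m, hm, -⟩ := hμ.exists_slope hZ hF hφ hW hWρ
    exact ⟨m, hm, sub_ofReal_re_pos (hμ.abs_slope_mul_im_lt hZ hF hφ hW hWρ hm),
      hq.straighten_gap hμ hZ hF hφ hW hWρ hm⟩
  intro ζ hζ ζ' hζ' he
  simp only [mem_ofPred_eq] at hζ hζ'
  rcases eq_or_ne ζ 0 with rfl | hne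
  · rw [straighten_zero] at he
    exact (h0 _ hζ' he.symm).symm
  rcases eq_or_ne ζ' 0 with rfl | hne'
  · rw [straighten_zero] at he
    exact h0 _ hζ he
  rcases hZ.isRay_or_gap hF hφ hne with ⟨r, β, hr, hβ, rfl⟩ | ⟨μ, W, hμ, hW, rfl⟩ <;>
    rcases hZ.isRay_or_gap hF hφ hne' with ⟨r', β', hr', hβ', rfl⟩ | ⟨μ', W', hμ', hW', rfl⟩
  · rw [norm_ofReal_mul_cis hr.le] at hζ
    rw [norm_ofReal_mul_cis hr'.le] at hζ'
    rwa [hq.straighten_ray hr hβ hζ, hq.straighten_ray hr' hβ' hζ'] at he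
  · rw [norm_ofReal_mul_cis hr.le] at hζ
    rw [norm_sector_symm_rpow] at hζ'
    obtain ⟨m, hm, hre, hs⟩ := hgap μ' W' hμ' hW' hζ'
    rw [hq.straighten_ray hr hβ hζ, hs] at he
    exact (hμ'.ne_of_isRay hre hr hβ he).elim
  · rw [norm_ofReal_mul_cis hr'.le] at hζ'
    rw [norm_sector_symm_rpow] at hζ
    obtain ⟨m, hm, hre, hs⟩ := hgap μ W hμ hW hζ
    rw [hq.straighten_ray hr' hβ' hζ', hs] at he
    exact (hμ.ne_of_isRay hre hr' hβ' he.symm).elim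
  · rw [norm_sector_symm_rpow] at hζ hζ'
    obtain ⟨m, hm, hre, hs⟩ := hgap μ W hμ hW hζ
    obtain ⟨m', hm', hre', hs'⟩ := hgap μ' W' hμ' hW' hζ'
    rw [hs, hs'] at he
    obtain ⟨hcis, he'⟩ := hμ.eq_of_symm_eq hμ' hre hre' he
    rw [← coneChart_congr hcis] at hm'
    rw [hμ.shear_injective hZ hF hφ hW hζ hW' hζ' hm hm' he', sector_congr hcis]

theorem IsShearing.exists_straighten_eq (hq : IsShearing F n ρ Z q) (hZ : IsNatCoord φ M n C ρ Z)
    (hF : F.IsGeodesic φ M) (hφ : ContinuousOn φ M) {η : ℂ} (hη : ‖η‖ ^ expt n < ρ ^ expt n / 4) :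
    ∃ ζ, ‖ζ‖ ^ expt n ≤ 2 * ‖η‖ ^ expt n ∧ straighten n q ζ = η := by
  rcases eq_or_ne η 0 with rfl | h0
  · refine ⟨0, ?_, straighten_zero n q⟩
    rw [norm_zero, Real.zero_rpow (expt_pos n).ne', mul_zero]
  rcases hZ.isRay_or_gap hF hφ h0 with ⟨r, β, hr, hβ, rfl⟩ | ⟨μ, W, hμ, hW, rfl⟩
  · rw [norm_ofReal_mul_cis hr.le] at hη
    refine ⟨r * cis β, ?_, hq.straighten_ray hr hβ (by linarith [hZ.rpow_pos])⟩
    have : 0 ≤ ‖(r : ℂ) * cis β‖ ^ expt n := by positivity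
    linarith
  · rw [norm_sector_symm_rpow] at hη ⊢
    obtain ⟨V, m, hV, hVn, hm, he⟩ := hμ.exists_shear_eq hZ hF hφ hW hη
    refine ⟨(sector n μ).symm V, by rwa [norm_sector_symm_rpow], ?_⟩
    rw [hq.straighten_gap hμ hZ hF hφ hV (by linarith) hm, he]

theorem IsShearing.exists_openPartialHomeomorph (hq : IsShearing F n ρ Z q)
    (hZ : IsNatCoord φ M n C ρ Z) (hF : F.IsGeodesic φ M) (hφ : ContinuousOn φ M) :
    ∃ e : OpenPartialHomeomorph ℂ ℂ, (∀ ζ, e ζ = straighten n q ζ) ∧ (0 : ℂ) ∈ e.source ∧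
      ∀ ζ ∈ e.source, ‖ζ‖ ^ expt n < ρ ^ expt n / 2 := by
  have hk := expt_pos n
  have hR := hZ.rpow_pos
  have hcont : Continuous fun ζ : ℂ => ‖ζ‖ ^ expt n :=
    continuous_norm.rpow_const fun _ => Or.inr hk.le
  have hlt : ∀ ζ : ℂ, ‖ζ‖ ^ expt n ≤ ρ ^ expt n / 8 → ‖ζ‖ ^ expt n < ρ ^ expt n / 2 :=
    fun ζ hζ => by linarith
  have hK : IsCompact {ζ : ℂ | ‖ζ‖ ^ expt n ≤ ρ ^ expt n / 8} := by
    refine (isCompact_closedBall (0 : ℂ) ρ).of_isClosed_subset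
      (isClosed_le hcont continuous_const) fun ζ hζ => ?_
    rw [mem_closedBall_zero_iff, ← Real.rpow_le_rpow_iff (norm_nonneg ζ) hZ.ρ_pos.le hk]
    have := hlt ζ hζ
    linarith
  -- With R = ρ^k: a value with norm^k below R/16 has a preimage with norm^k below 2 · R/16 = R/8.
  -- Conversely ‖q‖ ≤ 1/4 where norm^k ≤ R/8, so points over V satisfy norm^k < (4/3) · R/16 < R/8
  -- and are interior.
  obtain ⟨e, he, hes, -⟩ := exists_openPartialHomeomorph_of_compact hK
    (f := straighten n q) (V := {ζ : ℂ | ‖ζ‖ ^ expt n < ρ ^ expt n / 16})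
    (fun ζ hζ => (hq.continuousAt_straighten hZ hF hφ (hlt ζ hζ)).continuousWithinAt)
    ((hq.injOn_straighten hZ hF hφ).mono hlt) (isOpen_lt hcont continuous_const)
    (fun η hη => by
      have hη' : ‖η‖ ^ expt n < ρ ^ expt n / 16 := hη
      obtain ⟨ζ, hζ, hζη⟩ := hq.exists_straighten_eq hZ hF hφ (η := η) (by linarith)
      exact ⟨ζ, by rw [mem_ofPred_eq]; linarith, hζη⟩)
    (fun ζ hζ hfζ => by
      have hζ' : ‖ζ‖ ^ expt n ≤ ρ ^ expt n / 8 := hζ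
      have h1 : ‖straighten n q ζ‖ ^ expt n < ρ ^ expt n / 16 := hfζ
      rw [norm_straighten_rpow] at h1
      have h2 := hq.norm_le hZ hF hφ (hlt ζ hζ)
      rw [le_div_iff₀ hR] at h2
      have h3 : 3 / 4 ≤ ‖1 - q ζ‖ := by
        have h4 : ‖(1 : ℂ)‖ - ‖q ζ‖ ≤ ‖1 - q ζ‖ := norm_sub_norm_le _ _
        rw [norm_one] at h4
        have h5 : ‖q ζ‖ ≤ 1 / 4 := by
          by_contra h6
          nlinarith
        linarith
      have h4 : ‖ζ‖ ^ expt n * (3 / 4) ≤ ‖ζ‖ ^ expt n * ‖1 - q ζ‖ :=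
        mul_le_mul_of_nonneg_left h3 (by positivity)
      refine mem_interior.2 ⟨{ζ : ℂ | ‖ζ‖ ^ expt n < ρ ^ expt n / 8}, fun x hx => ?_,
        isOpen_lt hcont continuous_const, ?_⟩
      · have hx' : ‖x‖ ^ expt n < ρ ^ expt n / 8 := hx
        exact hx'.le
      · rw [mem_ofPred_eq]; linarith)
  refine ⟨e, he, ?_, fun ζ hζ => ?_⟩
  · rw [hes]
    constructor
    · rw [mem_ofPred_eq, norm_zero, Real.zero_rpow hk.ne']; positivity
    · rw [mem_preimage, mem_ofPred_eq, straighten_zero, norm_zero, Real.zero_rpow hk.ne']; positivity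
  · rw [hes] at hζ
    exact hlt ζ hζ.1

end Geodesic

/-! ### The word of a geodesic foliation -/

theorem tiles_append (n : ℕ) (θ : ℝ) (u v : Word) :
    tiles n θ (u ++ v) = tiles n θ u ++ tiles n (θ - wordWeight n u) v := by
  induction u generalizing θ with
  | nil => simp [tiles, wordWeight_nil]
  | cons s u ih => simp only [List.cons_append, tiles, ih, wordWeight_cons, sub_sub]

section Geodesic

variable {φ : ℂ → ℂ} {M : Set ℂ} {n : ℕ} {C ρ : ℝ} {Z : OpenPartialHomeomorph ℂ ℂ}
  {F : Foliation (M \ {0})} {μ θ : ℝ} {W : ℂ} {q : ℂ → ℂ} {w : Word}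

/-- The sector of type `s` and first boundary ray of argument `c` is filled by radial leaves if
`s` is a symbol `p`, and is a gap if `s` is the symbol `h`. -/
def FitsTile (F : Foliation (M \ {0})) (n : ℕ) (ρ : ℝ) (Z : OpenPartialHomeomorph ℂ ℂ) (c : ℝ) :
    Letter → Prop
  | .h => IsGap F n ρ Z (c - gap n / 2)
  | .p α => ∀ β ∈ Icc (c - α) c, IsRay F n ρ Z β

/-- Both ends of the angular interval being radial leaves, a gap that meets it lies inside it.
Removing such a gap leaves two intervals, each shorter by at least `gap n`, which drives the
induction. An interval without gaps is one parabolic sector. -/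
theorem IsNatCoord.exists_word_of_lt (hZ : IsNatCoord φ M n C ρ Z) (hF : F.IsGeodesic φ M)
    (hφ : ContinuousOn φ M) (N : ℕ) {c L : ℝ} (hL : 0 ≤ L) (hLN : L < N * gap n)
    (hc : IsRay F n ρ Z c) (hcL : IsRay F n ρ Z (c - L)) :
    ∃ w, wordWeight n w = L ∧ ∀ c' s, (c', s) ∈ tiles n c w → FitsTile F n ρ Z c' s := by
  induction N generalizing c L with
  | zero =>
    rw [Nat.cast_zero, zero_mul] at hLN
    linarith
  | succ N ih =>
    push_cast at hLN
    by_cases hall : ∀ β ∈ Icc (c - L) c, IsRay F n ρ Z β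
    · rcases hL.eq_or_lt with rfl | hL'
      -- An interval reduced to one ray gets the empty word, since a symbol `p` needs positive
      -- weight.
      · exact ⟨[], wordWeight_nil n, fun c' s h => by simp [tiles] at h⟩
      · refine ⟨[.p ⟨L, hL'⟩], by simp [wordWeight, Letter.weight], fun c' s h => ?_⟩
        simp only [tiles, List.mem_singleton, Prod.mk.injEq] at h
        obtain ⟨rfl, rfl⟩ := h
        exact hall
    · push Not at hall
      obtain ⟨β, hβ, hβr⟩ := hall
      obtain ⟨μ, hμ, hd⟩ := hZ.exists_isGap hF hφ hβr
      have hd := abs_lt.1 hd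
      have h1 : gap n / 2 ≤ |c - μ| := not_lt.1 fun h => hμ.not_isRay c h hc
      have h2 : gap n / 2 ≤ |c - L - μ| := not_lt.1 fun h => hμ.not_isRay _ h hcL
      have h3 : μ + gap n / 2 ≤ c := by
        rcases le_abs.1 h1 with h | h
        · linarith
        · linarith [hβ.2]
      have h4 : c - L ≤ μ - gap n / 2 := by
        rcases le_abs.1 h2 with h | h
        · linarith [hβ.1]
        · linarith
      obtain ⟨u, hu, hut⟩ := ih (c := c) (L := c - (μ + gap n / 2)) (by linarith)
        (by nlinarith) hc (by rw [sub_sub_cancel]; exact hμ.right)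
      obtain ⟨v, hv, hvt⟩ := ih (c := μ - gap n / 2) (L := μ - gap n / 2 - (c - L)) (by linarith)
        (by nlinarith) hμ.left (by rw [sub_sub_cancel]; exact hcL)
      refine ⟨u ++ .h :: v, ?_, fun c' s h => ?_⟩
      · rw [wordWeight_append, wordWeight_cons, hu, hv, weight_h]
        ring
      · rw [tiles_append, List.mem_append, hu, sub_sub_cancel, tiles, List.mem_cons, weight_h,
          show μ + gap n / 2 - gap n = μ - gap n / 2 by ring] at h
        rcases h with h | h | h
        · exact hut _ _ h
        · obtain ⟨rfl, rfl⟩ := Prod.mk.inj h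
          change IsGap F n ρ Z (μ + gap n / 2 - gap n / 2)
          rwa [add_sub_cancel_right]
        · exact hvt _ _ h

/-- The radial leaves and the gaps are arranged around `0` as prescribed by a word. -/
theorem IsNatCoord.exists_word (hZ : IsNatCoord φ M n C ρ Z) (hF : F.IsGeodesic φ M)
    (hφ : ContinuousOn φ M) : ∃ (θ : ℝ) (w : Word), wordWeight n w = 2 * Real.pi ∧
      ∀ c s, IsTile n θ w c s → FitsTile F n ρ Z c s := by
  obtain ⟨θ, hθ⟩ : ∃ θ, IsRay F n ρ Z θ := by
    by_cases h : IsRay F n ρ Z 0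
    · exact ⟨0, h⟩
    · obtain ⟨μ, hμ, -⟩ := hZ.exists_isGap hF hφ h
      exact ⟨_, hμ.left⟩
  obtain ⟨N, hN⟩ := exists_nat_gt (2 * Real.pi / gap n)
  rw [div_lt_iff₀ (gap_pos n)] at hN
  obtain ⟨w, hw, hwt⟩ := hZ.exists_word_of_lt hF hφ N (by positivity) hN hθ (by
    have := hθ.add_int_mul (-1)
    convert this using 1
    push_cast; ring)
  refine ⟨θ, w, hw, fun c s ⟨j, hj⟩ => ?_⟩
  have h1 := hwt _ _ hj
  cases s with
  | h =>
    have h2 := IsGap.add_int_mul h1 (-j)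
    change IsGap F n ρ Z (c - gap n / 2)
    convert h2 using 1
    push_cast; ring
  | p α =>
    intro β hβ
    rw [← isRay_add_int_mul_iff j]
    exact h1 _ ⟨by linarith [hβ.1], by linarith [hβ.2]⟩

/-- The tile containing the axis of the gap is not parabolic, as the axis is not a leaf. If
hyperbolic, it is a gap overlapping the given one and hence equal to it. -/
theorem IsGap.isTile (h : IsGap F n ρ Z μ) (hw : wordWeight n w = 2 * Real.pi)
    (hfit : ∀ c s, IsTile n θ w c s → FitsTile F n ρ Z c s) :
    IsTile n θ w (μ + gap n / 2) .h := by
  have hg := gap_pos n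
  obtain ⟨c, s, ht, h1, h2⟩ := exists_isTile_right (θ := θ) hw μ
  cases s with
  | h =>
    rw [weight_h] at h1
    have h3 : IsGap F n ρ Z (c - gap n / 2) := hfit _ _ ht
    have h4 := h.eq_of_abs_sub_lt h3 (abs_lt.2 ⟨by linarith, by linarith⟩)
    rwa [h4, sub_add_cancel]
  | p α =>
    exact (h.not_isRay μ (by rw [sub_self, abs_zero]; linarith) (hfit _ _ ht μ ⟨h1, h2.le⟩)).elim

/-- A radial leaf runs inside a parabolic tile or along the boundary of a hyperbolic one, where the
level is 0 at every radius. -/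
theorem IsRay.modelRel {β : ℝ} (h : IsRay F n ρ Z β) (hn : 1 ≤ n)
    (hw : wordWeight n w = 2 * Real.pi) (hfit : ∀ c s, IsTile n θ w c s → FitsTile F n ρ Z c s)
    {r r' : ℝ} (hr : 0 < r) (hr' : 0 < r') : ModelRel n θ w (r * cis β) (r' * cis β) := by
  have hg := gap_pos n
  rw [modelRel_iff_exists_isTile hn hr hr' (by rw [sub_self, abs_zero]; positivity)]
  obtain ⟨c, s, ht, h1, h2⟩ := exists_isTile_right (θ := θ) hw β
  refine ⟨c, s, ht, ⟨h1, h2.le⟩, ⟨h1, h2.le⟩, ?_⟩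
  cases s with
  | h =>
    rw [weight_h] at h1
    have h3 : IsGap F n ρ Z (c - gap n / 2) := hfit _ _ ht
    have h4 : gap n / 2 ≤ |β - (c - gap n / 2)| := not_lt.1 fun h' => h3.not_isRay β h' h
    have h5 : c - β = gap n := by
      rcases le_abs.1 h4 with h | h <;> linarith
    simp only [level]
    rw [h5, expt_mul_gap, Real.sin_pi, mul_zero, mul_zero]
  | p α => rfl

/-- A geodesic foliation has at the zero the singularity encoded by some word. -/
theorem Foliation.IsGeodesic.exists_hasSingularity (hF : F.IsGeodesic φ M) (hn : 1 ≤ n)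
    (hM : IsZeroNbhd φ n M) :
    ∃ w, wordWeight n w = 2 * Real.pi ∧ F.HasSingularity n w := by
  have hφ : ContinuousOn φ M := hM.holomorphic.continuousOn
  obtain ⟨C, ρ, Z, hZ⟩ := exists_isNatCoord hM
  obtain ⟨θ, w, hw, hfit⟩ := hZ.exists_word hF hφ
  obtain ⟨q, hq⟩ := hZ.exists_isShearing hF hφ
  obtain ⟨e, he, he0, hes⟩ := hq.exists_openPartialHomeomorph hZ hF hφ
  have hefun : (e : ℂ → ℂ) = straighten n q := funext he
  refine ⟨w, hw, θ, Z.trans e, ?_, ?_, ?_, ?_, ?_⟩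
  · rw [OpenPartialHomeomorph.trans_source]
    exact ⟨hZ.zero_mem, by rwa [mem_preimage, hZ.map_zero]⟩
  · rw [OpenPartialHomeomorph.trans_apply, hZ.map_zero, he, straighten_zero]
  · intro z hz
    exact ⟨hZ.source_subset hz.1.1, hz.2⟩
  · have h1 : HasDerivAt e 1 (Z 0) := by
      rw [hefun, hZ.map_zero]
      exact hq.hasDerivAt_straighten hZ hF hφ
    have h2 := h1.comp (0 : ℂ) hZ.hasDerivAt_zero
    rwa [one_mul] at h2
  intro z ⟨hzs, hz0⟩ e₀ he₀ hze₀
  set Ψ := Z.trans e with hΨ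
  have hΨ0 : Ψ z ≠ 0 := fun h => hz0 (Ψ.injOn hzs (by
    rw [hΨ, OpenPartialHomeomorph.trans_source]
    exact ⟨hZ.zero_mem, by rwa [mem_preimage, hZ.map_zero]⟩) (by
    rw [h, hΨ, OpenPartialHomeomorph.trans_apply, hZ.map_zero, he, straighten_zero]))
  obtain ⟨E, hE, hzE⟩ := exists_isModelChart (θ := θ) hn hw hΨ0
  have hzE' : z ∈ (Ψ.trans E).source := by
    rw [OpenPartialHomeomorph.trans_source]
    exact ⟨hzs, hzE⟩
  have hsrc : ∀ᶠ z' in 𝓝 z, z' ∈ (Ψ.trans E).source :=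
    (Ψ.trans E).open_source.mem_nhds hzE'
  -- By `eventually_plaque_iff` it is enough to find through each nearby point an arc of its leaf
  -- that `Ψ` takes into one leaf of the model.
  suffices h : ∀ᶠ z' in 𝓝 z, HasCommonArc e₀ (Ψ.trans E) z' by
    have h1 := eventually_plaque_iff hze₀ hzE' h
    filter_upwards [h1, by rw [nhds_prod_eq]; exact hsrc.prod_mk hsrc] with p h2 ⟨h3, h4⟩
    rw [OpenPartialHomeomorph.trans_source] at h3 h4
    rw [h2]
    exact hE _ h3.2 _ h4.2
  filter_upwards [e₀.open_source.mem_nhds hze₀, hsrc, isOpen_ne.mem_nhds hz0] with z' h1 h2 h3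
  have h2' := h2
  rw [OpenPartialHomeomorph.trans_source] at h2'
  obtain ⟨hz'Ψ, hz'E⟩ := h2'
  have hζ0 : Z z' ≠ 0 := hZ.apply_ne_zero hz'Ψ.1 h3
  have hζρ : ‖Z z'‖ ^ expt n < ρ ^ expt n / 2 := hes _ hz'Ψ.2
  have hR := hZ.rpow_pos
  have hk := expt_pos n
  suffices key : ∃ (μ : ℝ) (W u : ℂ), u ≠ 0 ∧ (coneChart n Z μ).symm W = z' ∧
      LeafDir F (coneChart n Z μ) W u ∧ ∀ᶠ t : ℝ in 𝓝 0, ModelRel n θ w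
        (straighten n q ((sector n μ).symm (W + t * u))) (straighten n q (Z z')) by
    obtain ⟨μ, W, u, hu, hWz, hdir, hrel⟩ := key
    set X := coneChart n Z μ with hX
    have hW0 : W + ((0 : ℝ) : ℂ) * u ∈ X.target := by simpa using hdir.1
    have hc := continuousAt_chart_line X u hW0
    have hc0 : X.symm (W + ((0 : ℝ) : ℂ) * u) = z' := by simpa using hWz
    have hes : ∀ᶠ t : ℝ in 𝓝 0, X.symm (W + t * u) ∈ e₀.source ∩ (Ψ.trans E).source :=
      hc (by
        beta_reduce
        rw [hc0]
        exact (e₀.open_source.inter (Ψ.trans E).open_source).mem_nhds ⟨h1, h2⟩)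
    obtain ⟨ε, hε, hεs⟩ := Metric.nhds_basis_closedBall.mem_iff.1
      ((eventually_line_mem_target X u hW0).and (hes.and ((hdir.2 e₀ he₀ (by rwa [hWz])).and hrel)))
    rw [Real.closedBall_eq_Icc, zero_sub, zero_add] at hεs
    refine ⟨fun t => X.symm (W + t * u), ε, hε, fun t ht =>
      (continuousAt_chart_line X u (hεs ht).1).continuousWithinAt, fun t ht t' ht' he => ?_, hc0,
      fun t ht => ?_⟩
    · have h4 := X.symm.injOn (hεs ht).1 (hεs ht').1 he
      have h5 := mul_right_cancel₀ hu (add_left_cancel h4)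
      exact_mod_cast h5
    · obtain ⟨ht1, ⟨ht2, ht3⟩, ht4, ht5⟩ := hεs ht
      refine ⟨ht2, ht3, by rw [ht4, hWz], ?_⟩
      rw [OpenPartialHomeomorph.trans_source] at ht3
      refine (hE _ ht3.2 _ hz'E).2 ?_
      have h6 : Z (X.symm (W + t * u)) = (sector n μ).symm (W + t * u) := Z.right_inv ht1.2
      change ModelRel n θ w (e (Z (X.symm (W + t * u)))) (e (Z z'))
      rw [h6, he, he]
      exact ht5
  have hsymm : ∀ (μ : ℝ) (W : ℂ), Z z' = (sector n μ).symm W → (coneChart n Z μ).symm W = z' :=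
    fun μ W h => by
    change Z.symm ((sector n μ).symm W) = z'
    rw [← h, Z.left_inv hz'Ψ.1]
  -- The arc is a straight piece of the leaf: a piece of a fixed ray, or a line of direction m + i
  -- that the shear makes vertical.
  rcases hZ.isRay_or_gap hF hφ hζ0 with ⟨r, β, hr, hβ, hζ⟩ | ⟨μ, W, hμ, hW, hζ⟩
  · have hrk : 0 < r ^ expt n := Real.rpow_pos_of_pos hr _
    rw [hζ, norm_ofReal_mul_cis hr.le] at hζρ
    have hpt : ∀ x : ℝ, 0 < x →
        (sector n β).symm (x : ℂ) = ((x ^ (1 / expt n) : ℝ) : ℂ) * cis β := fun x hx => by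
      rw [sectorChart_symm_eq_polar n β (by exact_mod_cast hx.ne'), Complex.norm_real,
        Real.norm_of_nonneg hx.le, Complex.arg_ofReal_of_nonneg hx.le, zero_div, add_zero]
    refine ⟨β, ((r ^ expt n : ℝ) : ℂ), 1, one_ne_zero, hsymm _ _ ?_, hβ _ hrk (by linarith), ?_⟩
    · rw [hpt _ hrk, ← Real.rpow_mul hr.le, mul_one_div_cancel hk.ne', Real.rpow_one, hζ]
    · have hev : ∀ᶠ t : ℝ in 𝓝 0, 0 < r ^ expt n + t ∧ r ^ expt n + t < ρ ^ expt n / 2 := by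
        have h4 : ContinuousAt (fun t : ℝ => r ^ expt n + t) 0 := by fun_prop
        exact h4 (Ioo_mem_nhds (by simpa using hrk) (by simpa using hζρ))
      filter_upwards [hev] with t ⟨ht, ht'⟩
      rw [mul_one, ← Complex.ofReal_add, hpt _ ht, hζ, hq.straighten_ray hr hβ hζρ,
        hq.straighten_ray (by positivity) hβ (by
          rwa [← Real.rpow_mul ht.le, one_div_mul_cancel hk.ne', Real.rpow_one])]
      exact hβ.modelRel hn hw hfit (by positivity) hr
  · rw [hζ, norm_sector_symm_rpow] at hζρ
    obtain ⟨m, hm, -⟩ := hμ.exists_slope hZ hF hφ hW hζρ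
    refine ⟨μ, W, m + Complex.I, ofReal_add_I_ne_zero m, hsymm _ _ hζ, hm, ?_⟩
    have hcont : ContinuousAt (fun t : ℝ => W + t * ((m : ℂ) + Complex.I)) 0 := by fun_prop
    have hre : ∀ᶠ t : ℝ in 𝓝 0, 0 < (W + t * ((m : ℂ) + Complex.I)).re :=
      hcont (IsOpen.mem_nhds (isOpen_lt continuous_const Complex.continuous_re) (by simpa using hW))
    have hnorm : ∀ᶠ t : ℝ in 𝓝 0, ‖W + t * ((m : ℂ) + Complex.I)‖ < ρ ^ expt n / 2 :=
      hcont (IsOpen.mem_nhds (isOpen_lt continuous_norm continuous_const) (by simpa using hζρ))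
    filter_upwards [hre, hnorm, hm.eventually_add (hZ.coneChart_source_subset μ)] with t h4 h5 h6
    have h7 := sub_ofReal_re_pos (hμ.abs_slope_mul_im_lt hZ hF hφ hW hζρ hm)
    have h8 := sub_ofReal_re_pos (hμ.abs_slope_mul_im_lt hZ hF hφ h4 h5 h6)
    have hne : ∀ V : ℂ, 0 < V.re → V ≠ 0 := fun V hV h => by simp [h] at hV
    rw [hζ, hq.straighten_gap hμ hZ hF hφ hW hζρ hm, hq.straighten_gap hμ hZ hF hφ h4 h5 h6]
    -- Along the leaf the slope stays `m`, so Re W - m Im W is constant: the sheared points lie on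
    -- one vertical line.
    refine (hμ.isTile hw hfit).modelRel_h hn (hne _ h8) (hne _ h7) h8.le h7.le ?_
    simp
    ring

end Geodesic

end QuadDiff

theorem lemma2 (n : ℕ) (hn : 1 ≤ n) (φ : ℂ → ℂ) (M : Set ℂ) (hM : QuadDiff.IsZeroNbhd φ n M) :
    (∀ F : QuadDiff.Foliation (M \ {0}), F.IsGeodesic φ M →
      ∃ c : QuadDiff.WordClass, c.IsNormalized n ∧
        ∀ w : QuadDiff.Word, w.toClass = c → F.HasSingularity n w) ∧
    (∀ c : QuadDiff.WordClass, c.IsNormalized n →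
      ∃ U : Set ℂ, U ⊆ M ∧ QuadDiff.IsZeroNbhd φ n U ∧
        ∃ F : QuadDiff.Foliation (U \ {0}), F.IsGeodesic φ U ∧
          ∀ w : QuadDiff.Word, w.toClass = c → F.HasSingularity n w) :=
  ⟨fun _ hF => by
    obtain ⟨w, hw, h⟩ := hF.exists_hasSingularity hn hM
    exact ⟨w.toClass, QuadDiff.isNormalized_toClass hw, fun w' hw' => h.of_toClass_eq hw hw'⟩,
   fun c hc => QuadDiff.exists_foliation_hasSingularity hn hM c hc⟩
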